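/- Let $(M,g)$ and $(N,h)$ be smooth Riemannian manifolds (finite-dimensional, without boundary) and let $\varphi\colon M\to N$ be a smooth submersive map (that is, $d\varphi(x)\colon T_xM\to T_{\varphi(x)}N$ is surjective for every $x\in M$) which is a harmonic morphism: for every open $U\subseteq N$ and every harmonic function $f\colon U\to\mathbb R$, the composition $f\circ\varphi\colon\varphi^{-1}(U)\to\mathbb R$ is harmonic. Write $\|d\varphi\|^2=\operatorname{Tr}(d\varphi^{T}d\varphi)\colon M\to\mathbb R$ for the squared Hilbert--Schmidt norm of the differential, and $\nabla\|d\varphi\|^2$ for its gradient on $(M,g)$. Let $B\subset N$ be a minimal (embedded, not necessarily closed) submanifold of codimension $p$ with $p\neq 2$, i.e. a submanifold whose mean curvature vector vanishes identically. Then the following are equivalent: (i) $d\varphi\big(\nabla\|d\varphi\|^2(x)\big)\in T_{\varphi(x)}B$ for all $x\in\varphi^{-1}(B)$; (ii) $\varphi^{-1}(B)$ is a minimal submanifold of $M$ of codimension $p$. -/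

import Mathlib

open Bundle Set Filter VectorField
open scoped Manifold ContDiff Topology

noncomputable section

namespace RiemGeom

section LeviCivita

variable {E : Type*} [NormedAddCommGroup E] [NormedSpace ℝ E] [FiniteDimensional ℝ E]
  {H : Type*} [TopologicalSpace H] (I : ModelWithCorners ℝ E H)
  {M : Type*} [TopologicalSpace M] [ChartedSpace H M]

instance instFiniteDimensionalTangentSpace (x : M) : FiniteDimensional ℝ (TangentSpace I x) :=
  inferInstanceAs (FiniteDimensional ℝ E)

variable [RiemannianBundle (fun x : M ↦ TangentSpace I x)]

/-- The right-hand side of the Koszul formula for `⟨∇_X Y, Z⟩` at `x`. -/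
def koszul (Y X Z : Π x : M, TangentSpace I x) (x : M) : ℝ :=
  (1 / 2) * (d% (fun y ↦ inner ℝ (Y y) (Z y)) x (X x) + d% (fun y ↦ inner ℝ (X y) (Z y)) x (Y x)
    - d% (fun y ↦ inner ℝ (X y) (Y y)) x (Z x) + inner ℝ (mlieBracket I X Y x) (Z x)
    - inner ℝ (mlieBracket I X Z x) (Y x) - inner ℝ (mlieBracket I Y Z x) (X x))

variable [IsManifold I ∞ M] [IsContMDiffRiemannianBundle I ∞ E (fun x : M ↦ TangentSpace I x)]

lemma mdifferentiableAt_inner {Y Z : Π x : M, TangentSpace I x} {x : M}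
    (hY : MDiffAt (T% Y) x) (hZ : MDiffAt (T% Z) x) :
    MDiffAt (fun y ↦ inner ℝ (Y y) (Z y)) x :=
  MDifferentiableAt.inner_bundle (F := E) (E := fun x : M ↦ TangentSpace I x) (IB := I)
    (b := id) hY hZ

lemma koszul_tensorial_left {Y Z : Π x : M, TangentSpace I x} {x : M}
    (hY : MDiffAt (T% Y) x) (hZ : MDiffAt (T% Z) x) :
    TensorialAt I E (fun X ↦ koszul I Y X Z x) x where
  smul {f X} hf hX := by
    have h1 := mdifferentiableAt_inner I hX hZ
    have h2 := mdifferentiableAt_inner I hX hY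
    simp only [koszul, mlieBracket_smul_left hf hX, Pi.smul_apply', real_inner_smul_left,
      real_inner_smul_right, inner_add_left, mvfderiv_fun_mul hf h1, mvfderiv_fun_mul hf h2]
    simp
    rw [real_inner_comm (X x) (mlieBracket I Y Z x)]
    ring
  add {X X'} hX hX' := by
    simp only [koszul, mlieBracket_add_left hX hX', Pi.add_apply, inner_add_left,
      inner_add_right, mvfderiv_fun_add (mdifferentiableAt_inner I hX hZ)
        (mdifferentiableAt_inner I hX' hZ),
      mvfderiv_fun_add (mdifferentiableAt_inner I hX hY) (mdifferentiableAt_inner I hX' hY),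
      map_add]
    simp
    ring

lemma koszul_tensorial_right {Y X : Π x : M, TangentSpace I x} {x : M}
    (hY : MDiffAt (T% Y) x) (hX : MDiffAt (T% X) x) :
    TensorialAt I E (fun Z ↦ koszul I Y X Z x) x where
  smul {f Z} hf hZ := by
    have h1 := mdifferentiableAt_inner I hY hZ
    have h2 := mdifferentiableAt_inner I hX hZ
    simp only [koszul, mlieBracket_smul_right hf hZ, Pi.smul_apply', real_inner_smul_right,
      real_inner_smul_left, inner_add_left, mvfderiv_fun_mul hf h1, mvfderiv_fun_mul hf h2]
    simp
    rw [real_inner_comm (Z x) (Y x), real_inner_comm (Z x) (X x)]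
    ring
  add {Z Z'} hZ hZ' := by
    simp only [koszul, mlieBracket_add_right hZ hZ', Pi.add_apply, inner_add_left,
      inner_add_right, mvfderiv_fun_add (mdifferentiableAt_inner I hX hZ)
        (mdifferentiableAt_inner I hX hZ'),
      mvfderiv_fun_add (mdifferentiableAt_inner I hY hZ) (mdifferentiableAt_inner I hY hZ'),
      map_add]
    simp
    ring

open Classical in
/-- `leviCivitaFun I Y x v` is `∇_v Y`: the vector representing the functional `Z ↦ koszul I Y V Z x`,
which is tensorial in `Z` and in `V` (where `V x = v`). Sections not differentiable at `x` get the
value `0`. -/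
def leviCivitaFun (Y : Π x : M, TangentSpace I x) (x : M) :
    TangentSpace I x →L[ℝ] TangentSpace I x :=
  if hY : MDiffAt (T% Y) x then
    InnerProductSpace.continuousLinearMapOfBilin (𝕜 := ℝ)
      (TensorialAt.mkHom₂ (fun X Z ↦ koszul I Y X Z x) x
        (fun _ hZ ↦ koszul_tensorial_left I hY hZ) (fun _ hX ↦ koszul_tensorial_right I hY hX))
  else 0

lemma inner_leviCivitaFun {Y X Z : Π x : M, TangentSpace I x} {x : M}
    (hY : MDiffAt (T% Y) x) (hX : MDiffAt (T% X) x) (hZ : MDiffAt (T% Z) x) :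
    inner ℝ (leviCivitaFun I Y x (X x)) (Z x) = koszul I Y X Z x := by
  rw [leviCivitaFun, dif_pos hY, InnerProductSpace.continuousLinearMapOfBilin_apply]
  exact TensorialAt.mkHom₂_apply _ _ hX hZ

lemma clm_ext_sections {x : M} {A B : TangentSpace I x →L[ℝ] TangentSpace I x}
    (h : ∀ X Z : Π x : M, TangentSpace I x, MDiffAt (T% X) x → MDiffAt (T% Z) x →
      inner ℝ (A (X x)) (Z x) = inner ℝ (B (X x)) (Z x)) : A = B := by
  ext v
  refine ext_inner_right ℝ fun z ↦ ?_
  have := h (FiberBundle.extend E v) (FiberBundle.extend E z)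
    (FiberBundle.mdifferentiableAt_extend I E v) (FiberBundle.mdifferentiableAt_extend I E z)
  simpa using this

variable (M) in
/-- The Levi-Civita connection of the Riemannian manifold `M`, given by the Koszul formula. -/
def leviCivita : CovariantDerivative I E (fun x : M ↦ TangentSpace I x) where
  toFun := leviCivitaFun I
  isCovariantDerivativeOnUniv :=
    { add := by
        intro Y Y' x hY hY' _
        refine clm_ext_sections I fun X Z hX hZ ↦ ?_
        rw [add_apply, inner_add_left,
          inner_leviCivitaFun I (mdifferentiableAt_add_section hY hY') hX hZ,
          inner_leviCivitaFun I hY hX hZ, inner_leviCivitaFun I hY' hX hZ]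
        simp only [koszul, mlieBracket_add_right hY hY', mlieBracket_add_left hY hY',
          Pi.add_apply, inner_add_left, inner_add_right,
          mvfderiv_fun_add (mdifferentiableAt_inner I hY hZ) (mdifferentiableAt_inner I hY' hZ),
          mvfderiv_fun_add (mdifferentiableAt_inner I hX hY) (mdifferentiableAt_inner I hX hY'),
          map_add]
        simp
        ring
      leibniz := by
        intro Y f x hY hf _
        refine clm_ext_sections I fun X Z hX hZ ↦ ?_
        have h1 := mdifferentiableAt_inner I hY hZ
        have h2 := mdifferentiableAt_inner I hX hY
        rw [add_apply, inner_add_left,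
          inner_leviCivitaFun I (hf.smul_section hY) hX hZ, smul_apply,
          real_inner_smul_left, inner_leviCivitaFun I hY hX hZ]
        simp only [koszul, mlieBracket_smul_right hf hY, mlieBracket_smul_left hf hY,
          Pi.smul_apply', real_inner_smul_right, real_inner_smul_left, inner_add_left,
          mvfderiv_fun_mul hf h1, mvfderiv_fun_mul hf h2]
        simp [real_inner_smul_left]
        rw [real_inner_comm (X x) (Y x)]
        ring }

lemma inner_leviCivita {Y X Z : Π x : M, TangentSpace I x} {x : M}
    (hY : MDiffAt (T% Y) x) (hX : MDiffAt (T% X) x) (hZ : MDiffAt (T% Z) x) :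
    inner ℝ (leviCivita I M Y x (X x)) (Z x) = koszul I Y X Z x :=
  inner_leviCivitaFun I hY hX hZ

/-- The Levi-Civita connection is torsion-free. -/
lemma leviCivita_torsion : (leviCivita I M).torsion = 0 := by
  rw [CovariantDerivative.torsion_eq_zero_iff]
  intro X Y x hX hY
  refine ext_inner_right ℝ fun z ↦ ?_
  obtain ⟨Z, hZ, rfl⟩ : ∃ Z : Π x : M, TangentSpace I x, MDiffAt (T% Z) x ∧ Z x = z :=
    ⟨FiberBundle.extend E z, FiberBundle.mdifferentiableAt_extend I E z, by simp⟩
  rw [inner_sub_left, inner_leviCivita I hY hX hZ, inner_leviCivita I hX hY hZ]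
  simp only [koszul, mlieBracket_swap_apply (V := Y) (W := X), inner_neg_left,
    fun y ↦ real_inner_comm (X y) (Y y)]
  ring

/-- The Levi-Civita connection is compatible with the metric. -/
lemma leviCivita_metric {X Y Z : Π x : M, TangentSpace I x} {x : M}
    (hX : MDiffAt (T% X) x) (hY : MDiffAt (T% Y) x) (hZ : MDiffAt (T% Z) x) :
    d% (fun y ↦ inner ℝ (Y y) (Z y)) x (X x) =
      inner ℝ (leviCivita I M Y x (X x)) (Z x) + inner ℝ (Y x) (leviCivita I M Z x (X x)) := by
  rw [real_inner_comm _ (Y x), inner_leviCivita I hY hX hZ, inner_leviCivita I hZ hX hY]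
  simp only [koszul, mlieBracket_swap_apply (V := Z) (W := Y), inner_neg_left,
    fun y ↦ real_inner_comm (Y y) (Z y)]
  ring

end LeviCivita

section Harmonic

variable {E : Type*} [NormedAddCommGroup E] [NormedSpace ℝ E] [FiniteDimensional ℝ E]
  {H : Type*} [TopologicalSpace H] (I : ModelWithCorners ℝ E H)
  {M : Type*} [TopologicalSpace M] [ChartedSpace H M]
  [RiemannianBundle (fun x : M ↦ TangentSpace I x)]

/-- The gradient of `f`: the vector field dual to `df` with respect to the metric. -/
def grad (f : M → ℝ) (x : M) : TangentSpace I x :=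
  (InnerProductSpace.toDual ℝ (TangentSpace I x)).symm (d% f x)

variable [IsManifold I ∞ M] [IsContMDiffRiemannianBundle I ∞ E (fun x : M ↦ TangentSpace I x)]

/-- The Laplace-Beltrami operator `Δ f = tr (v ↦ ∇_v grad f)`. -/
def laplacian (f : M → ℝ) (x : M) : ℝ :=
  LinearMap.trace ℝ (TangentSpace I x) (leviCivita I M (grad I f) x).toLinearMap

/-- `f` is a harmonic function on the open set `U`. The values of `f` off `U` play no role. -/
def IsHarmonicOn (f : M → ℝ) (U : Set M) : Prop :=
  ContMDiffOn I 𝓘(ℝ, ℝ) 2 f U ∧ ∀ x ∈ U, laplacian I f x = 0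

variable {E' : Type*} [NormedAddCommGroup E'] [NormedSpace ℝ E'] [FiniteDimensional ℝ E']
  {H' : Type*} [TopologicalSpace H'] (J : ModelWithCorners ℝ E' H')
  {N : Type*} [TopologicalSpace N] [ChartedSpace H' N]
  [RiemannianBundle (fun y : N ↦ TangentSpace J y)]

/-- The squared Hilbert-Schmidt norm `‖dφ‖² = tr (dφᵀ dφ)` of the differential. -/
def normSqDifferential (φ : M → N) (x : M) : ℝ :=
  LinearMap.trace ℝ (TangentSpace I x)
    (LinearMap.adjoint (mfderiv I J φ x).toLinearMap ∘ₗ (mfderiv I J φ x).toLinearMap)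

/-- A harmonic morphism is a smooth map which pulls back harmonic functions defined on open subsets
of the target to harmonic functions. -/
structure IsHarmonicMorphism [IsManifold J ∞ N]
    [IsContMDiffRiemannianBundle J ∞ E' (fun y : N ↦ TangentSpace J y)] (φ : M → N) : Prop where
  smooth : ContMDiff I J ∞ φ
  comp : ∀ (U : Set N) (f : N → ℝ), IsOpen U → IsHarmonicOn J f U →
    IsHarmonicOn I (f ∘ φ) (φ ⁻¹' U)

end Harmonic

section Submersive

variable {E : Type*} [NormedAddCommGroup E] [NormedSpace ℝ E]
  {H : Type*} [TopologicalSpace H] (I : ModelWithCorners ℝ E H)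
  {M : Type*} [TopologicalSpace M] [ChartedSpace H M]
  {E' : Type*} [NormedAddCommGroup E'] [NormedSpace ℝ E']
  {H' : Type*} [TopologicalSpace H'] (J : ModelWithCorners ℝ E' H')
  {N : Type*} [TopologicalSpace N] [ChartedSpace H' N]

/-- All differentials of `φ` are surjective. -/
def IsSubmersive (φ : M → N) : Prop :=
  ∀ x : M, Function.Surjective (mfderiv I J φ x)

end Submersive

section Submanifold

variable {E : Type*} [NormedAddCommGroup E] [NormedSpace ℝ E]
  {H : Type*} [TopologicalSpace H] (I : ModelWithCorners ℝ E H)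
  {M : Type*} [TopologicalSpace M] [ChartedSpace H M]

/-- `B` is an embedded smooth submanifold of codimension `p` (not necessarily closed): near each of
its points it is the zero set of a smooth submersion to `ℝ^p`. -/
def IsSubmanifold (p : ℕ) (B : Set M) : Prop :=
  ∀ x ∈ B, ∃ (U : Set M) (F : M → EuclideanSpace ℝ (Fin p)), IsOpen U ∧ x ∈ U ∧
    ContMDiffOn I 𝓘(ℝ, EuclideanSpace ℝ (Fin p)) ∞ F U ∧
    (∀ y ∈ U, Function.Surjective (d% F y)) ∧ B ∩ U = {y ∈ U | F y = 0}

/-- The tangent space `T_x B ⊆ T_x M` of a submanifold `B` at `x ∈ B`: the tangent vectors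
annihilating all smooth function germs at `x` which vanish on `B`. -/
def tangentSpaceOf (B : Set M) (x : M) : Submodule ℝ (TangentSpace I x) where
  carrier := {v | ∀ f : M → ℝ, (∀ᶠ y in 𝓝 x, ContMDiffAt I 𝓘(ℝ, ℝ) ∞ f y) →
    (∀ᶠ y in 𝓝[B] x, f y = 0) → d% f x v = 0}
  add_mem' := by
    intro v w hv hw f hf h
    rw [map_add, hv f hf h, hw f hf h, add_zero]
  zero_mem' := by
    intro f _ _
    exact map_zero _
  smul_mem' := by
    intro c v hv f hf h
    rw [map_smul, hv f hf h, smul_zero]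

/-- `W` is a smooth vector field near `x` with `W x = w` which is tangent to `B` along `B`. -/
structure IsTangentExtension [IsManifold I ∞ M] (B : Set M) (x : M) (w : TangentSpace I x)
    (W : Π y : M, TangentSpace I y) : Prop where
  smooth : ∀ᶠ y in 𝓝 x, ContMDiffAt I I.tangent ∞ (T% W) y
  apply_eq : W x = w
  tangent : ∀ᶠ y in 𝓝[B] x, W y ∈ tangentSpaceOf I B y

variable [FiniteDimensional ℝ E] [RiemannianBundle (fun x : M ↦ TangentSpace I x)]
  [IsManifold I ∞ M] [IsContMDiffRiemannianBundle I ∞ E (fun x : M ↦ TangentSpace I x)]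

open Classical in
/-- The second fundamental form of a submanifold `B` at `x ∈ B`: for `v, w ∈ T_x B`, the component
normal to `B` of `∇_v W`, where `W` is any smooth extension of `w` tangent to `B` (such extensions
exist, and the normal component does not depend on the choice). -/
def secondFundamentalForm (B : Set M) (x : M) (v w : TangentSpace I x) : TangentSpace I x :=
  if h : ∃ W : Π y : M, TangentSpace I y, IsTangentExtension I B x w W then
    (tangentSpaceOf I B x)ᗮ.starProjection (leviCivita I M h.choose x v)
  else 0

/-- The mean curvature vector of `B` at `x`: the trace over `T_x B` of the second fundamental
form. -/
def meanCurvature (B : Set M) (x : M) : TangentSpace I x :=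
  ∑ i, secondFundamentalForm I B x (stdOrthonormalBasis ℝ (tangentSpaceOf I B x) i)
    (stdOrthonormalBasis ℝ (tangentSpaceOf I B x) i)

/-- `B` is a minimal submanifold of codimension `p`: its mean curvature vanishes. -/
structure IsMinimalSubmanifold (p : ℕ) (B : Set M) : Prop where
  isSubmanifold : IsSubmanifold I p B
  meanCurvature_eq_zero : ∀ x ∈ B, meanCurvature I B x = 0

end Submanifold

end RiemGeom

end

open RiemGeom

open RiemGeom

set_option linter.unusedSectionVars false

section Analysis

open Set Filter MeasureTheory
open scoped ContDiff Topology

section Wiener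

variable {ι : Type*} [Fintype ι]

/-- The plane wave `x ↦ exp (2πi ⟨ξ, x⟩)`. -/
noncomputable def planeWave (ξ x : ι → ℝ) : ℂ :=
  Complex.exp ((2 * Real.pi * ∑ j, ξ j * x j : ℝ) * Complex.I)

/-- The linear form `v ↦ 2πi ⟨ξ, v⟩`. -/
noncomputable def planeWaveForm (ξ : ι → ℝ) : (ι → ℝ) →L[ℝ] ℂ :=
  ∑ j, (2 * Real.pi * ξ j * Complex.I : ℂ) • Complex.ofRealCLM ∘L ContinuousLinearMap.proj j

lemma planeWaveForm_apply (ξ v : ι → ℝ) :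
    planeWaveForm ξ v = (2 * Real.pi * ∑ j, ξ j * v j : ℝ) * Complex.I := by
  simp [planeWaveForm, Finset.mul_sum, Finset.sum_mul]
  exact Finset.sum_congr rfl fun j _ ↦ by ring

lemma planeWave_eq_exp (ξ x : ι → ℝ) : planeWave ξ x = Complex.exp (planeWaveForm ξ x) := by
  rw [planeWave, planeWaveForm_apply]

lemma norm_planeWave (ξ x : ι → ℝ) : ‖planeWave ξ x‖ = 1 :=
  Complex.norm_exp_ofReal_mul_I _

lemma planeWave_add (ξ η x : ι → ℝ) :
    planeWave (ξ + η) x = planeWave ξ x * planeWave η x := by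
  rw [planeWave_eq_exp, planeWave_eq_exp, planeWave_eq_exp, ← Complex.exp_add]
  congr 1
  simp only [planeWaveForm_apply, Pi.add_apply, add_mul, Finset.sum_add_distrib]
  push_cast
  ring

lemma planeWave_zero_left (x : ι → ℝ) : planeWave 0 x = 1 := by simp [planeWave]

lemma hasFDerivAt_planeWave (ξ x : ι → ℝ) :
    HasFDerivAt (planeWave ξ) (planeWave ξ x • planeWaveForm ξ) x := by
  have h : planeWave ξ = fun x ↦ Complex.exp (planeWaveForm ξ x) :=
    funext fun x ↦ planeWave_eq_exp ξ x
  rw [h]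
  exact (planeWaveForm ξ).hasFDerivAt.cexp

lemma contDiff_planeWave (ξ : ι → ℝ) : ContDiff ℝ ∞ (planeWave ξ) := by
  have h : planeWave ξ = fun x ↦ Complex.exp (planeWaveForm ξ x) :=
    funext fun x ↦ planeWave_eq_exp ξ x
  rw [h]
  exact (planeWaveForm ξ).contDiff.cexp

/-- The integer frequency `k` as a real vector. -/
def intFreq (k : ι → ℤ) : ι → ℝ := fun i ↦ k i

/-- The Fourier coefficients of a function supported in the unit cube. -/
noncomputable def cubeCoeff (g : (ι → ℝ) → ℂ) (k : ι → ℤ) : ℂ :=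
  ∫ x, planeWave (-intFreq k) x * g x

variable [DecidableEq ι]

/-- Decay of Fourier coefficients, locally uniformly in a parameter. -/
lemma exists_pow_mul_cubeCoeff_le {K : Set (ι → ℝ)} (hK : IsCompact K) (j : ι) (N : ℕ) :
    ∀ G : ℝ × (ι → ℝ) → ℂ, ContDiff ℝ ∞ G → (∀ ε x, x ∉ K → G (ε, x) = 0) →
    ∃ C, ∀ ε ∈ Icc (-1 : ℝ) 1, ∀ k : ι → ℤ,
      |(k j : ℝ)| ^ N * ‖cubeCoeff (fun x ↦ G (ε, x)) k‖ ≤ C := by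
  induction N with
  | zero =>
    intro G hG hsupp
    obtain ⟨C, hC⟩ := (isCompact_Icc (a := (-1 : ℝ)) (b := 1)).prod hK
      |>.exists_bound_of_continuousOn hG.continuous.continuousOn
    refine ⟨C * volume.real K, fun ε hε k ↦ ?_⟩
    rw [pow_zero, one_mul, cubeCoeff, ← setIntegral_eq_integral_of_forall_compl_eq_zero (s := K)
      (fun x hx ↦ by simp [hsupp ε x hx])]
    refine norm_setIntegral_le_of_norm_le_const hK.measure_lt_top fun x hx ↦ ?_
    rw [norm_mul, norm_planeWave, one_mul]
    exact hC (ε, x) ⟨hε, hx⟩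
  | succ N ih =>
    intro G hG hsupp
    let e : ℝ × (ι → ℝ) := (0, Pi.single j 1)
    let G' : ℝ × (ι → ℝ) → ℂ := fun p ↦ fderiv ℝ G p e
    have hG' : ContDiff ℝ ∞ G' := (hG.fderiv_right (m := ∞) (by simp)).clm_apply contDiff_const
    have hslice (ε : ℝ) : ContDiff ℝ ∞ (fun x ↦ G (ε, x)) :=
      hG.comp (contDiff_const.prodMk contDiff_id)
    have hder (ε x) : fderiv ℝ (fun x ↦ G (ε, x)) x (Pi.single j 1) = G' (ε, x) := by
      have h1 : HasFDerivAt G (fderiv ℝ G (ε, x)) (ε, x) :=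
        (hG.differentiable (by simp)).differentiableAt.hasFDerivAt
      have h2 := h1.comp x (hasFDerivAt_prodMk_right ε x)
      have h3 : HasFDerivAt (fun x ↦ G (ε, x)) _ x := h2
      rw [h3.fderiv]
      simp [G', e]
    have hsupp' : ∀ ε x, x ∉ K → G' (ε, x) = 0 := by
      intro ε x hx
      rw [← hder]
      have : (fun x ↦ G (ε, x)) =ᶠ[𝓝 x] fun _ ↦ 0 := by
        filter_upwards [hK.isClosed.isOpen_compl.mem_nhds hx] with y hy using hsupp ε y hy
      rw [this.fderiv_eq]
      simp
    obtain ⟨C, hC⟩ := ih G' hG' hsupp'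
    refine ⟨C, fun ε hε k ↦ ?_⟩
    refine le_trans ?_ (hC ε hε k)
    rw [pow_succ, mul_assoc]
    refine mul_le_mul_of_nonneg_left ?_ (by positivity)
    have hint {p : (ι → ℝ) → ℂ} (hp : Continuous p) (hz : ∀ x, x ∉ K → p x = 0) :
        Integrable p :=
      hp.integrable_of_hasCompactSupport (HasCompactSupport.intro hK hz)
    have hpw := (contDiff_planeWave (-intFreq k))
    have hib := integral_mul_fderiv_eq_neg_fderiv_mul_of_integrable (μ := volume)
      (f := planeWave (-intFreq k)) (g := fun x ↦ G (ε, x)) (v := Pi.single j 1)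
      (hint (by
        refine Continuous.mul ?_ (hslice ε).continuous
        exact (hpw.continuous_fderiv (by simp)).clm_apply continuous_const)
        (fun x hx ↦ by simp [hsupp ε x hx]))
      (hint (by
        simp only [hder]
        exact hpw.continuous.mul (hG'.continuous.comp (by fun_prop)))
        (fun x hx ↦ by simp [hder, hsupp' ε x hx]))
      (hint (hpw.continuous.mul (hslice ε).continuous) (fun x hx ↦ by simp [hsupp ε x hx]))
      (fun x _ ↦ (hpw.differentiable (by simp)).differentiableAt)
      (fun x _ ↦ ((hslice ε).differentiable (by simp)).differentiableAt)
    simp only [hder, (hasFDerivAt_planeWave _ _).fderiv] at hib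
    have hform : planeWaveForm (-intFreq k) (Pi.single j 1) =
        -((2 * Real.pi * k j : ℝ) * Complex.I) := by
      rw [planeWaveForm_apply]
      simp [intFreq, Pi.single_apply]
    have hkey : cubeCoeff (fun x ↦ G' (ε, x)) k =
        ((2 * Real.pi * k j : ℝ) * Complex.I) * cubeCoeff (fun x ↦ G (ε, x)) k := by
      rw [cubeCoeff, hib, cubeCoeff, ← integral_const_mul, ← integral_neg]
      refine integral_congr_ae (Eventually.of_forall fun x ↦ ?_)
      simp only [smul_apply, smul_eq_mul, hform]
      ring
    rw [hkey, norm_mul]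
    refine mul_le_mul_of_nonneg_right ?_ (norm_nonneg _)
    rw [norm_mul, Complex.norm_I, mul_one, Complex.norm_real, Real.norm_eq_abs, abs_mul, abs_mul]
    have h1 : 1 ≤ |(2 : ℝ)| * |Real.pi| := by
      rw [abs_of_pos two_pos, abs_of_pos Real.pi_pos]
      nlinarith [Real.pi_gt_three]
    nlinarith [abs_nonneg (k j : ℝ)]

/-- Summability of `‖k‖⁻ᴺ` over the integer lattice. -/
lemma exists_summable_norm_intFreq : ∃ N : ℕ, 0 < N ∧
    Summable (fun k : ι → ℤ ↦ (‖intFreq k‖ ^ N)⁻¹) := by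
  let L := Submodule.span ℤ (range (Pi.basisFun ℝ ι))
  have hL (k : ι → ℤ) : intFreq k ∈ L := by
    have : intFreq k = ∑ i, k i • Pi.basisFun ℝ ι i := by
      ext j
      simp [intFreq, Pi.single_apply]
    rw [this]
    exact Submodule.sum_mem _ fun i _ ↦ Submodule.smul_mem _ _ (Submodule.subset_span ⟨i, rfl⟩)
  refine ⟨Module.finrank ℤ L + 1, by omega, ?_⟩
  have h := ZLattice.summable_norm_pow_inv L _ (Nat.lt_succ_self _)
  have hinj : Function.Injective (fun k : ι → ℤ ↦ (⟨intFreq k, hL k⟩ : L)) := by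
    intro k l hkl
    ext i
    have := congrFun (congrArg Subtype.val hkl) i
    simpa [intFreq] using this
  simpa [Function.comp_def] using h.comp_injective hinj

/-- A summable bound for Fourier coefficients, locally uniform in a parameter. -/
lemma exists_summable_cubeCoeff_le {K : Set (ι → ℝ)} (hK : IsCompact K)
    {G : ℝ × (ι → ℝ) → ℂ} (hG : ContDiff ℝ ∞ G) (hsupp : ∀ ε x, x ∉ K → G (ε, x) = 0) :
    ∃ b : (ι → ℤ) → ℝ, Summable b ∧ ∀ ε ∈ Icc (-1 : ℝ) 1, ∀ k : ι → ℤ,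
      ‖cubeCoeff (fun x ↦ G (ε, x)) k‖ ≤ b k := by
  obtain ⟨N, hN, hsum⟩ := exists_summable_norm_intFreq (ι := ι)
  choose C hC using fun j : ι ↦ exists_pow_mul_cubeCoeff_le hK j N G hG hsupp
  obtain ⟨C₀, hC₀⟩ : ∃ C, ∀ ε ∈ Icc (-1 : ℝ) 1, ∀ k : ι → ℤ,
      ‖cubeCoeff (fun x ↦ G (ε, x)) k‖ ≤ C := by
    obtain ⟨C, hC⟩ := (isCompact_Icc (a := (-1 : ℝ)) (b := 1)).prod hK
      |>.exists_bound_of_continuousOn hG.continuous.continuousOn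
    refine ⟨C * volume.real K, fun ε hε k ↦ ?_⟩
    rw [cubeCoeff, ← setIntegral_eq_integral_of_forall_compl_eq_zero (s := K)
      (fun x hx ↦ by simp [hsupp ε x hx])]
    refine norm_setIntegral_le_of_norm_le_const hK.measure_lt_top fun x hx ↦ ?_
    rw [norm_mul, norm_planeWave, one_mul]
    exact hC (ε, x) ⟨hε, hx⟩
  have hC₀n : 0 ≤ C₀ := (norm_nonneg _).trans (hC₀ 0 (by simp) 0)
  have hCn (j) : 0 ≤ C j := le_trans (by positivity) (hC j 0 (by simp) 0)
  refine ⟨fun k ↦ (∑ j, C j) * (‖intFreq k‖ ^ N)⁻¹ + (if k = 0 then C₀ else 0), ?_, ?_⟩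
  · refine (hsum.mul_left _).add ?_
    exact (hasSum_ite_eq (0 : ι → ℤ) C₀).summable
  · intro ε hε k
    by_cases hk : k = 0
    · simp only [hk, if_true]
      have : 0 ≤ (∑ j, C j) * (‖intFreq (0 : ι → ℤ)‖ ^ N)⁻¹ :=
        mul_nonneg (Finset.sum_nonneg fun j _ ↦ hCn j) (by positivity)
      linarith [hC₀ ε hε 0]
    · simp only [hk, if_false, add_zero]
      have hne : Nonempty ι := by
        by_contra h
        rw [not_nonempty_iff] at h
        exact hk (Subsingleton.elim _ _)
      have hpos : 0 < ‖intFreq k‖ := by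
        rw [norm_pos_iff]
        intro h
        apply hk
        ext i
        simpa [intFreq] using congrFun h i
      obtain ⟨j, hj⟩ : ∃ j, ‖intFreq k‖ = |(k j : ℝ)| := by
        by_contra! h
        refine lt_irrefl _ ((pi_norm_lt_iff hpos).2 fun j ↦ ?_)
        exact lt_of_le_of_ne (norm_le_pi_norm (intFreq k) j) (h j).symm
      have h1 := hC j ε hε k
      rw [← hj] at h1
      rw [← div_eq_mul_inv, le_div_iff₀ (by positivity), mul_comm]
      exact h1.trans (Finset.single_le_sum (fun j _ ↦ hCn j) (Finset.mem_univ j))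

lemma continuous_cubeCoeff {K : Set (ι → ℝ)} (hK : IsCompact K)
    {G : ℝ × (ι → ℝ) → ℂ} (hG : ContDiff ℝ ∞ G) (hsupp : ∀ ε x, x ∉ K → G (ε, x) = 0)
    (k : ι → ℤ) : Continuous (fun ε ↦ cubeCoeff (fun x ↦ G (ε, x)) k) := by
  have h (ε) : cubeCoeff (fun x ↦ G (ε, x)) k =
      ∫ x in K, planeWave (-intFreq k) x * G (ε, x) := by
    rw [cubeCoeff, ← setIntegral_eq_integral_of_forall_compl_eq_zero (s := K)
      (fun x hx ↦ by simp [hsupp ε x hx])]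
  simp only [h]
  refine continuous_parametric_integral_of_continuous
    (f := fun ε x ↦ planeWave (-intFreq k) x * G (ε, x)) ?_ hK
  exact ((contDiff_planeWave _).continuous.comp continuous_snd).mul hG.continuous

/-- Periodization of a function supported in the unit cube. -/
noncomputable def periodize (g : (ι → ℝ) → ℂ) (x : ι → ℝ) : ℂ := g (fun i ↦ x i - round (x i))

lemma periodize_eq {g : (ι → ℝ) → ℂ} (hg : ∀ x, 1 / 4 < ‖x‖ → g x = 0) {x : ι → ℝ}
    {l : ι → ℤ} (h : ∀ i, |x i - l i| ≤ 5 / 8) : periodize g x = g (x - intFreq l) := by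
  by_cases hl : ∀ i, round (x i) = l i
  · simp only [periodize, hl]
    rfl
  · push Not at hl
    obtain ⟨i, hi⟩ := hl
    have h1 : (1 : ℝ) ≤ |(round (x i) : ℝ) - l i| := by
      exact_mod_cast Int.one_le_abs (sub_ne_zero.2 hi)
    have h2 := abs_sub_round (x i)
    have h3 := h i
    have h4 : |(round (x i) : ℝ) - l i| ≤ |x i - l i| + |x i - round (x i)| := by
      have := abs_sub_le (round (x i) : ℝ) (x i) (l i)
      rw [abs_sub_comm _ (x i)] at this
      linarith
    have h5 : periodize g x = 0 := by
      refine hg _ (lt_of_lt_of_le ?_ (norm_le_pi_norm _ i))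
      rw [Real.norm_eq_abs]
      linarith
    have h6 : g (x - intFreq l) = 0 := by
      refine hg _ (lt_of_lt_of_le ?_ (norm_le_pi_norm _ i))
      rw [Real.norm_eq_abs, Pi.sub_apply, intFreq]
      linarith
    rw [h5, h6]

lemma continuous_periodize {g : (ι → ℝ) → ℂ} (hc : Continuous g)
    (hg : ∀ x, 1 / 4 < ‖x‖ → g x = 0) : Continuous (periodize g) := by
  rw [continuous_iff_continuousAt]
  intro x₀
  let l : ι → ℤ := fun i ↦ round (x₀ i)
  have hev : periodize g =ᶠ[𝓝 x₀] fun x ↦ g (x - intFreq l) := by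
    filter_upwards [Metric.ball_mem_nhds x₀ (show (0 : ℝ) < 1 / 8 by norm_num)] with x hx
    refine periodize_eq hg fun i ↦ ?_
    have h1 := abs_sub_round (x₀ i)
    have h2 : |x i - x₀ i| < 1 / 8 := by
      have := (dist_le_pi_dist x x₀ i).trans_lt hx
      rwa [Real.dist_eq] at this
    have := abs_sub_le (x i) (x₀ i) (l i)
    simp only [l] at this ⊢
    linarith
  exact (ContinuousAt.congr (by fun_prop) hev.symm)

lemma periodize_add_intFreq (g : (ι → ℝ) → ℂ) (x : ι → ℝ) (l : ι → ℤ) :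
    periodize g (x + intFreq l) = periodize g x := by
  simp [periodize, intFreq]

open UnitAddTorus in
/-- Fourier inversion for functions supported in a small cube. -/
lemma hasSum_cubeCoeff {g : (ι → ℝ) → ℂ} (hc : Continuous g)
    (hg : ∀ x, 1 / 4 < ‖x‖ → g x = 0) (hs : Summable (cubeCoeff g)) {x : ι → ℝ}
    (hx : ‖x‖ ≤ 1 / 4) :
    HasSum (fun k ↦ cubeCoeff g k * planeWave (intFreq k) x) (g x) := by
  let τ : (ι → ℝ) → UnitAddTorus ι := fun x i ↦ (x i : UnitAddCircle)
  have hτ : IsOpenQuotientMap τ :=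
    IsOpenQuotientMap.piMap fun _ ↦ QuotientAddGroup.isOpenQuotientMap_mk
  let s : UnitAddTorus ι → ι → ℝ := fun t i ↦ (t i).out
  have hF (x : ι → ℝ) : periodize g (s (τ x)) = periodize g x := by
    have h (i) : ∃ m : ℤ, s (τ x) i = x i + m := by
      have h1 : ((s (τ x) i : ℝ) : UnitAddCircle) = (x i : UnitAddCircle) := Quotient.out_eq _
      rw [← sub_eq_zero, ← AddCircle.coe_sub, AddCircle.coe_eq_zero_iff] at h1
      obtain ⟨m, hm⟩ := h1
      refine ⟨m, ?_⟩
      rw [zsmul_one] at hm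
      linarith
    choose m hm using h
    have : s (τ x) = x + intFreq m := funext fun i ↦ by simp [hm, intFreq]
    rw [this, periodize_add_intFreq]
  let F : C(UnitAddTorus ι, ℂ) := ⟨fun t ↦ periodize g (s t), by
    rw [hτ.isQuotientMap.continuous_iff]
    exact (continuous_periodize hc hg).congr fun x ↦ (hF x).symm⟩
  have hwave (k : ι → ℤ) (x : ι → ℝ) : mFourier k (τ x) = planeWave (intFreq k) x := by
    simp only [mFourier, ContinuousMap.coe_mk, τ, fourier_coe_apply, planeWave, ← Complex.exp_sum]
    congr 1
    simp only [intFreq]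
    push_cast
    rw [Finset.mul_sum, Finset.sum_mul]
    exact Finset.sum_congr rfl fun i _ ↦ by ring
  have hper {x : ι → ℝ} (hx : ∀ i, |x i| ≤ 1 / 2) : periodize g x = g x := by
    have := periodize_eq hg (x := x) (l := 0) (fun i ↦ by simpa using (hx i).trans (by norm_num))
    rw [this]
    congr 1
    ext i
    simp [intFreq]
  have hcoeff (k : ι → ℤ) : mFourierCoeff F k = cubeCoeff g k := by
    rw [mFourierCoeff_eq_integral _ _ (fun _ ↦ -(1 / 2 : ℝ)), cubeCoeff,
      ← setIntegral_eq_integral_of_forall_compl_eq_zero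
        (s := {x : ι → ℝ | ∀ i, x i ∈ Ioc (-(1 / 2 : ℝ)) (-(1 / 2) + 1)})
        (f := fun x ↦ planeWave (-intFreq k) x * g x)]
    · refine setIntegral_congr_fun ?_ fun x hx ↦ ?_
      · exact MeasurableSet.univ_pi' fun i ↦ measurableSet_Ioc
      · have h1 : F (fun i ↦ (x i : UnitAddCircle)) = g x := by
          refine (hF x).trans (hper fun i ↦ ?_)
          have := hx i
          rw [mem_Ioc] at this
          rw [abs_le]
          constructor <;> linarith
        have h2 : intFreq (-k) = -intFreq k := by ext i; simp [intFreq]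
        simp only [h1, smul_eq_mul]
        rw [← h2, ← hwave]
    · intro x hx
      simp only [mem_ofPred_eq, not_forall] at hx
      obtain ⟨i, hi⟩ := hx
      rw [hg x, mul_zero]
      refine lt_of_lt_of_le ?_ (norm_le_pi_norm x i)
      rw [Real.norm_eq_abs, lt_abs]
      rw [mem_Ioc, not_and_or] at hi
      rcases hi with hi | hi
      · right; linarith
      · left; linarith
  have hsF : Summable (mFourierCoeff F) := by
    rwa [show mFourierCoeff F = cubeCoeff g from funext hcoeff]
  have := hasSum_mFourier_series_apply_of_summable hsF (τ x)
  simp only [hcoeff, hwave, smul_eq_mul] at this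
  have h1 : F (τ x) = g x := by
    refine (hF x).trans (hper fun i ↦ ?_)
    have := norm_le_pi_norm x i
    rw [Real.norm_eq_abs] at this
    linarith
  rwa [h1] at this

/-- A smooth family of functions supported in a small cube and vanishing for the parameter `0` is
given by Fourier series whose `ℓ¹` norms tend to `0`. -/
lemma exists_fourier_series_tendsto_zero {G : ℝ × (ι → ℝ) → ℂ} (hG : ContDiff ℝ ∞ G)
    (hsupp : ∀ ε x, 1 / 4 < ‖x‖ → G (ε, x) = 0) (h0 : ∀ x, G (0, x) = 0) :
    ∃ γ : ℝ → (ι → ℤ) → ℂ, (∀ᶠ ε in 𝓝 0, Summable (fun k ↦ ‖γ ε k‖)) ∧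
      Tendsto (fun ε ↦ ∑' k, ‖γ ε k‖) (𝓝 0) (𝓝 0) ∧
      ∀ᶠ ε in 𝓝 0, ∀ x, ‖x‖ ≤ 1 / 4 →
        HasSum (fun k ↦ γ ε k * planeWave (intFreq k) x) (G (ε, x)) := by
  have hK : IsCompact (Metric.closedBall (0 : ι → ℝ) (1 / 4)) := isCompact_closedBall _ _
  have hsupp' : ∀ ε x, x ∉ Metric.closedBall (0 : ι → ℝ) (1 / 4) → G (ε, x) = 0 :=
    fun ε x hx ↦ hsupp ε x (by simpa using hx)
  obtain ⟨b, hb, hle⟩ := exists_summable_cubeCoeff_le hK hG hsupp'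
  have hI : ∀ᶠ ε : ℝ in 𝓝 0, ε ∈ Icc (-1 : ℝ) 1 := Icc_mem_nhds (by norm_num) (by norm_num)
  have hsum : ∀ ε ∈ Icc (-1 : ℝ) 1, Summable (fun k ↦ ‖cubeCoeff (fun x ↦ G (ε, x)) k‖) :=
    fun ε hε ↦ hb.of_nonneg_of_le (fun _ ↦ norm_nonneg _) (hle ε hε)
  refine ⟨fun ε ↦ cubeCoeff (fun x ↦ G (ε, x)), hI.mono hsum, ?_, ?_⟩
  · have := tendsto_tsum_of_dominated_convergence (𝓕 := 𝓝 (0 : ℝ))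
      (f := fun ε k ↦ ‖cubeCoeff (fun x ↦ G (ε, x)) k‖) (g := fun _ ↦ (0 : ℝ)) hb (fun k ↦ by
        have := ((continuous_cubeCoeff hK hG hsupp' k).tendsto 0).norm
        simpa [cubeCoeff, h0] using this)
      (hI.mono fun ε hε k ↦ by simpa using hle ε hε k)
    simpa using this
  · filter_upwards [hI] with ε hε x hx
    exact hasSum_cubeCoeff (hG.continuous.comp (by fun_prop)) (hsupp ε) (hsum ε hε).of_norm hx

end Wiener

section Neumann

/-- The map `c ↦ ∑ c k • t k` from `ℓ¹` defined by a bounded family `t`. -/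
noncomputable def lpOneLift {κ Y : Type*} [NormedAddCommGroup Y] [NormedSpace ℂ Y] [CompleteSpace Y]
    (t : κ → Y) (C : ℝ) (ht : ∀ k, ‖t k‖ ≤ C) : lp (fun _ : κ ↦ ℂ) 1 →L[ℂ] Y :=
  have hs (c : lp (fun _ : κ ↦ ℂ) 1) : Summable (fun k ↦ ‖c k‖) := by
    simpa using (lp.memℓp c).summable (by simp)
  have hs' (c : lp (fun _ : κ ↦ ℂ) 1) : Summable (fun k ↦ c k • t k) :=
    ((hs c).mul_right C).of_norm_bounded fun k ↦ by
      rw [norm_smul]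
      exact mul_le_mul_of_nonneg_left (ht k) (norm_nonneg _)
  LinearMap.mkContinuous
    { toFun := fun c ↦ ∑' k, c k • t k
      map_add' := fun c d ↦ by
        rw [← (hs' c).tsum_add (hs' d)]
        simp [add_smul]
      map_smul' := fun a c ↦ by
        rw [RingHom.id_apply, ← (hs' c).tsum_const_smul]
        simp [mul_smul] } C fun c ↦ by
    have h1 : ‖c‖ = ∑' k, ‖c k‖ := by simp [lp.norm_eq_tsum_rpow (p := 1) (by simp) c]
    rw [h1, mul_comm, ← tsum_mul_right]
    refine tsum_of_norm_bounded ((hs c).mul_right C).hasSum fun k ↦ ?_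
    rw [norm_smul]
    exact mul_le_mul_of_nonneg_left (ht k) (norm_nonneg _)

lemma lpOneLift_apply {κ Y : Type*} [NormedAddCommGroup Y] [NormedSpace ℂ Y] [CompleteSpace Y]
    (t : κ → Y) (C : ℝ) (ht : ∀ k, ‖t k‖ ≤ C) (c : lp (fun _ : κ ↦ ℂ) 1) :
    lpOneLift t C ht c = ∑' k, c k • t k := rfl

lemma summable_norm_lp_one {κ : Type*} (c : lp (fun _ : κ ↦ ℂ) 1) :
    Summable (fun k ↦ ‖c k‖) := by
  simpa using (lp.memℓp c).summable (by simp)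

lemma norm_lp_one_eq_tsum {κ : Type*} (c : lp (fun _ : κ ↦ ℂ) 1) : ‖c‖ = ∑' k, ‖c k‖ := by
  simp [lp.norm_eq_tsum_rpow (p := 1) (by simp) c]

lemma norm_lpOneLift_le {κ Y : Type*} [NormedAddCommGroup Y] [NormedSpace ℂ Y] [CompleteSpace Y]
    (t : κ → Y) (C : ℝ) (hC : 0 ≤ C) (ht : ∀ k, ‖t k‖ ≤ C) : ‖lpOneLift t C ht‖ ≤ C := by
  refine ContinuousLinearMap.opNorm_le_bound _ hC fun c ↦ ?_
  rw [lpOneLift_apply, norm_lp_one_eq_tsum, mul_comm, ← tsum_mul_right]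
  refine tsum_of_norm_bounded ((summable_norm_lp_one c).mul_right C).hasSum fun k ↦ ?_
  rw [norm_smul]
  exact mul_le_mul_of_nonneg_left (ht k) (norm_nonneg _)

/-- A summable family as an element of `ℓ¹`. -/
def lpOneMk {κ : Type*} (f : κ → ℂ) (hf : Summable (fun k ↦ ‖f k‖)) : lp (fun _ : κ ↦ ℂ) 1 :=
  ⟨f, memℓp_gen (by simpa using hf)⟩

variable {ι : Type*} [Fintype ι]

lemma intFreq_add (k l : ι → ℤ) : intFreq (k + l) = intFreq k + intFreq l := by
  ext i; simp [intFreq]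

/-- A small perturbation of the identity on `ℓ¹`, given by Fourier multipliers followed by
multiplication by functions with small Fourier coefficients, can be inverted. -/
lemma exists_neumann_solution {α : Type*} [Fintype α] (mult : α → (ι → ℤ) → ℂ) {C : ℝ}
    (hmult : ∀ a k, ‖mult a k‖ ≤ C) (γ : α → (ι → ℤ) → ℂ)
    (hγ : ∀ a, Summable (fun k ↦ ‖γ a k‖)) (hsmall : C * ∑ a, ∑' k, ‖γ a k‖ ≤ 1 / 2)
    (ρ : (ι → ℤ) → ℂ) (hρ : Summable (fun k ↦ ‖ρ k‖)) :
    ∃ g : (ι → ℤ) → ℂ, Summable (fun k ↦ ‖g k‖) ∧ ∑' k, ‖g k‖ ≤ 2 * ∑' k, ‖ρ k‖ ∧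
      ∀ (x : ι → ℝ) (A : α → ℂ) (r : ℂ),
        (∀ a, HasSum (fun k ↦ γ a k * planeWave (intFreq k) x) (A a)) →
        HasSum (fun k ↦ ρ k * planeWave (intFreq k) x) r →
        ∑' k, g k * planeWave (intFreq k) x +
          ∑ a, A a * ∑' k, mult a k * g k * planeWave (intFreq k) x = -r := by
  let X := lp (fun _ : ι → ℤ ↦ ℂ) 1
  have hsh (a) (k : ι → ℤ) : Summable (fun l ↦ ‖γ a (l - k)‖) :=
    (hγ a).comp_injective sub_left_injective
  let sh (a) (k : ι → ℤ) : X := lpOneMk (fun l ↦ γ a (l - k)) (hsh a k)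
  have hnsh (a) (k : ι → ℤ) : ‖sh a k‖ = ∑' l, ‖γ a l‖ := by
    rw [norm_lp_one_eq_tsum]
    exact (Equiv.subRight k).tsum_eq (fun l ↦ ‖γ a l‖)
  let t (k : ι → ℤ) : X := ∑ a, mult a k • sh a k
  have ht (k) : ‖t k‖ ≤ 1 / 2 := by
    refine (norm_sum_le _ _).trans (le_trans ?_ hsmall)
    rw [Finset.mul_sum]
    refine Finset.sum_le_sum fun a _ ↦ ?_
    rw [norm_smul, hnsh]
    exact mul_le_mul_of_nonneg_right (hmult a k) (tsum_nonneg fun _ ↦ norm_nonneg _)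
  let T : X →L[ℂ] X := lpOneLift t (1 / 2) ht
  have hT : ‖T‖ ≤ 1 / 2 := norm_lpOneLift_le t (1 / 2) (by norm_num) ht
  let r₀ : X := lpOneMk ρ hρ
  obtain ⟨g, hg⟩ : ∃ g : X, g + T g = -r₀ := by
    have hu : IsUnit (1 - (-T)) := isUnit_one_sub_of_norm_lt_one (by rw [norm_neg]; linarith)
    obtain ⟨S, hS⟩ := hu.exists_right_inv
    refine ⟨S (-r₀), ?_⟩
    have := congrArg (fun A : X →L[ℂ] X ↦ A (-r₀)) hS
    simpa using this
  refine ⟨g, summable_norm_lp_one g, ?_, ?_⟩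
  · rw [← norm_lp_one_eq_tsum]
    have h1 : ‖r₀‖ = ∑' k, ‖ρ k‖ := norm_lp_one_eq_tsum r₀
    have h2 : ‖g‖ ≤ ‖r₀‖ + ‖T g‖ := by
      have : g = -r₀ - T g := eq_sub_of_add_eq hg
      calc ‖g‖ = ‖-r₀ - T g‖ := by rw [← this]
        _ ≤ ‖-r₀‖ + ‖T g‖ := norm_sub_le _ _
        _ = _ := by rw [norm_neg]
    have h3 : ‖T g‖ ≤ 1 / 2 * ‖g‖ :=
      (T.le_opNorm g).trans (mul_le_mul_of_nonneg_right hT (norm_nonneg _))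
    linarith
  · intro x A r hA hr
    let ev : X →L[ℂ] ℂ :=
      lpOneLift (fun k ↦ planeWave (intFreq k) x) 1 (fun k ↦ (norm_planeWave _ _).le)
    have hev (c : X) : ev c = ∑' k, c k * planeWave (intFreq k) x := lpOneLift_apply _ _ _ c
    have hevsh (a k) : ev (sh a k) = planeWave (intFreq k) x * A a := by
      rw [hev, ← (hA a).tsum_eq, ← tsum_mul_left, ← (Equiv.addRight k).tsum_eq]
      refine tsum_congr fun l ↦ ?_
      have : (sh a k : (ι → ℤ) → ℂ) (l + k) = γ a l := by
        change γ a (l + k - k) = γ a l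
        rw [add_sub_cancel_right]
      rw [Equiv.coe_addRight, this, intFreq_add, planeWave_add]
      ring
    have hsum (a) : Summable (fun k ↦ mult a k * g k * planeWave (intFreq k) x) := by
      refine ((summable_norm_lp_one g).mul_left C).of_norm_bounded fun k ↦ ?_
      rw [norm_mul, norm_mul, norm_planeWave, mul_one]
      exact mul_le_mul_of_nonneg_right (hmult a k) (norm_nonneg _)
    have hTg : ev (T g) = ∑ a, A a * ∑' k, mult a k * g k * planeWave (intFreq k) x := by
      have hsT : Summable (fun k ↦ g k • t k) := by
        refine ((summable_norm_lp_one g).mul_right (1 / 2)).of_norm_bounded fun k ↦ ?_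
        rw [norm_smul]
        exact mul_le_mul_of_nonneg_left (ht k) (norm_nonneg _)
      have hTd : T g = ∑' k, g k • t k := lpOneLift_apply _ _ _ g
      rw [hTd, ev.map_tsum hsT]
      simp only [← tsum_mul_left]
      rw [← Summable.tsum_finsetSum fun a _ ↦ (hsum a).mul_left _]
      refine tsum_congr fun k ↦ ?_
      simp only [t, map_smul, map_sum, hevsh, smul_eq_mul, Finset.mul_sum]
      exact Finset.sum_congr rfl fun a _ ↦ by ring
    have := congrArg ev hg
    rw [map_add, hTg, map_neg, hev] at this
    rw [this, hev, ← hr.tsum_eq]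
    rfl

end Neumann

section WaveSeries

variable {ι κ : Type*} [Fintype ι]

/-- The second derivative of a plane wave, as a function of the value of the wave. -/
noncomputable def planeWaveForm₂ (ξ : ι → ℝ) (c : ℂ) : (ι → ℝ) →L[ℝ] (ι → ℝ) →L[ℝ] ℂ :=
  (∑ j, (2 * Real.pi * ξ j) • ContinuousLinearMap.proj (R := ℝ) (φ := fun _ : ι ↦ ℝ) j).smulRight
    ((Complex.I * c) • planeWaveForm ξ)

lemma planeWaveForm₂_apply (ξ : ι → ℝ) (c : ℂ) (u v : ι → ℝ) :
    planeWaveForm₂ ξ c u v = c * planeWaveForm ξ u * planeWaveForm ξ v := by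
  have h : (∑ j, (2 * Real.pi * ξ j) •
      ContinuousLinearMap.proj (R := ℝ) (φ := fun _ : ι ↦ ℝ) j) u
      = 2 * Real.pi * ∑ j, ξ j * u j := by
    simp [Finset.mul_sum, mul_assoc]
  rw [planeWaveForm₂, ContinuousLinearMap.smulRight_apply, h, smul_apply, smul_apply, smul_eq_mul,
    Complex.real_smul, planeWaveForm_apply ξ u]
  ring

lemma norm_planeWaveForm₂_le (ξ : ι → ℝ) (c : ℂ) :
    ‖planeWaveForm₂ ξ c‖ ≤ ‖c‖ * ‖planeWaveForm ξ‖ ^ 2 := by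
  refine ContinuousLinearMap.opNorm_le_bound₂ _ (by positivity) fun u v ↦ ?_
  rw [planeWaveForm₂_apply, norm_mul, norm_mul]
  calc ‖c‖ * ‖planeWaveForm ξ u‖ * ‖planeWaveForm ξ v‖
      ≤ ‖c‖ * (‖planeWaveForm ξ‖ * ‖u‖) * (‖planeWaveForm ξ‖ * ‖v‖) := by
        gcongr <;> exact ContinuousLinearMap.le_opNorm _ _
    _ = _ := by ring

lemma continuous_planeWaveForm₂ (ξ : ι → ℝ) : Continuous (planeWaveForm₂ ξ) := by
  have h := (ContinuousLinearMap.smulRightL ℝ (ι → ℝ) ((ι → ℝ) →L[ℝ] ℂ)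
    (∑ j, (2 * Real.pi * ξ j) •
      ContinuousLinearMap.proj (R := ℝ) (φ := fun _ : ι ↦ ℝ) j)).continuous
  exact h.comp ((continuous_const.mul continuous_id).smul continuous_const)

lemma ContinuousLinearMap.hasSum_apply {κ V Y : Type*} [NormedAddCommGroup V] [NormedSpace ℝ V]
    [NormedAddCommGroup Y] [NormedSpace ℝ Y] {f : κ → V →L[ℝ] Y} {g : V →L[ℝ] Y}
    (hf : HasSum f g) (u : V) : HasSum (fun k ↦ f k u) (g u) :=
  (ContinuousLinearMap.apply ℝ Y u).hasSum hf

/-- Derivatives of a real part of a rapidly convergent series of plane waves. -/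
lemma contDiff_two_re_tsum_planeWave (ξ : κ → ι → ℝ) (d : κ → ℂ) (s : κ → ℝ) (hs : Summable s)
    (hd : ∀ k, ‖d k‖ * (1 + ‖planeWaveForm (ξ k)‖) ^ 2 ≤ s k) :
    ContDiff ℝ 2 (fun x ↦ (∑' k, d k * planeWave (ξ k) x).re) ∧
    (∀ x u, fderiv ℝ (fun x ↦ (∑' k, d k * planeWave (ξ k) x).re) x u =
      (∑' k, d k * planeWaveForm (ξ k) u * planeWave (ξ k) x).re) ∧
    ∀ x u v, fderiv ℝ (fderiv ℝ (fun x ↦ (∑' k, d k * planeWave (ξ k) x).re)) x u v =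
      (∑' k, d k * planeWaveForm (ξ k) u * planeWaveForm (ξ k) v * planeWave (ξ k) x).re := by
  have hd0 (k) : ‖d k‖ ≤ s k := by
    refine le_trans ?_ (hd k)
    refine le_mul_of_one_le_right (norm_nonneg _) ?_
    nlinarith [norm_nonneg (planeWaveForm (ξ k))]
  have hd1 (k) : ‖d k‖ * ‖planeWaveForm (ξ k)‖ ≤ s k := by
    refine le_trans ?_ (hd k)
    refine mul_le_mul_of_nonneg_left ?_ (norm_nonneg _)
    nlinarith [norm_nonneg (planeWaveForm (ξ k))]
  have hd2 (k) : ‖d k‖ * ‖planeWaveForm (ξ k)‖ ^ 2 ≤ s k := by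
    refine le_trans ?_ (hd k)
    refine mul_le_mul_of_nonneg_left ?_ (norm_nonneg _)
    nlinarith [norm_nonneg (planeWaveForm (ξ k))]
  let W : (ι → ℝ) → ℂ := fun x ↦ ∑' k, d k * planeWave (ξ k) x
  let W₁ : (ι → ℝ) → (ι → ℝ) →L[ℝ] ℂ := fun x ↦ ∑' k, (d k * planeWave (ξ k) x) • planeWaveForm (ξ k)
  let W₂ : (ι → ℝ) → (ι → ℝ) →L[ℝ] (ι → ℝ) →L[ℝ] ℂ :=
    fun x ↦ ∑' k, planeWaveForm₂ (ξ k) (d k * planeWave (ξ k) x)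
  have hb1 (k x) : ‖(d k * planeWave (ξ k) x) • planeWaveForm (ξ k)‖ ≤ s k := by
    rw [norm_smul, norm_mul, norm_planeWave, mul_one]
    exact hd1 k
  have hb2 (k x) : ‖planeWaveForm₂ (ξ k) (d k * planeWave (ξ k) x)‖ ≤ s k := by
    refine (norm_planeWaveForm₂_le _ _).trans ?_
    rw [norm_mul, norm_planeWave, mul_one]
    exact hd2 k
  have hW (x) : HasFDerivAt W (W₁ x) x := by
    refine hasFDerivAt_tsum (x₀ := 0) hs (fun k x ↦ ?_) hb1 ?_ x
    · rw [← smul_smul]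
      exact (hasFDerivAt_planeWave (ξ k) x).const_mul (d k)
    · refine hs.of_norm_bounded fun k ↦ ?_
      rw [norm_mul, norm_planeWave, mul_one]
      exact hd0 k
  have hW₁ (x) : HasFDerivAt W₁ (W₂ x) x := by
    refine hasFDerivAt_tsum (x₀ := 0) hs (fun k x ↦ ?_) hb2 ?_ x
    · have := ((hasFDerivAt_planeWave (ξ k) x).const_mul (d k)).smul_const (planeWaveForm (ξ k))
      convert this using 1
      ext u v
      simp only [planeWaveForm₂_apply, smul_apply, smul_eq_mul,
        ContinuousLinearMap.smulRight_apply]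
      ring
    · exact hs.of_norm_bounded fun k ↦ hb1 k 0
  have hW₂ : Continuous W₂ := by
    refine continuous_tsum (f := fun k x ↦ planeWaveForm₂ (ξ k) (d k * planeWave (ξ k) x))
      (fun k ↦ ?_) hs hb2
    exact (continuous_planeWaveForm₂ (ξ k)).comp
      (continuous_const.mul (contDiff_planeWave (ξ k)).continuous)
  have h1 (x) : HasFDerivAt (fun x ↦ (W x).re) (Complex.reCLM ∘L W₁ x) x :=
    Complex.reCLM.hasFDerivAt.comp x (hW x)
  have hf1 : fderiv ℝ (fun x ↦ (W x).re) = fun x ↦ Complex.reCLM ∘L W₁ x :=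
    funext fun x ↦ (h1 x).fderiv
  let P := ContinuousLinearMap.compL ℝ (ι → ℝ) ℂ ℝ Complex.reCLM
  have h2 (x) : HasFDerivAt (fun x ↦ Complex.reCLM ∘L W₁ x) (P ∘L W₂ x) x :=
    P.hasFDerivAt.comp x (hW₁ x)
  have hf2 : fderiv ℝ (fderiv ℝ (fun x ↦ (W x).re)) = fun x ↦ P ∘L W₂ x := by
    rw [hf1]
    exact funext fun x ↦ (h2 x).fderiv
  refine ⟨?_, fun x u ↦ ?_, fun x u v ↦ ?_⟩
  · change ContDiff ℝ 2 (fun x ↦ (W x).re)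
    rw [show (2 : ℕ∞ω) = 1 + 1 by norm_num, contDiff_succ_iff_fderiv]
    refine ⟨fun x ↦ (h1 x).differentiableAt, by simp, ?_⟩
    rw [contDiff_one_iff_fderiv]
    refine ⟨by rw [hf1]; exact fun x ↦ (h2 x).differentiableAt, ?_⟩
    rw [hf2]
    fun_prop
  · change fderiv ℝ (fun x ↦ (W x).re) x u = _
    have hsum : Summable (fun k ↦ (d k * planeWave (ξ k) x) • planeWaveForm (ξ k)) :=
      hs.of_norm_bounded fun k ↦ hb1 k x
    rw [hf1]
    change (W₁ x u).re = _
    have : W₁ x u = ∑' k, ((d k * planeWave (ξ k) x) • planeWaveForm (ξ k)) u :=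
      (ContinuousLinearMap.apply ℝ ℂ u).map_tsum hsum
    rw [this]
    congr 1
    exact tsum_congr fun k ↦ by simp only [smul_apply, smul_eq_mul]; ring
  · change fderiv ℝ (fderiv ℝ (fun x ↦ (W x).re)) x u v = _
    have hsum : Summable (fun k ↦ planeWaveForm₂ (ξ k) (d k * planeWave (ξ k) x)) :=
      Summable.of_norm_bounded (E := (ι → ℝ) →L[ℝ] (ι → ℝ) →L[ℝ] ℂ) hs fun k ↦ hb2 k x
    rw [hf2]
    change (W₂ x u v).re = _
    have e2 : W₂ x u v = ∑' k, planeWaveForm₂ (ξ k) (d k * planeWave (ξ k) x) u v :=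
      (ContinuousLinearMap.hasSum_apply
        (ContinuousLinearMap.hasSum_apply hsum.hasSum u) v).tsum_eq.symm
    rw [e2]
    congr 1
    exact tsum_congr fun k ↦ by rw [planeWaveForm₂_apply]; ring

end WaveSeries

section Perturbation

variable {ι : Type*} [Fintype ι]

lemma norm_planeWaveForm_le (ξ : ι → ℝ) :
    ‖planeWaveForm ξ‖ ≤ 2 * Real.pi * Fintype.card ι * ‖ξ‖ := by
  refine ContinuousLinearMap.opNorm_le_bound _ (by positivity) fun v ↦ ?_
  rw [planeWaveForm_apply, norm_mul, Complex.norm_I, mul_one, Complex.norm_real, norm_mul, norm_mul,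
    Real.norm_of_nonneg Real.pi_pos.le, Real.norm_two]
  have : ‖∑ j, ξ j * v j‖ ≤ Fintype.card ι * (‖ξ‖ * ‖v‖) := by
    refine (norm_sum_le _ _).trans ?_
    rw [← nsmul_eq_mul, ← Finset.card_univ]
    refine Finset.sum_le_card_nsmul _ _ _ fun j _ ↦ ?_
    rw [norm_mul]
    exact mul_le_mul (norm_le_pi_norm ξ j) (norm_le_pi_norm v j) (norm_nonneg _) (norm_nonneg _)
  calc 2 * Real.pi * ‖∑ j, ξ j * v j‖ ≤ 2 * Real.pi * (Fintype.card ι * (‖ξ‖ * ‖v‖)) := by gcongr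
    _ = _ := by ring

lemma half_le_norm_intFreq_add_half [Nonempty ι] (k : ι → ℤ) :
    1 / 2 ≤ ‖intFreq k + fun _ ↦ (1 / 2 : ℝ)‖ := by
  obtain ⟨i⟩ := ‹Nonempty ι›
  refine le_trans ?_ (norm_le_pi_norm _ i)
  rw [Pi.add_apply, intFreq, Real.norm_eq_abs, le_abs]
  rcases le_or_gt 0 (k i) with h | h
  · left
    have : (0 : ℝ) ≤ k i := by exact_mod_cast h
    linarith
  · right
    have : (k i : ℝ) ≤ -1 := by exact_mod_cast Int.le_sub_one_of_lt h
    linarith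

variable [DecidableEq ι]

lemma planeWaveForm_single (ξ : ι → ℝ) (i : ι) :
    planeWaveForm ξ (Pi.single i 1) = (2 * Real.pi * ξ i : ℝ) * Complex.I := by
  rw [planeWaveForm_apply]
  simp [Pi.single_apply]

/-- A small perturbation of an elliptic equation with constant coefficients has small solutions
for a small right hand side. -/
lemma exists_small_solution_perturbed [Nonempty ι] (a₀ : ι → ι → ℝ) {c : ℝ} (hc : 0 < c)
    (hell : ∀ ξ : ι → ℝ, c * ‖ξ‖ ^ 2 ≤ ∑ i, ∑ j, a₀ i j * (ξ i * ξ j))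
    {A : ι → ι → ℝ × (ι → ℝ) → ℝ} {B : ι → ℝ × (ι → ℝ) → ℝ} {R : ℝ × (ι → ℝ) → ℝ}
    (hA : ∀ i j, ContDiff ℝ ∞ (A i j)) (hB : ∀ i, ContDiff ℝ ∞ (B i)) (hR : ContDiff ℝ ∞ R)
    (sA : ∀ i j ε x, 1 / 4 < ‖x‖ → A i j (ε, x) = 0) (sB : ∀ i ε x, 1 / 4 < ‖x‖ → B i (ε, x) = 0)
    (sR : ∀ ε x, 1 / 4 < ‖x‖ → R (ε, x) = 0)
    (zA : ∀ i j x, A i j (0, x) = 0) (zB : ∀ i x, B i (0, x) = 0) (zR : ∀ x, R (0, x) = 0)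
    {δ : ℝ} (hδ : 0 < δ) :
    ∀ᶠ ε in 𝓝 (0 : ℝ), ∃ w : (ι → ℝ) → ℝ, ContDiff ℝ 2 w ∧
      (∀ i j, |fderiv ℝ (fderiv ℝ w) 0 (Pi.single i 1) (Pi.single j 1)| ≤ δ) ∧
      (∀ i, |fderiv ℝ w 0 (Pi.single i 1)| ≤ δ) ∧
      ∀ x, ‖x‖ ≤ 1 / 4 →
        ∑ i, ∑ j, (a₀ i j + A i j (ε, x)) *
          fderiv ℝ (fderiv ℝ w) x (Pi.single i 1) (Pi.single j 1) +
        ∑ i, B i (ε, x) * fderiv ℝ w x (Pi.single i 1) = -R (ε, x) := by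
  let θ : ι → ℝ := fun _ ↦ 1 / 2
  let ξ (k : ι → ℤ) : ι → ℝ := intFreq k + θ
  let Q (k : ι → ℤ) : ℝ := ∑ i, ∑ j, a₀ i j * (ξ k i * ξ k j)
  have hξ (k) : 1 / 2 ≤ ‖ξ k‖ := half_le_norm_intFreq_add_half k
  have hξ0 (k) : 0 < ‖ξ k‖ := by linarith [hξ k]
  have hQ (k) : c * ‖ξ k‖ ^ 2 ≤ Q k := hell (ξ k)
  have hQ0 (k) : 0 < Q k := lt_of_lt_of_le (by have := hξ0 k; positivity) (hQ k)
  let D (k : ι → ℤ) : ℂ := ((-(1 / (4 * Real.pi ^ 2 * Q k)) : ℝ) : ℂ)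
  have hD (k) : ‖D k‖ * ‖ξ k‖ ^ 2 ≤ 1 / (4 * Real.pi ^ 2 * c) := by
    have h1 := hQ0 k
    rw [Complex.norm_real, norm_neg, Real.norm_of_nonneg (by positivity), one_div_mul_eq_div,
      div_le_div_iff₀ (by positivity) (by positivity)]
    have := hQ k
    nlinarith [Real.pi_pos, sq_nonneg Real.pi, mul_le_mul_of_nonneg_left this (sq_nonneg Real.pi)]
  let e (i : ι) : ι → ℝ := Pi.single i 1
  let mult : (ι × ι ⊕ ι) → (ι → ℤ) → ℂ := fun a k ↦ Sum.elim
    (fun q : ι × ι ↦ D k * planeWaveForm (ξ k) (e q.1) * planeWaveForm (ξ k) (e q.2))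
    (fun i ↦ D k * planeWaveForm (ξ k) (e i)) a
  have hform (k i) : ‖planeWaveForm (ξ k) (e i)‖ ≤ 2 * Real.pi * ‖ξ k‖ := by
    rw [planeWaveForm_single, norm_mul, Complex.norm_I, mul_one, Complex.norm_real, norm_mul,
      norm_mul, Real.norm_of_nonneg Real.pi_pos.le, Real.norm_two]
    exact mul_le_mul_of_nonneg_left (norm_le_pi_norm (ξ k) i) (by positivity)
  have hpi : (1 : ℝ) ≤ Real.pi := by linarith [Real.pi_gt_three]
  have hmult (a k) : ‖mult a k‖ ≤ 1 / c := by
    have hk : ‖D k‖ * (4 * Real.pi ^ 2 * ‖ξ k‖ ^ 2) ≤ 1 / c := by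
      calc ‖D k‖ * (4 * Real.pi ^ 2 * ‖ξ k‖ ^ 2) = 4 * Real.pi ^ 2 * (‖D k‖ * ‖ξ k‖ ^ 2) := by ring
        _ ≤ 4 * Real.pi ^ 2 * (1 / (4 * Real.pi ^ 2 * c)) := by gcongr; exact hD k
        _ = 1 / c := by field_simp
    refine le_trans ?_ hk
    rcases a with ⟨i, j⟩ | i
    · simp only [mult, Sum.elim_inl, norm_mul, mul_assoc]
      refine mul_le_mul_of_nonneg_left ?_ (norm_nonneg _)
      refine (mul_le_mul (hform k i) (hform k j) (norm_nonneg _)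
        (by have := hξ0 k; positivity)).trans (le_of_eq (by ring))
    · simp only [mult, Sum.elim_inr, norm_mul]
      refine mul_le_mul_of_nonneg_left ((hform k i).trans ?_) (norm_nonneg _)
      have h2 : 1 ≤ 2 * Real.pi * ‖ξ k‖ := by nlinarith [hξ k]
      calc 2 * Real.pi * ‖ξ k‖ ≤ (2 * Real.pi * ‖ξ k‖) * (2 * Real.pi * ‖ξ k‖) :=
            le_mul_of_one_le_right (by linarith) h2
        _ = _ := by ring
  let coef : (ι × ι ⊕ ι) → ℝ × (ι → ℝ) → ℝ := fun a q ↦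
    Sum.elim (fun p : ι × ι ↦ A p.1 p.2 q) (fun i ↦ B i q) a
  have hcoef (a) : ∃ γ : ℝ → (ι → ℤ) → ℂ, (∀ᶠ ε in 𝓝 0, Summable (fun k ↦ ‖γ ε k‖)) ∧
      Tendsto (fun ε ↦ ∑' k, ‖γ ε k‖) (𝓝 0) (𝓝 0) ∧
      ∀ᶠ ε in 𝓝 0, ∀ x : ι → ℝ, ‖x‖ ≤ 1 / 4 →
        HasSum (fun k ↦ γ ε k * planeWave (intFreq k) x) (coef a (ε, x) : ℂ) := by
    refine exists_fourier_series_tendsto_zero (G := fun q ↦ (coef a q : ℂ)) ?_ ?_ ?_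
    · refine Complex.ofRealCLM.contDiff.comp ?_
      rcases a with ⟨i, j⟩ | i
      exacts [hA i j, hB i]
    · intro ε x hx
      rcases a with ⟨i, j⟩ | i
      exacts [by simp [coef, sA i j ε x hx], by simp [coef, sB i ε x hx]]
    · intro x
      rcases a with ⟨i, j⟩ | i
      exacts [by simp [coef, zA i j x], by simp [coef, zB i x]]
  choose γ hγs hγt hγ using hcoef
  obtain ⟨ρ, hρs, hρt, hρ⟩ :=
    exists_fourier_series_tendsto_zero (G := fun q : ℝ × (ι → ℝ) ↦ planeWave (-θ) q.2 * (R q : ℂ))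
      (((contDiff_planeWave _).comp contDiff_snd).mul (Complex.ofRealCLM.contDiff.comp hR))
      (fun ε x hx ↦ by simp [sR ε x hx]) (fun x ↦ by simp [zR x])
  have hsm : ∀ᶠ ε in 𝓝 (0 : ℝ), 1 / c * ∑ a, ∑' k, ‖γ a ε k‖ ≤ 1 / 2 := by
    have : Tendsto (fun ε ↦ 1 / c * ∑ a, ∑' k, ‖γ a ε k‖) (𝓝 0) (𝓝 0) := by
      simpa using (tendsto_finsetSum Finset.univ fun a _ ↦ hγt a).const_mul (1 / c)
    exact this.eventually (eventually_le_nhds (by norm_num))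
  have hsr : ∀ᶠ ε in 𝓝 (0 : ℝ), 1 / c * (2 * ∑' k, ‖ρ ε k‖) ≤ δ := by
    have : Tendsto (fun ε ↦ 1 / c * (2 * ∑' k, ‖ρ ε k‖)) (𝓝 0) (𝓝 0) := by
      simpa using (hρt.const_mul 2).const_mul (1 / c)
    exact this.eventually (eventually_le_nhds hδ)
  filter_upwards [eventually_all.2 hγs, eventually_all.2 hγ, hρs, hρ, hsm, hsr]
    with ε h1 h2 h3 h4 h5 h6
  obtain ⟨g, hg, hgρ, hsol⟩ := exists_neumann_solution mult hmult (fun a ↦ γ a ε) h1 h5 (ρ ε) h3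
  let K : ℝ := (2 + 2 * Real.pi * Fintype.card ι) ^ 2 * (1 / (4 * Real.pi ^ 2 * c))
  have hd (k) : ‖D k * g k‖ * (1 + ‖planeWaveForm (ξ k)‖) ^ 2 ≤ K * ‖g k‖ := by
    have h7 : 1 + ‖planeWaveForm (ξ k)‖ ≤ (2 + 2 * Real.pi * Fintype.card ι) * ‖ξ k‖ := by
      have := norm_planeWaveForm_le (ξ k)
      have := hξ k
      linarith
    calc ‖D k * g k‖ * (1 + ‖planeWaveForm (ξ k)‖) ^ 2
        ≤ ‖D k * g k‖ * ((2 + 2 * Real.pi * Fintype.card ι) * ‖ξ k‖) ^ 2 := by gcongr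
      _ = (2 + 2 * Real.pi * Fintype.card ι) ^ 2 * (‖D k‖ * ‖ξ k‖ ^ 2) * ‖g k‖ := by
        rw [norm_mul]; ring
      _ ≤ K * ‖g k‖ := mul_le_mul_of_nonneg_right
        (mul_le_mul_of_nonneg_left (hD k) (by positivity)) (norm_nonneg _)
  obtain ⟨hw, hw1, hw2⟩ :=
    contDiff_two_re_tsum_planeWave ξ (fun k ↦ D k * g k) (fun k ↦ K * ‖g k‖) (hg.mul_left K) hd
  let S (a) (x : ι → ℝ) : ℂ := ∑' k, mult a k * g k * planeWave (intFreq k) x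
  have hbd (a k) (x : ι → ℝ) : ‖mult a k * g k * planeWave (intFreq k) x‖ ≤ 1 / c * ‖g k‖ := by
    rw [norm_mul, norm_mul, norm_planeWave, mul_one]
    exact mul_le_mul_of_nonneg_right (hmult a k) (norm_nonneg _)
  have hS (a x) : Summable (fun k ↦ mult a k * g k * planeWave (intFreq k) x) :=
    (hg.mul_left (1 / c)).of_norm_bounded fun k ↦ hbd a k x
  have hSb (a x) : ‖planeWave θ x * S a x‖ ≤ δ := by
    rw [norm_mul, norm_planeWave, one_mul]
    refine (tsum_of_norm_bounded (hg.mul_left (1 / c)).hasSum fun k ↦ hbd a k x).trans ?_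
    rw [tsum_mul_left]
    exact le_trans (by gcongr) h6
  have hpw (k x) : planeWave (ξ k) x = planeWave (intFreq k) x * planeWave θ x :=
    planeWave_add _ _ _
  set w : (ι → ℝ) → ℝ := fun x ↦ (∑' k, D k * g k * planeWave (ξ k) x).re
  have hw1' (x i) : fderiv ℝ w x (e i) = (planeWave θ x * S (Sum.inr i) x).re := by
    rw [hw1, ← tsum_mul_left]
    congr 1
    refine tsum_congr fun k ↦ ?_
    simp only [mult, Sum.elim_inr, hpw]
    ring
  have hw2' (x i j) : fderiv ℝ (fderiv ℝ w) x (e i) (e j) =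
      (planeWave θ x * S (Sum.inl (i, j)) x).re := by
    rw [hw2, ← tsum_mul_left]
    congr 1
    refine tsum_congr fun k ↦ ?_
    simp only [mult, Sum.elim_inl, hpw]
    ring
  refine ⟨w, hw, fun i j ↦ ?_, fun i ↦ ?_, fun x hx ↦ ?_⟩
  · change |fderiv ℝ (fderiv ℝ w) 0 (e i) (e j)| ≤ δ
    rw [hw2']
    exact (Complex.abs_re_le_norm _).trans (hSb _ _)
  · change |fderiv ℝ w 0 (e i)| ≤ δ
    rw [hw1']
    exact (Complex.abs_re_le_norm _).trans (hSb _ _)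
  · change ∑ i, ∑ j, (a₀ i j + A i j (ε, x)) * fderiv ℝ (fderiv ℝ w) x (e i) (e j) +
        ∑ i, B i (ε, x) * fderiv ℝ w x (e i) = -R (ε, x)
    have key := hsol x (fun a ↦ (coef a (ε, x) : ℂ)) _ (fun a ↦ h2 a x hx) (h4 x hx)
    have hmain : ∑' k, g k * planeWave (intFreq k) x =
        ∑ i, ∑ j, (a₀ i j : ℂ) * S (Sum.inl (i, j)) x := by
      simp only [S, ← tsum_mul_left]
      have hin (i) : ∑ j, ∑' k, (a₀ i j : ℂ) *
          (mult (Sum.inl (i, j)) k * g k * planeWave (intFreq k) x) = ∑' k, ∑ j, (a₀ i j : ℂ) *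
          (mult (Sum.inl (i, j)) k * g k * planeWave (intFreq k) x) :=
        (Summable.tsum_finsetSum fun j _ ↦ (hS _ x).mul_left _).symm
      simp only [hin]
      rw [← Summable.tsum_finsetSum fun i _ ↦ summable_sum fun j _ ↦ (hS _ x).mul_left _]
      refine tsum_congr fun k ↦ ?_
      have hone : ∑ i, ∑ j, (a₀ i j : ℂ) * mult (Sum.inl (i, j)) k = 1 := by
        have hr (i j) : (a₀ i j : ℂ) * mult (Sum.inl (i, j)) k =
            ((1 / Q k * (a₀ i j * (ξ k i * ξ k j)) : ℝ) : ℂ) := by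
          simp only [mult, Sum.elim_inl, e, planeWaveForm_single, D]
          have hq : (Q k : ℂ) ≠ 0 := by exact_mod_cast (hQ0 k).ne'
          have hp : (Real.pi : ℂ) ≠ 0 := by exact_mod_cast Real.pi_ne_zero
          push_cast
          field_simp
          rw [Complex.I_sq]
          ring
        simp only [hr, ← Complex.ofReal_sum, ← Finset.mul_sum]
        rw [show ∑ i, ∑ j, a₀ i j * (ξ k i * ξ k j) = Q k from rfl, one_div_mul_cancel (hQ0 k).ne']
        simp
      calc g k * planeWave (intFreq k) x
          = (∑ i, ∑ j, (a₀ i j : ℂ) * mult (Sum.inl (i, j)) k) * (g k * planeWave (intFreq k) x) := by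
            rw [hone, one_mul]
        _ = _ := by
            simp only [Finset.sum_mul]
            exact Finset.sum_congr rfl fun i _ ↦ Finset.sum_congr rfl fun j _ ↦ by ring
    rw [hmain, Fintype.sum_sum_type, Fintype.sum_prod_type] at key
    have key2 := congrArg (fun z ↦ (planeWave θ x * z).re) key
    have hθ : planeWave θ x * -(planeWave (-θ) x * (R (ε, x) : ℂ)) = ((-R (ε, x) : ℝ) : ℂ) := by
      have : planeWave θ x * planeWave (-θ) x = 1 := by
        rw [← planeWave_add, add_neg_cancel, planeWave_zero_left]
      push_cast
      linear_combination (-(R (ε, x) : ℂ)) * this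
    simp only [hθ, Complex.ofReal_re] at key2
    rw [← key2]
    have hmv (r : ℝ) (z : ℂ) : (planeWave θ x * ((r : ℂ) * z)).re = r * (planeWave θ x * z).re := by
      rw [mul_left_comm, Complex.re_ofReal_mul]
    simp only [mul_add, Finset.mul_sum, Complex.add_re, Complex.re_sum, hw1', hw2']
    change _ = _ + (∑ i, ∑ j, (planeWave θ x * ((A i j (ε, x) : ℂ) * S (Sum.inl (i, j)) x)).re +
      ∑ i, (planeWave θ x * ((B i (ε, x) : ℂ) * S (Sum.inr i) x)).re)
    simp only [hmv, add_mul, Finset.sum_add_distrib]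
    ring

end Perturbation

section LocalSolution

variable {ι : Type*} [Fintype ι] [DecidableEq ι]

/-- A 2-jet satisfying an elliptic equation at a point is approximated by 2-jets of
local solutions. -/
lemma exists_local_solution_jet_approx [Nonempty ι] {a : ι → ι → (ι → ℝ) → ℝ}
    {b : ι → (ι → ℝ) → ℝ} (ha : ∀ i j, ContDiff ℝ ∞ (a i j)) (hb : ∀ i, ContDiff ℝ ∞ (b i))
    {c : ℝ} (hc : 0 < c) (hell : ∀ ξ : ι → ℝ, c * ‖ξ‖ ^ 2 ≤ ∑ i, ∑ j, a i j 0 * (ξ i * ξ j))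
    (C : (ι → ℝ) →L[ℝ] (ι → ℝ) →L[ℝ] ℝ) (hC : ∀ u v, C u v = C v u) (ℓ : (ι → ℝ) →L[ℝ] ℝ)
    (h0 : ∑ i, ∑ j, a i j 0 * C (Pi.single i 1) (Pi.single j 1) +
      ∑ i, b i 0 * ℓ (Pi.single i 1) = 0) {δ : ℝ} (hδ : 0 < δ) :
    ∃ f : (ι → ℝ) → ℝ, ContDiff ℝ 2 f ∧
      (∀ i j, |fderiv ℝ (fderiv ℝ f) 0 (Pi.single i 1) (Pi.single j 1) -
        C (Pi.single i 1) (Pi.single j 1)| ≤ δ) ∧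
      (∀ i, |fderiv ℝ f 0 (Pi.single i 1) - ℓ (Pi.single i 1)| ≤ δ) ∧
      ∀ᶠ x in 𝓝 0, ∑ i, ∑ j, a i j x *
          fderiv ℝ (fderiv ℝ f) x (Pi.single i 1) (Pi.single j 1) +
        ∑ i, b i x * fderiv ℝ f x (Pi.single i 1) = 0 := by
  let χ : ContDiffBump (0 : ι → ℝ) := ⟨1 / 8, 1 / 4, by norm_num, by norm_num⟩
  have hχ : ContDiff ℝ ∞ (fun q : ℝ × (ι → ℝ) ↦ χ q.2) := χ.contDiff.comp contDiff_snd
  have hχ0 (x : ι → ℝ) (hx : 1 / 4 < ‖x‖) : χ x = 0 :=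
    χ.zero_of_le_dist (by rw [dist_zero_right]; exact hx.le)
  have hχ1 (x : ι → ℝ) (hx : ‖x‖ ≤ 1 / 8) : χ x = 1 :=
    χ.one_of_mem_closedBall (by rw [mem_closedBall_zero_iff]; exact hx)
  have hsc : ContDiff ℝ ∞ (fun q : ℝ × (ι → ℝ) ↦ q.1 • q.2) := contDiff_fst.smul contDiff_snd
  let e (i : ι) : ι → ℝ := Pi.single i 1
  let A (i j) (q : ℝ × (ι → ℝ)) : ℝ := χ q.2 * (a i j (q.1 • q.2) - a i j 0)
  let B (i) (q : ℝ × (ι → ℝ)) : ℝ := χ q.2 * (q.1 * b i (q.1 • q.2))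
  let R (q : ℝ × (ι → ℝ)) : ℝ := χ q.2 *
    (∑ i, ∑ j, (a i j (q.1 • q.2) - a i j 0) * C (e i) (e j) +
      ∑ i, ((b i (q.1 • q.2) - b i 0) * ℓ (e i) + q.1 * b i (q.1 • q.2) * C q.2 (e i)))
  have hA (i j) : ContDiff ℝ ∞ (A i j) := hχ.mul (((ha i j).comp hsc).sub contDiff_const)
  have hB (i) : ContDiff ℝ ∞ (B i) := hχ.mul (contDiff_fst.mul ((hb i).comp hsc))
  have hR : ContDiff ℝ ∞ R := by
    refine hχ.mul ((ContDiff.sum fun i _ ↦ ContDiff.sum fun j _ ↦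
      (((ha i j).comp hsc).sub contDiff_const).mul contDiff_const).add
      (ContDiff.sum fun i _ ↦ ContDiff.add
        ((((hb i).comp hsc).sub contDiff_const).mul contDiff_const)
        ((contDiff_fst.mul ((hb i).comp hsc)).mul ?_)))
    exact (C.flip (e i)).contDiff.comp contDiff_snd
  have hev := exists_small_solution_perturbed (fun i j ↦ a i j 0) hc hell hA hB hR
    (fun i j ε x hx ↦ by simp [A, hχ0 x hx]) (fun i ε x hx ↦ by simp [B, hχ0 x hx])
    (fun ε x hx ↦ by simp [R, hχ0 x hx]) (fun i j x ↦ by simp [A]) (fun i x ↦ by simp [B])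
    (fun x ↦ by simp [R]) hδ
  obtain ⟨ε, ⟨w, hw, hw2, hw1, hsol⟩, hε0, hε1⟩ :=
    ((hev.filter_mono nhdsWithin_le_nhds).and
      (Ioc_mem_nhdsGT (zero_lt_one (α := ℝ)))).exists
  let f (z : ι → ℝ) : ℝ := 1 / 2 * C z z + ℓ z + ε ^ 2 * w (ε⁻¹ • z)
  have hd1 (z) : HasFDerivAt f (C z + ℓ + ε • fderiv ℝ w (ε⁻¹ • z)) z := by
    have hq : HasFDerivAt (fun z ↦ C z z) (C z + C.flip z) z := by
      have := (C.hasFDerivAt (x := z)).clm_apply (hasFDerivAt_id z)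
      exact this.congr_fderiv rfl
    have hwz : HasFDerivAt (fun z ↦ w (ε⁻¹ • z))
        ((fderiv ℝ w (ε⁻¹ • z)).comp (ε⁻¹ • ContinuousLinearMap.id ℝ (ι → ℝ))) z :=
      ((hw.differentiable (by norm_num)) (ε⁻¹ • z)).hasFDerivAt.comp z
        ((hasFDerivAt_id z).const_smul ε⁻¹)
    have := ((hq.const_mul (1 / 2)).add ℓ.hasFDerivAt).add (hwz.const_mul (ε ^ 2))
    refine HasFDerivAt.congr_fderiv this (ContinuousLinearMap.ext fun v ↦ ?_)
    simp only [add_apply, smul_apply, ContinuousLinearMap.flip_apply, hC v z, smul_eq_mul,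
      ContinuousLinearMap.comp_apply, ContinuousLinearMap.id_apply, map_smul]
    field_simp
    ring
  have hf1 : fderiv ℝ f = fun z ↦ C z + ℓ + ε • fderiv ℝ w (ε⁻¹ • z) :=
    funext fun z ↦ (hd1 z).fderiv
  have hw' : ContDiff ℝ 1 (fderiv ℝ w) := hw.fderiv_right (by norm_num)
  have hd2 (z) : HasFDerivAt (fderiv ℝ f) (C + fderiv ℝ (fderiv ℝ w) (ε⁻¹ • z)) z := by
    rw [hf1]
    have hwz : HasFDerivAt (fun z ↦ fderiv ℝ w (ε⁻¹ • z))
        ((fderiv ℝ (fderiv ℝ w) (ε⁻¹ • z)).comp (ε⁻¹ • ContinuousLinearMap.id ℝ (ι → ℝ))) z :=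
      ((hw'.differentiable (by norm_num)) (ε⁻¹ • z)).hasFDerivAt.comp z
        ((hasFDerivAt_id z).const_smul ε⁻¹)
    have := (C.hasFDerivAt (x := z).add_const ℓ).add (hwz.const_smul ε)
    refine HasFDerivAt.congr_fderiv this
      (ContinuousLinearMap.ext fun u ↦ ContinuousLinearMap.ext fun v ↦ ?_)
    simp only [add_apply, smul_apply, smul_eq_mul,
      ContinuousLinearMap.comp_apply, ContinuousLinearMap.id_apply, map_smul]
    field_simp
  have hf2 (z) : fderiv ℝ (fderiv ℝ f) z = C + fderiv ℝ (fderiv ℝ w) (ε⁻¹ • z) := (hd2 z).fderiv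
  refine ⟨f, ?_, fun i j ↦ ?_, fun i ↦ ?_, ?_⟩
  · have h1 : ContDiff ℝ 2 (fun z ↦ C z z) := C.contDiff.clm_apply contDiff_id
    have h2 : ContDiff ℝ 2 (fun z : ι → ℝ ↦ w (ε⁻¹ • z)) := hw.comp (contDiff_const_smul _)
    exact ((contDiff_const.mul h1).add ℓ.contDiff).add (contDiff_const.mul h2)
  · rw [hf2, add_apply, add_apply, smul_zero, add_sub_cancel_left]
    exact hw2 i j
  · rw [hf1]
    simp only [map_zero, zero_add, add_apply, smul_apply, smul_zero, smul_eq_mul,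
      add_sub_cancel_left, abs_mul, abs_of_pos hε0]
    exact (mul_le_of_le_one_left (abs_nonneg _) hε1).trans (hw1 i)
  · have hev : ∀ᶠ z : ι → ℝ in 𝓝 0, ‖ε⁻¹ • z‖ < 1 / 8 := by
      have : Continuous fun z : ι → ℝ ↦ ‖ε⁻¹ • z‖ := by fun_prop
      exact this.continuousAt.eventually_lt continuousAt_const (by simp)
    filter_upwards [hev] with z hz
    obtain ⟨x, rfl⟩ : ∃ x, z = ε • x := ⟨ε⁻¹ • z, by rw [smul_inv_smul₀ hε0.ne']⟩
    rw [inv_smul_smul₀ hε0.ne'] at hz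
    have h := hsol x (by linarith)
    simp only [A, B, R, hχ1 x hz.le, one_mul, add_sub_cancel] at h
    rw [hf1]
    simp only [← hf1, hf2, add_apply, smul_apply, inv_smul_smul₀ hε0.ne', map_smul, smul_eq_mul,
      mul_add, Finset.sum_add_distrib, sub_mul, Finset.sum_sub_distrib] at h ⊢
    simp only [← mul_assoc] at h ⊢
    simp only [mul_comm (b _ _) ε] at h ⊢
    linarith

end LocalSolution

end Analysis

section Geometry

open Bundle Set Filter VectorField
open scoped Manifold ContDiff Topology

section Gradient

variable {E : Type*} [NormedAddCommGroup E] [NormedSpace ℝ E]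
  {H : Type*} [TopologicalSpace H] {I : ModelWithCorners ℝ E H}
  {M : Type*} [TopologicalSpace M] [ChartedSpace H M] [IsManifold I ∞ M]
  {F : Type*} [NormedAddCommGroup F] [NormedSpace ℝ F]

/-- The derivative of a `C^{k+1}` function is a `C^k` section of the cotangent bundle. -/
lemma ContMDiffAt.mvfderiv_section {f : M → F} {x : M} {k : ℕ∞ω}
    (hf : ContMDiffAt I 𝓘(ℝ, F) (k + 1) f x) :
    ContMDiffAt I (I.prod 𝓘(ℝ, E →L[ℝ] F)) k
      (fun y ↦ TotalSpace.mk' (E →L[ℝ] F)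
        (E := fun y : M ↦ TangentSpace I y →L[ℝ] Bundle.Trivial M F y) y (d% f y)) x := by
  rw [contMDiffAt_hom_bundle]
  refine ⟨contMDiffAt_id, ?_⟩
  have := hf.mfderiv_const (m := k) le_rfl
  refine this.congr_of_eventuallyEq (Eventually.of_forall fun y ↦ ?_)
  ext v
  simp [inTangentCoordinates, ContinuousLinearMap.inCoordinates, mvfderiv]
  rfl

/-- The derivative of a `C^{k+1}` function along a `C^k` vector field is `C^k`. -/
lemma ContMDiffAt.mvfderiv_apply {f : M → F} {Y : Π x : M, TangentSpace I x} {x : M} {k : ℕ∞ω}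
    (hf : ContMDiffAt I 𝓘(ℝ, F) (k + 1) f x) (hY : ContMDiffAt I I.tangent k (T% Y) x) :
    ContMDiffAt I 𝓘(ℝ, F) k (fun y ↦ d% f y (Y y)) x := by
  have := hf.mvfderiv_section.clm_bundle_apply (F₁ := E) (F₂ := F)
    (E₁ := fun y : M ↦ TangentSpace I y) (E₂ := Bundle.Trivial M F) hY
  rw [contMDiffAt_section] at this
  exact this

/-- The derivative of a `C²` function along a differentiable vector field is differentiable. -/
lemma ContMDiffAt.mdifferentiableAt_mvfderiv_apply {f : M → F} {Y : Π x : M, TangentSpace I x}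
    {x : M} (hf : ContMDiffAt I 𝓘(ℝ, F) 2 f x) (hY : MDiffAt (T% Y) x) :
    MDiffAt (fun y ↦ d% f y (Y y)) x := by
  have h1 := (ContMDiffAt.mvfderiv_section (k := 1)
    (hf.of_le (by norm_num))).mdifferentiableAt one_ne_zero
  have := h1.clm_bundle_apply (F₁ := E) (F₂ := F)
    (E₁ := fun y : M ↦ TangentSpace I y) (E₂ := Bundle.Trivial M F) hY
  rw [mdifferentiableAt_section] at this
  exact this

lemma ContMDiffAt.matrix_det {ι : Type*} [Fintype ι] [DecidableEq ι] {A : M → Matrix ι ι ℝ}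
    {x : M} {k : ℕ∞ω} (hA : ∀ i j, ContMDiffAt I 𝓘(ℝ, ℝ) k (fun y ↦ A y i j) x) :
    ContMDiffAt I 𝓘(ℝ, ℝ) k (fun y ↦ (A y).det) x := by
  simp only [Matrix.det_apply']
  exact contMDiffAt_finsetSum fun σ _ ↦ contMDiffAt_const.mul
    (contMDiffAt_finsetProd fun i _ ↦ hA _ _)

/-- The entries of the inverse of a matrix with `C^k` entries are `C^k`. -/
lemma ContMDiffAt.matrix_inv {ι : Type*} [Fintype ι] [DecidableEq ι] {A : M → Matrix ι ι ℝ}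
    {x : M} {k : ℕ∞ω} (hA : ∀ i j, ContMDiffAt I 𝓘(ℝ, ℝ) k (fun y ↦ A y i j) x)
    (hdet : (A x).det ≠ 0) (i j : ι) :
    ContMDiffAt I 𝓘(ℝ, ℝ) k (fun y ↦ (A y)⁻¹ i j) x := by
  simp only [Matrix.inv_def, Matrix.smul_apply, Matrix.adjugate_apply, Ring.inverse_eq_inv',
    smul_eq_mul]
  refine (ContMDiffAt.inv₀ (ContMDiffAt.matrix_det hA) hdet).mul
    (ContMDiffAt.matrix_det fun a b ↦ ?_)
  by_cases h : a = j
  · subst h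
    simpa using contMDiffAt_const
  · simpa [Matrix.updateRow_ne h] using hA a b

variable [FiniteDimensional ℝ E] [RiemannianBundle (fun x : M ↦ TangentSpace I x)]

lemma inner_grad_left (f : M → ℝ) (x : M) (v : TangentSpace I x) :
    inner ℝ (grad I f x) v = d% f x v := by
  simp [grad]

lemma inner_grad_right (f : M → ℝ) (x : M) (v : TangentSpace I x) :
    inner ℝ v (grad I f x) = d% f x v := by
  rw [real_inner_comm, inner_grad_left]

variable [IsContMDiffRiemannianBundle I ∞ E (fun x : M ↦ TangentSpace I x)]

/-- The gradient of a `C^{k+1}` function is a `C^k` vector field. -/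
lemma ContMDiffAt.grad {f : M → ℝ} {x : M} {k : ℕ∞}
    (hf : ContMDiffAt I 𝓘(ℝ, ℝ) (k + 1) f x) :
    ContMDiffAt I I.tangent k (T% (RiemGeom.grad I f)) x := by
  classical
  let e := trivializationAt E (fun y : M ↦ TangentSpace I y) x
  let b := Module.finBasis ℝ E
  have hx : x ∈ e.baseSet := FiberBundle.mem_baseSet_trivializationAt' x
  let s := e.localFrame b
  have hs : IsLocalFrameOn I E k s e.baseSet := e.isLocalFrameOn_localFrame_baseSet I k b
  have hsx (i) : ContMDiffAt I I.tangent k (T% (s i)) x := hs.contMDiffAt e.open_baseSet hx i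
  let G : M → Matrix _ _ ℝ := fun y ↦ Matrix.gram ℝ (fun i ↦ s i y)
  have hG (i j) : ContMDiffAt I 𝓘(ℝ, ℝ) k (fun y ↦ G y i j) x :=
    ContMDiffAt.inner_bundle (F := E) (E := fun x : M ↦ TangentSpace I x) (IB := I) (b := id)
      (hsx i) (hsx j)
  have hdet {y} (hy : y ∈ e.baseSet) : (G y).det ≠ 0 :=
    (Matrix.posDef_gram_of_linearIndependent (hs.linearIndependent hy)).det_pos.ne'
  have key : ContMDiffAt I I.tangent k
      (T% (fun y ↦ ∑ i, (∑ j, (G y)⁻¹ i j * d% f y (s j y)) • s i y)) x := by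
    refine ContMDiffAt.sum_section fun i _ ↦ ContMDiffAt.smul_section ?_ (hsx i)
    exact contMDiffAt_finsetSum fun j _ ↦
      (ContMDiffAt.matrix_inv hG (hdet hx) i j).mul (hf.mvfderiv_apply (hsx j))
  refine key.congr_of_eventuallyEq ?_
  filter_upwards [e.open_baseSet.mem_nhds hx] with y hy
  suffices RiemGeom.grad I f y = ∑ i, (∑ j, (G y)⁻¹ i j * d% f y (s j y)) • s i y by
    simp [this]
  refine InnerProductSpace.ext_inner_left_basis (hs.toBasisAt hy) fun l ↦ ?_
  rw [IsLocalFrameOn.toBasisAt_coe, inner_grad_right, inner_sum]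
  simp only [real_inner_smul_right]
  have h1 : ∀ j, ∑ i, G y l i * (G y)⁻¹ i j = if l = j then 1 else 0 := fun j ↦ by
    rw [← Matrix.mul_apply, Matrix.mul_nonsing_inv _ (isUnit_iff_ne_zero.2 (hdet hy)),
      Matrix.one_apply]
  calc d% f y (s l y) = ∑ j, (∑ i, G y l i * (G y)⁻¹ i j) * d% f y (s j y) := by simp [h1]
    _ = _ := by
      simp only [Finset.sum_mul]
      rw [Finset.sum_comm]
      exact Finset.sum_congr rfl fun i _ ↦ Finset.sum_congr rfl fun j _ ↦ by
        simp only [G, Matrix.gram_apply]; ring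

/-- The second derivatives of a `C²` function along two vector fields differ by the derivative
along the Lie bracket. -/
lemma mvfderiv_mlieBracket [I.Boundaryless] {f : M → ℝ} {X Y : Π x : M, TangentSpace I x} {x : M}
    (hf : ContMDiffAt I 𝓘(ℝ, ℝ) 2 f x) (hX : MDiffAt (T% X) x) (hY : MDiffAt (T% Y) x) :
    d% f x (mlieBracket I X Y x) =
      d% (fun y ↦ d% f y (Y y)) x (X x) - d% (fun y ↦ d% f y (X y)) x (Y x) := by
  set φ := extChartAt I x with hφ
  set z₀ := φ x
  have hz₀ : z₀ ∈ φ.target := mem_extChartAt_target x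
  have htgt : φ.target ∈ 𝓝 z₀ := extChartAt_target_mem_nhds x
  have hx : φ.symm z₀ = x := extChartAt_to_inv x
  let pb (V : Π x : M, TangentSpace I x) : E → E :=
    mpullbackWithin 𝓘(ℝ, E) I φ.symm V (range I)
  have hψ {z} (hz : z ∈ φ.target) : MDiffAt φ.symm z := by
    have := mdifferentiableWithinAt_extChartAt_symm (I := I) hz
    rwa [I.range_eq_univ, mdifferentiableWithinAt_univ] at this
  have hpb (V : Π x : M, TangentSpace I x) {z} (hz : z ∈ φ.target) :
      mfderiv% φ.symm z (pb V z) = V (φ.symm z) := by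
    have h := isInvertible_mfderivWithin_extChartAt_symm (I := I) hz
    have := h.self_apply_inverse (V (φ.symm z))
    rw [← mfderivWithin_univ, ← I.range_eq_univ]
    exact this
  have hchain {g : M → ℝ} {z : E} (hz : z ∈ φ.target) (hg : MDiffAt g (φ.symm z)) (v : E) :
      d% g (φ.symm z) (mfderiv% φ.symm z v) = fderiv ℝ (g ∘ φ.symm) z v := by
    have := mvfderiv_comp_apply z hg (hψ hz) v
    rw [← this]
    simp [mvfderiv]
    rfl
  have hpbd {V : Π x : M, TangentSpace I x} (hV : MDiffAt (T% V) x) :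
      DifferentiableAt ℝ (pb V) z₀ := by
    have : DifferentiableWithinAt ℝ (pb V) (φ.symm ⁻¹' univ ∩ range I) z₀ :=
      MDifferentiableWithinAt.differentiableWithinAt_mpullbackWithin_vectorField
        (s := univ) (mdifferentiableWithinAt_univ.2 hV)
    rw [preimage_univ, univ_inter, I.range_eq_univ] at this
    exact differentiableWithinAt_univ.1 this
  have hψc : ContMDiffAt 𝓘(ℝ, E) I 2 φ.symm z₀ := by
    have := contMDiffWithinAt_extChartAt_symm_range_self (n := 2) (I := I) x
    rwa [I.range_eq_univ, contMDiffWithinAt_univ] at this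
  set f' : E → ℝ := f ∘ φ.symm
  have hf' : ContDiffAt ℝ 2 f' z₀ :=
    (ContMDiffAt.comp (g := f) z₀ (by rw [hx]; exact hf) hψc).contDiffAt
  have hfn : ∀ᶠ z in 𝓝 z₀, MDiffAt f (φ.symm z) := by
    have h1 : ∀ᶠ y in 𝓝 (φ.symm z₀), ContMDiffAt I 𝓘(ℝ, ℝ) 2 f y := by
      rw [hx]
      exact (contMDiffAt_iff_contMDiffAt_nhds (by simp)).1 hf
    filter_upwards [hψc.continuousAt.eventually h1] with z hz
    exact hz.mdifferentiableAt two_ne_zero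
  have hsnd {V W : Π x : M, TangentSpace I x} (hW : MDiffAt (T% W) x) :
      d% (fun y ↦ d% f y (W y)) x (V x) =
        fderiv ℝ (fderiv ℝ f') z₀ (pb V z₀) (pb W z₀) +
          fderiv ℝ f' z₀ (fderiv ℝ (pb W) z₀ (pb V z₀)) := by
    have hg := hf.mdifferentiableAt_mvfderiv_apply hW
    have h1 := hchain (g := fun y ↦ d% f y (W y)) hz₀ (by rw [hx]; exact hg) (pb V z₀)
    rw [hpb V hz₀, hx] at h1
    rw [h1]
    have h2 : (fun y ↦ d% f y (W y)) ∘ φ.symm =ᶠ[𝓝 z₀] fun z ↦ fderiv ℝ f' z (pb W z) := by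
      filter_upwards [htgt, hfn] with z hz hfz
      rw [← hchain hz hfz, hpb W hz]
      rfl
    rw [h2.fderiv_eq]
    have h3 : DifferentiableAt ℝ (fderiv ℝ f') z₀ :=
      (hf'.fderiv_right (m := 1) (by norm_num)).differentiableAt one_ne_zero
    rw [fderiv_clm_apply h3 (hpbd hW)]
    simp
    ring
  rw [hsnd hX, hsnd hY]
  have hsymm : IsSymmSndFDerivAt ℝ f' z₀ := hf'.isSymmSndFDerivAt (by simp)
  have hL : d% f x (mlieBracket I X Y x) =
      fderiv ℝ f' z₀ (lieBracket ℝ (pb X) (pb Y) z₀) := by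
    have hinv := isInvertible_mfderiv_extChartAt (I := I) (mem_extChartAt_source (I := I) x)
    have h1 : mfderiv% φ x (mlieBracket I X Y x) = lieBracket ℝ (E := E) (pb X) (pb Y) z₀ := by
      have h : lieBracketWithin ℝ (E := E) (pb X) (pb Y) (φ.symm ⁻¹' univ ∩ range I) z₀ =
          lieBracket ℝ (E := E) (pb X) (pb Y) z₀ := by
        rw [preimage_univ, univ_inter, I.range_eq_univ]
        exact congrFun lieBracketWithin_univ _
      exact (hinv.self_apply_inverse _).trans h
    have h2 : f =ᶠ[𝓝 x] f' ∘ φ := by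
      filter_upwards [extChartAt_source_mem_nhds (I := I) x] with y hy
      simp [f', φ.left_inv hy]
    have h3 : d% f x (mlieBracket I X Y x) =
        mfderiv% f' z₀ (mfderiv% φ x (mlieBracket I X Y x)) := by
      rw [← mfderiv_comp_apply x
        (hf'.differentiableAt two_ne_zero).mdifferentiableAt
        (mdifferentiableAt_extChartAt (mem_chart_source H x)), ← h2.mfderiv_eq]
      rfl
    rw [h3, h1, mfderiv_eq_fderiv]
    rfl
  rw [hL, lieBracket, hsymm.eq (pb X z₀) (pb Y z₀)]
  simp

/-- The gradient of a `C²` function is differentiable. -/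
lemma ContMDiffAt.mdifferentiableAt_grad {f : M → ℝ} {x : M}
    (hf : ContMDiffAt I 𝓘(ℝ, ℝ) 2 f x) : MDiffAt (T% (RiemGeom.grad I f)) x :=
  (ContMDiffAt.grad (k := 1) (hf.of_le (by norm_num))).mdifferentiableAt one_ne_zero

namespace RiemGeom

variable (I) in
/-- The Hessian of `f` as a bilinear form: `Hess f (v, w) = ⟨∇_v grad f, w⟩`. -/
noncomputable def hess (f : M → ℝ) (x : M) (v w : TangentSpace I x) : ℝ :=
  inner ℝ (leviCivita I M (grad I f) x v) w

/-- The Hessian of a `C²` function is symmetric. -/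
lemma hess_symm [I.Boundaryless] {f : M → ℝ} {x : M} (hf : ContMDiffAt I 𝓘(ℝ, ℝ) 2 f x)
    (v w : TangentSpace I x) : hess I f x v w = hess I f x w v := by
  obtain ⟨X, hX, rfl⟩ : ∃ Z : Π x : M, TangentSpace I x, MDiffAt (T% Z) x ∧ Z x = v :=
    ⟨FiberBundle.extend E v, FiberBundle.mdifferentiableAt_extend I E v, by simp⟩
  obtain ⟨Y, hY, rfl⟩ : ∃ Z : Π x : M, TangentSpace I x, MDiffAt (T% Z) x ∧ Z x = w :=
    ⟨FiberBundle.extend E w, FiberBundle.mdifferentiableAt_extend I E w, by simp⟩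
  have hg := hf.mdifferentiableAt_grad
  have h1 := mvfderiv_mlieBracket hf hX hY
  have h2 := leviCivita_metric I hX hg hY
  have h3 := leviCivita_metric I hY hg hX
  have h4 : leviCivita I M Y x (X x) - leviCivita I M X x (Y x) = mlieBracket I X Y x :=
    (CovariantDerivative.torsion_eq_zero_iff _).1 (leviCivita_torsion I) hX hY
  simp only [inner_grad_left] at h2 h3
  rw [← h4, map_sub, h2, h3] at h1
  simp only [hess]
  linarith

/-- The Hessian of `f` on two gradients, in terms of inner products of gradients. -/
lemma hess_grad_grad [I.Boundaryless] {f g h : M → ℝ} {x : M}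
    (hf : ContMDiffAt I 𝓘(ℝ, ℝ) 2 f x) (hg : ContMDiffAt I 𝓘(ℝ, ℝ) 2 g x)
    (hh : ContMDiffAt I 𝓘(ℝ, ℝ) 2 h x) :
    hess I f x (grad I g x) (grad I h x) = (1 / 2) *
      (d% (fun y ↦ inner ℝ (grad I f y) (grad I h y)) x (grad I g x) +
        d% (fun y ↦ inner ℝ (grad I f y) (grad I g y)) x (grad I h x) -
        d% (fun y ↦ inner ℝ (grad I g y) (grad I h y)) x (grad I f x)) := by
  have hF := hf.mdifferentiableAt_grad
  have hG := hg.mdifferentiableAt_grad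
  have hH := hh.mdifferentiableAt_grad
  rw [leviCivita_metric I hG hF hH, leviCivita_metric I hH hF hG, leviCivita_metric I hF hG hH]
  have h1 := hess_symm hf (grad I g x) (grad I h x)
  have h2 := hess_symm hg (grad I f x) (grad I h x)
  have h3 := hess_symm hh (grad I f x) (grad I g x)
  simp only [hess] at h1 h2 h3 ⊢
  rw [real_inner_comm _ (grad I f x), real_inner_comm _ (grad I f x), real_inner_comm _ (grad I g x)]
  linarith

lemma laplacian_eq_trace (f : M → ℝ) (x : M) :
    laplacian I f x = LinearMap.trace ℝ _ (leviCivita I M (grad I f) x).toLinearMap := rfl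

lemma hess_eq_sub {f : M → ℝ} {x : M} (hf : ContMDiffAt I 𝓘(ℝ, ℝ) 2 f x)
    {W : Π x : M, TangentSpace I x} (hW : MDiffAt (T% W) x) (v : TangentSpace I x) :
    hess I f x v (W x) =
      d% (fun y ↦ d% f y (W y)) x v - d% f x (leviCivita I M W x v) := by
  obtain ⟨X, hX, rfl⟩ : ∃ Z : Π x : M, TangentSpace I x, MDiffAt (T% Z) x ∧ Z x = v :=
    ⟨FiberBundle.extend E v, FiberBundle.mdifferentiableAt_extend I E v, by simp⟩
  have h := leviCivita_metric I hX hf.mdifferentiableAt_grad hW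
  simp only [inner_grad_left] at h
  rw [h, hess]
  ring

lemma laplacian_eq_sum_hess {ι : Type*} [Fintype ι] (f : M → ℝ) (x : M)
    (b : OrthonormalBasis ι ℝ (TangentSpace I x)) :
    laplacian I f x = ∑ i, hess I f x (b i) (b i) := by
  classical
  rw [laplacian_eq_trace, LinearMap.trace_eq_sum_inner _ b]
  exact Finset.sum_congr rfl fun i _ ↦ real_inner_comm _ _

variable {V W : Type*} [NormedAddCommGroup V] [NormedSpace ℝ V] [NormedAddCommGroup W]
  [NormedSpace ℝ W]

lemma _root_.Filter.EventuallyEq.mvfderiv_eq {f g : M → V} {x : M} (h : f =ᶠ[𝓝 x] g) :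
    d% f x = d% g x := by
  ext v
  have := h.mfderiv_eq (I := I) (I' := 𝓘(ℝ, V))
  exact congrArg (fun A : E →L[ℝ] V ↦ A v) this

lemma mvfderiv_comp_vectorSpace {u : M → V} {G : V → W} {x : M} (hG : DifferentiableAt ℝ G (u x))
    (hu : MDiffAt u x) (v : TangentSpace I x) :
    d% (fun y ↦ G (u y)) x v = fderiv ℝ G (u x) (d% u x v) := by
  have := mfderiv_comp_apply x hG.mdifferentiableAt hu v
  rw [mfderiv_eq_fderiv] at this
  exact this

lemma mvfderiv_prodMk {u : M → V} {p : M → W} {x : M} (hu : MDiffAt u x) (hp : MDiffAt p x)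
    (v : TangentSpace I x) :
    mvfderiv I (fun y ↦ (u y, p y)) x v = (d% u x v, d% p x v) := by
  rw [mvfderiv, modelWithCornersSelf_prod, ← chartedSpaceSelf_prod]
  simp [mfderiv_prodMk hu hp]
  rfl

lemma hess_comp {u : M → V} {F : V → ℝ} {x : M} (hF : ContDiffAt ℝ 2 F (u x))
    (hu : ContMDiffAt I 𝓘(ℝ, V) 2 u x) {Y : Π x : M, TangentSpace I x} (hY : MDiffAt (T% Y) x)
    (v : TangentSpace I x) :
    hess I (fun y ↦ F (u y)) x v (Y x) =
      fderiv ℝ (fderiv ℝ F) (u x) (d% u x v) (d% u x (Y x)) +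
        fderiv ℝ F (u x) (d% (fun y ↦ d% u y (Y y)) x v - d% u x (leviCivita I M Y x v)) := by
  have hu1 : MDiffAt u x := hu.mdifferentiableAt two_ne_zero
  have hFu : ContMDiffAt I 𝓘(ℝ, ℝ) 2 (fun y ↦ F (u y)) x := hF.contMDiffAt.comp x hu
  have hp := hu.mdifferentiableAt_mvfderiv_apply hY
  rw [hess_eq_sub hFu hY, mvfderiv_comp_vectorSpace (hF.differentiableAt two_ne_zero) hu1]
  let Φ : V × V → ℝ := fun q ↦ fderiv ℝ F q.1 q.2
  have hev : (fun y ↦ d% (fun y ↦ F (u y)) y (Y y)) =ᶠ[𝓝 x]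
      fun y ↦ Φ (u y, d% u y (Y y)) := by
    have h1 : ∀ᶠ y in 𝓝 x, ContMDiffAt I 𝓘(ℝ, V) 2 u y :=
      (contMDiffAt_iff_contMDiffAt_nhds (by simp)).1 hu
    have h2 : ∀ᶠ y in 𝓝 x, ContDiffAt ℝ 2 F (u y) :=
      hu.continuousAt.eventually (hF.eventually (by simp))
    filter_upwards [h1, h2] with y hy hy'
    exact mvfderiv_comp_vectorSpace (hy'.differentiableAt two_ne_zero)
      (hy.mdifferentiableAt two_ne_zero) _
  have h3 : DifferentiableAt ℝ (fderiv ℝ F) (u x) :=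
    (hF.fderiv_right (m := 1) (by norm_num)).differentiableAt one_ne_zero
  have hΦ : HasFDerivAt Φ _ (u x, d% u x (Y x)) :=
    (h3.hasFDerivAt.comp (u x, d% u x (Y x)) hasFDerivAt_fst).clm_apply hasFDerivAt_snd
  rw [hev.mvfderiv_eq, mvfderiv_comp_vectorSpace (u := fun y ↦ (u y, d% u y (Y y))) hΦ.differentiableAt
    (hu1.prodMk_space hp), hΦ.fderiv, mvfderiv_prodMk hu1 hp]
  simp
  ring

end RiemGeom

end Gradient

/-- The trace of an endomorphism in terms of a basis with Gram matrix `G`. -/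
lemma LinearMap.trace_eq_sum_gram_inv {ι V : Type*} [Fintype ι] [DecidableEq ι]
    [NormedAddCommGroup V] [InnerProductSpace ℝ V] (b : Module.Basis ι ℝ V) (A : V →ₗ[ℝ] V) :
    LinearMap.trace ℝ V A = ∑ i, ∑ j, (Matrix.gram ℝ b)⁻¹ i j * inner ℝ (A (b i)) (b j) := by
  have hdet : (Matrix.gram ℝ b).det ≠ 0 :=
    (Matrix.posDef_gram_of_linearIndependent b.linearIndependent).det_pos.ne'
  rw [LinearMap.trace_eq_matrix_trace ℝ b, Matrix.trace]
  refine Finset.sum_congr rfl fun i _ ↦ ?_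
  have h1 (j) : inner ℝ (A (b i)) (b j) = ∑ k, Matrix.gram ℝ b j k * b.repr (A (b i)) k := by
    conv_lhs => rw [← b.sum_repr (A (b i))]
    rw [sum_inner]
    exact Finset.sum_congr rfl fun k _ ↦ by
      rw [real_inner_smul_left, Matrix.gram_apply, real_inner_comm]; ring
  have h2 : ∀ k, ∑ j, (Matrix.gram ℝ b)⁻¹ i j * Matrix.gram ℝ b j k = if i = k then 1 else 0 :=
    fun k ↦ by
      rw [← Matrix.mul_apply, Matrix.nonsing_inv_mul _ (isUnit_iff_ne_zero.2 hdet),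
        Matrix.one_apply]
  simp only [h1, Finset.mul_sum, ← mul_assoc]
  rw [Finset.sum_comm]
  simp only [← Finset.sum_mul, h2]
  simp [LinearMap.toMatrix_apply]

section Laplacian

variable {E : Type*} [NormedAddCommGroup E] [NormedSpace ℝ E] [FiniteDimensional ℝ E]
  {H : Type*} [TopologicalSpace H] {I : ModelWithCorners ℝ E H}
  {M : Type*} [TopologicalSpace M] [ChartedSpace H M] [IsManifold I ∞ M]
  [RiemannianBundle (fun x : M ↦ TangentSpace I x)]
  [IsContMDiffRiemannianBundle I ∞ E (fun x : M ↦ TangentSpace I x)]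

namespace RiemGeom

lemma _root_.Filter.EventuallyEq.laplacian_eq {f g : M → ℝ} {x : M} (h : f =ᶠ[𝓝 x] g)
    (hf : ContMDiffAt I 𝓘(ℝ, ℝ) 2 f x) : laplacian I f x = laplacian I g x := by
  have hg : ContMDiffAt I 𝓘(ℝ, ℝ) 2 g x := hf.congr_of_eventuallyEq h.symm
  have h1 : ∀ᶠ y in 𝓝 x, grad I f y = grad I g y := by
    filter_upwards [h.eventuallyEq_nhds] with y hy
    rw [grad, grad, hy.mvfderiv_eq]
  rw [laplacian, laplacian, (leviCivita I M).isCovariantDerivativeOn.congr_of_eventuallyEq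
    hf.mdifferentiableAt_grad hg.mdifferentiableAt_grad univ_mem h1]

/-- The Laplacian of a composition with a map to `ℝ^ι`. -/
lemma laplacian_comp {ι : Type*} [Fintype ι] [DecidableEq ι] {u : M → ι → ℝ} {F : (ι → ℝ) → ℝ}
    {x : M} (hF : ContDiffAt ℝ 2 F (u x)) (hu : ContMDiffAt I 𝓘(ℝ, ι → ℝ) 2 u x) :
    laplacian I (fun y ↦ F (u y)) x =
      ∑ i, ∑ j, fderiv ℝ (fderiv ℝ F) (u x) (Pi.single i 1) (Pi.single j 1) *
        inner ℝ (grad I (fun y ↦ u y i) x) (grad I (fun y ↦ u y j) x) +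
      ∑ i, fderiv ℝ F (u x) (Pi.single i 1) * laplacian I (fun y ↦ u y i) x := by
  let b := stdOrthonormalBasis ℝ (TangentSpace I x)
  have hproj {p : M → ι → ℝ} {y : M} (hp : MDifferentiableAt I 𝓘(ℝ, ι → ℝ) p y)
      (w : TangentSpace I y) (i : ι) : mvfderiv I p y w i = d% (fun z ↦ p z i) y w := by
    have := mvfderiv_comp_vectorSpace (G := fun q : ι → ℝ ↦ q i) (by fun_prop) hp w
    rw [this]
    have h : fderiv ℝ (fun q : ι → ℝ ↦ q i) (p y) =
        ContinuousLinearMap.proj (R := ℝ) (φ := fun _ : ι ↦ ℝ) i :=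
      (ContinuousLinearMap.proj (R := ℝ) (φ := fun _ : ι ↦ ℝ) i).fderiv
    rw [h]
    rfl
  have hu1 : MDifferentiableAt I 𝓘(ℝ, ι → ℝ) u x := hu.mdifferentiableAt two_ne_zero
  have hc (w : TangentSpace I x) : mvfderiv I u x w =
      ∑ i, d% (fun y ↦ u y i) x w • (Pi.single i 1 : ι → ℝ) := by
    ext j
    simp [hproj hu1 w j, Pi.single_apply]
  have hui (i) : ContMDiffAt I 𝓘(ℝ, ℝ) 2 (fun y ↦ u y i) x :=
    (contDiff_apply ℝ ℝ i).contDiffAt.contMDiffAt.comp x hu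
  have hh (w : TangentSpace I x) : hess I (fun y ↦ F (u y)) x w w =
      ∑ i, ∑ j, fderiv ℝ (fderiv ℝ F) (u x) (Pi.single i 1) (Pi.single j 1) *
        (d% (fun y ↦ u y i) x w * d% (fun y ↦ u y j) x w) +
      ∑ i, fderiv ℝ F (u x) (Pi.single i 1) * hess I (fun y ↦ u y i) x w w := by
    obtain ⟨X, hX, rfl⟩ : ∃ Z : Π x : M, TangentSpace I x, MDiffAt (T% Z) x ∧ Z x = w :=
      ⟨FiberBundle.extend E w, FiberBundle.mdifferentiableAt_extend I E w, by simp⟩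
    rw [hess_comp hF hu hX]
    congr 1
    · rw [hc]
      simp only [map_sum, map_smul, sum_apply, smul_apply, smul_eq_mul, Finset.mul_sum]
      rw [Finset.sum_comm]
      exact Finset.sum_congr rfl fun i _ ↦ Finset.sum_congr rfl fun j _ ↦ by ring
    · have hd : mvfderiv I (fun y ↦ mvfderiv I u y (X y)) x (X x) -
            mvfderiv I u x (leviCivita I M X x (X x)) =
          ∑ i, hess I (fun y ↦ u y i) x (X x) (X x) • (Pi.single i 1 : ι → ℝ) := by
        ext i
        have h1 : (fun y ↦ mvfderiv I u y (X y) i) =ᶠ[𝓝 x]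
            fun y ↦ d% (fun z ↦ u z i) y (X y) := by
          filter_upwards [(contMDiffAt_iff_contMDiffAt_nhds (by simp)).1 hu] with y hy
          exact hproj (hy.mdifferentiableAt two_ne_zero) _ i
        rw [Pi.sub_apply, hproj (hu.mdifferentiableAt_mvfderiv_apply hX), hproj hu1,
          h1.mvfderiv_eq, ← hess_eq_sub (hui i) hX]
        simp [Pi.single_apply]
      rw [hd]
      simp [map_sum, mul_comm]
  have hin (f g : M → ℝ) : ∑ k, d% f x (b k) * d% g x (b k) =
      inner ℝ (grad I f x) (grad I g x) := by
    rw [← b.sum_inner_mul_inner]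
    simp only [inner_grad_left, inner_grad_right]
  rw [laplacian_eq_sum_hess _ _ b]
  simp only [hh, Finset.sum_add_distrib, laplacian_eq_sum_hess _ _ b, ← hin, Finset.mul_sum]
  congr 1
  · rw [Finset.sum_comm]
    refine Finset.sum_congr rfl fun i _ ↦ ?_
    rw [Finset.sum_comm]
  · rw [Finset.sum_comm]

lemma two_le_infty : (2 : ℕ∞ω) ≤ ∞ := ENat.LEInfty.out

lemma laplacian_mul {f g : M → ℝ} {x : M} (hf : ContMDiffAt I 𝓘(ℝ, ℝ) 2 f x)
    (hg : ContMDiffAt I 𝓘(ℝ, ℝ) 2 g x) :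
    laplacian I (fun y ↦ f y * g y) x = f x * laplacian I g x + g x * laplacian I f x +
      2 * inner ℝ (grad I f x) (grad I g x) := by
  let b := stdOrthonormalBasis ℝ (TangentSpace I x)
  have hf1 := hf.mdifferentiableAt two_ne_zero
  have hg1 := hg.mdifferentiableAt two_ne_zero
  have hh (w : TangentSpace I x) : hess I (fun y ↦ f y * g y) x w w =
      f x * hess I g x w w + g x * hess I f x w w + 2 * (d% f x w * d% g x w) := by
    obtain ⟨X, hX, rfl⟩ : ∃ Z : Π x : M, TangentSpace I x, MDiffAt (T% Z) x ∧ Z x = w :=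
      ⟨FiberBundle.extend E w, FiberBundle.mdifferentiableAt_extend I E w, by simp⟩
    have hev : (fun y ↦ d% (fun y ↦ f y * g y) y (X y)) =ᶠ[𝓝 x]
        fun y ↦ f y * d% g y (X y) + g y * d% f y (X y) := by
      filter_upwards [(contMDiffAt_iff_contMDiffAt_nhds (by simp)).1 hf,
        (contMDiffAt_iff_contMDiffAt_nhds (by simp)).1 hg] with y hy hy'
      rw [mvfderiv_fun_mul (hy.mdifferentiableAt two_ne_zero) (hy'.mdifferentiableAt two_ne_zero)]
      simp
    have h1 := hf.mdifferentiableAt_mvfderiv_apply hX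
    have h2 := hg.mdifferentiableAt_mvfderiv_apply hX
    rw [hess_eq_sub (f := fun y ↦ f y * g y) (hf.mul hg) hX, hess_eq_sub hf hX, hess_eq_sub hg hX,
      hev.mvfderiv_eq,
      mvfderiv_fun_add (g := fun y ↦ f y * d% g y (X y)) (g' := fun y ↦ g y * d% f y (X y))
        (hf1.mul h2) (hg1.mul h1), mvfderiv_fun_mul hf1 h2,
      mvfderiv_fun_mul hg1 h1, mvfderiv_fun_mul hf1 hg1]
    simp
    ring
  have hin : ∑ k, d% f x (b k) * d% g x (b k) = inner ℝ (grad I f x) (grad I g x) := by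
    rw [← b.sum_inner_mul_inner]
    simp only [inner_grad_left, inner_grad_right]
  rw [laplacian_eq_sum_hess _ _ b, laplacian_eq_sum_hess _ _ b, laplacian_eq_sum_hess _ _ b]
  simp only [hh, Finset.sum_add_distrib, ← hin, Finset.mul_sum]

lemma _root_.ContMDiffAt.inner_grad {f g : M → ℝ} {x : M} {k : ℕ∞}
    (hf : ContMDiffAt I 𝓘(ℝ, ℝ) (k + 1) f x) (hg : ContMDiffAt I 𝓘(ℝ, ℝ) (k + 1) g x) :
    ContMDiffAt I 𝓘(ℝ, ℝ) k (fun y ↦ inner ℝ (grad I f y) (grad I g y)) x :=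
  ContMDiffAt.inner_bundle (F := E) (E := fun x : M ↦ TangentSpace I x) (IB := I) (b := id)
    hf.grad hg.grad

/-- The Laplacian of a smooth function is smooth. The hypothesis provides functions whose gradients
form a frame. -/
lemma _root_.ContMDiffAt.laplacian [I.Boundaryless] {ι : Type*} [Fintype ι] {u : ι → M → ℝ}
    {f : M → ℝ} {x : M} (hf : ContMDiffAt I 𝓘(ℝ, ℝ) ∞ f x)
    (hu : ∀ i, ContMDiffAt I 𝓘(ℝ, ℝ) ∞ (u i) x)
    (hli : LinearIndependent ℝ (fun i ↦ grad I (u i) x))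
    (hcard : Fintype.card ι = Module.finrank ℝ E) :
    ContMDiffAt I 𝓘(ℝ, ℝ) ∞ (RiemGeom.laplacian I f) x := by
  classical
  let G : M → Matrix ι ι ℝ := fun y ↦ Matrix.gram ℝ (fun i ↦ grad I (u i) y)
  have hinn {f g : M → ℝ} (hf : ContMDiffAt I 𝓘(ℝ, ℝ) ∞ f x) (hg : ContMDiffAt I 𝓘(ℝ, ℝ) ∞ g x) :
    ContMDiffAt I 𝓘(ℝ, ℝ) ∞ (fun y ↦ inner ℝ (grad I f y) (grad I g y)) x :=
    ContMDiffAt.inner_grad (k := ⊤) hf hg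
  have hG (i j) : ContMDiffAt I 𝓘(ℝ, ℝ) ∞ (fun y ↦ G y i j) x := hinn (hu i) (hu j)
  have hdx : (G x).det ≠ 0 := (Matrix.posDef_gram_of_linearIndependent hli).det_pos.ne'
  have hdet : ∀ᶠ y in 𝓝 x, (G y).det ≠ 0 :=
    (ContMDiffAt.matrix_det hG).continuousAt.eventually_ne hdx
  have hdir {f g : M → ℝ} (hf : ContMDiffAt I 𝓘(ℝ, ℝ) ∞ f x) (hg : ContMDiffAt I 𝓘(ℝ, ℝ) ∞ g x) :
      ContMDiffAt I 𝓘(ℝ, ℝ) ∞ (fun y ↦ d% f y (grad I g y)) x :=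
    ContMDiffAt.mvfderiv_apply (k := ∞) hf (ContMDiffAt.grad (k := ⊤) hg)
  have h2 {f : M → ℝ} (hf : ContMDiffAt I 𝓘(ℝ, ℝ) ∞ f x) :
      ∀ᶠ y in 𝓝 x, ContMDiffAt I 𝓘(ℝ, ℝ) 2 f y :=
    (contMDiffAt_iff_contMDiffAt_nhds (by simp)).1 (hf.of_le two_le_infty)
  have key : ContMDiffAt I 𝓘(ℝ, ℝ) ∞ (fun y ↦ ∑ i, ∑ j, (G y)⁻¹ i j * ((1 / 2) *
      (d% (fun y ↦ inner ℝ (grad I f y) (grad I (u j) y)) y (grad I (u i) y) +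
        d% (fun y ↦ inner ℝ (grad I f y) (grad I (u i) y)) y (grad I (u j) y) -
        d% (fun y ↦ inner ℝ (grad I (u i) y) (grad I (u j) y)) y (grad I f y)))) x := by
    refine contMDiffAt_finsetSum fun i _ ↦ contMDiffAt_finsetSum fun j _ ↦
      (ContMDiffAt.matrix_inv hG hdx i j).mul (contMDiffAt_const.mul ?_)
    exact ((hdir (hinn hf (hu j)) (hu i)).add (hdir (hinn hf (hu i)) (hu j))).sub
      (hdir (hinn (hu i) (hu j)) hf)
  refine key.congr_of_eventuallyEq ?_
  filter_upwards [hdet, h2 hf, eventually_all.2 fun i ↦ h2 (hu i)] with y hy hfy huy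
  have hliy : LinearIndependent ℝ (fun i ↦ grad I (u i) y) :=
    Matrix.linearIndependent_of_det_gram_ne_zero hy
  let b : Module.Basis ι ℝ (TangentSpace I y) := basisOfLinearIndependentOfCardEqFinrank' _ hliy hcard
  have hb : (b : ι → TangentSpace I y) = fun i ↦ grad I (u i) y :=
    coe_basisOfLinearIndependentOfCardEqFinrank' _ _ _
  rw [laplacian_eq_trace, LinearMap.trace_eq_sum_gram_inv b, hb]
  refine Finset.sum_congr rfl fun i _ ↦ Finset.sum_congr rfl fun j _ ↦ ?_
  rw [← hess_grad_grad hfy (huy i) (huy j)]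
  rfl

end RiemGeom

end Laplacian

/-- A function which is smooth near a point agrees near this point with a smooth function. -/
lemma exists_contDiff_eventuallyEq {V : Type*} [NormedAddCommGroup V] [NormedSpace ℝ V]
    [FiniteDimensional ℝ V] {f : V → ℝ} {z₀ : V} (hf : ∀ᶠ z in 𝓝 z₀, ContDiffAt ℝ ∞ f z) :
    ∃ g : V → ℝ, ContDiff ℝ ∞ g ∧ g =ᶠ[𝓝 z₀] f := by
  obtain ⟨r, hr, hfr⟩ := Metric.eventually_nhds_iff_ball.1 hf
  let χ : ContDiffBump z₀ := ⟨r / 4, r / 2, by positivity, by linarith⟩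
  refine ⟨fun z ↦ χ z * f z, contDiff_iff_contDiffAt.2 fun z ↦ ?_, ?_⟩
  · by_cases hz : z ∈ Metric.ball z₀ r
    · exact χ.contDiff.contDiffAt.mul (hfr z hz)
    · have hz' : r / 2 < dist z z₀ := by
        rw [Metric.mem_ball, not_lt] at hz
        linarith
      have hev : (fun z ↦ χ z * f z) =ᶠ[𝓝 z] fun _ ↦ 0 := by
        filter_upwards [(continuous_id.dist continuous_const).continuousAt.eventually_const_lt hz']
          with w hw
        rw [χ.zero_of_le_dist (x := w) hw.le, zero_mul]
      exact contDiffAt_const.congr_of_eventuallyEq hev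
  · filter_upwards [χ.eventuallyEq_one] with z hz
    simp [hz]

section Coordinates

variable {E : Type*} [NormedAddCommGroup E] [NormedSpace ℝ E] [FiniteDimensional ℝ E]
  {H : Type*} [TopologicalSpace H] (I : ModelWithCorners ℝ E H)
  {M : Type*} [TopologicalSpace M] [ChartedSpace H M] [IsManifold I ∞ M]

namespace RiemGeom

/-- Local coordinates centred at a point, with values in `ℝ^ι`. -/
lemma exists_centred_coordinates [I.Boundaryless] (x : M) :
    ∃ (X : M → Fin (Module.finrank ℝ E) → ℝ) (ψ : (Fin (Module.finrank ℝ E) → ℝ) → M),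
      X x = 0 ∧ ψ 0 = x ∧
      (∀ᶠ q in 𝓝 x, ContMDiffAt I 𝓘(ℝ, Fin (Module.finrank ℝ E) → ℝ) ∞ X q ∧ ψ (X q) = q) ∧
      ∀ᶠ z in 𝓝 0, ContMDiffAt 𝓘(ℝ, Fin (Module.finrank ℝ E) → ℝ) I ∞ ψ z ∧ X (ψ z) = z := by
  let L : E ≃L[ℝ] (Fin (Module.finrank ℝ E) → ℝ) := (Module.finBasis ℝ E).equivFunL
  let e := extChartAt I x
  let X (q : M) : Fin (Module.finrank ℝ E) → ℝ := L (e q - e x)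
  let ψ (z : Fin (Module.finrank ℝ E) → ℝ) : M := e.symm (L.symm z + e x)
  have h0 : L.symm 0 + e x = e x := by rw [map_zero, zero_add]
  refine ⟨X, ψ, by simp [X], ?_, ?_, ?_⟩
  · change e.symm (L.symm 0 + e x) = x
    rw [h0]
    exact extChartAt_to_inv x
  · filter_upwards [extChartAt_source_mem_nhds (I := I) x] with q hq
    constructor
    · have h1 : ContMDiffAt I 𝓘(ℝ, E) ∞ e q := contMDiffAt_extChartAt' (by simpa using hq)
      have h2 : ContDiff ℝ ∞ (fun v : E ↦ L (v - e x)) :=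
        L.contDiff.comp (contDiff_id.sub contDiff_const)
      exact h2.contMDiff.contMDiffAt.comp q h1
    · change e.symm (L.symm (L (e q - e x)) + e x) = q
      rw [L.symm_apply_apply, sub_add_cancel]
      exact e.left_inv hq
  · have hc : Continuous fun z : Fin (Module.finrank ℝ E) → ℝ ↦ L.symm z + e x := by fun_prop
    have ht : e.target ∈ 𝓝 (L.symm 0 + e x) := by
      rw [h0]
      exact extChartAt_target_mem_nhds x
    filter_upwards [hc.continuousAt.eventually (eventually_mem_nhds_iff.2 ht)] with z hz
    constructor
    · have h1 : ContMDiffAt 𝓘(ℝ, E) I ∞ e.symm (L.symm z + e x) :=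
        (contMDiffOn_extChartAt_symm x).contMDiffAt hz
      have h2 : ContDiff ℝ ∞ (fun z ↦ L.symm z + e x) := L.symm.contDiff.add contDiff_const
      exact h1.comp z h2.contMDiff.contMDiffAt
    · change L (e (e.symm (L.symm z + e x)) - e x) = z
      rw [e.right_inv (mem_of_mem_nhds hz), add_sub_cancel_right, L.apply_symm_apply]

variable [RiemannianBundle (fun x : M ↦ TangentSpace I x)]
  [IsContMDiffRiemannianBundle I ∞ E (fun x : M ↦ TangentSpace I x)]
variable {I}

/-- The gradients of coordinate functions are linearly independent. -/
lemma linearIndependent_grad_of_rightInverse {ι : Type*} [Fintype ι] [DecidableEq ι]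
    {X : M → ι → ℝ} {ψ : (ι → ℝ) → M}
    {z : ι → ℝ} (hX : MDifferentiableAt I 𝓘(ℝ, ι → ℝ) X (ψ z))
    (hψ : MDifferentiableAt 𝓘(ℝ, ι → ℝ) I ψ z) (h : ∀ᶠ z' in 𝓝 z, X (ψ z') = z') :
    LinearIndependent ℝ (fun i ↦ grad I (fun q ↦ X q i) (ψ z)) := by
  have key (u : ι → ℝ) (i : ι) :
      d% (fun q ↦ X q i) (ψ z) (mfderiv 𝓘(ℝ, ι → ℝ) I ψ z u) = u i := by
    have hXi : MDifferentiableAt I 𝓘(ℝ, ℝ) (fun q ↦ X q i) (ψ z) :=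
      MDifferentiableAt.comp (ψ z)
        (differentiableAt_pi.1 differentiableAt_id i).mdifferentiableAt hX
    have hev : (fun q ↦ X q i) ∘ ψ =ᶠ[𝓝 z] fun z' ↦ z' i := h.mono fun z' hz' ↦ by
      simp [hz']
    have h1 := mfderiv_comp z hXi hψ
    rw [hev.mfderiv_eq, mfderiv_eq_fderiv] at h1
    have h2 : fderiv ℝ (fun z' : ι → ℝ ↦ z' i) z =
        ContinuousLinearMap.proj (R := ℝ) (φ := fun _ : ι ↦ ℝ) i :=
      (ContinuousLinearMap.proj (R := ℝ) (φ := fun _ : ι ↦ ℝ) i).fderiv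
    rw [h2] at h1
    exact (congrArg (fun A : (ι → ℝ) →L[ℝ] ℝ ↦ A u) h1).symm
  rw [Fintype.linearIndependent_iff]
  intro c hc i
  have := congrArg (fun v ↦ inner ℝ v (mfderiv 𝓘(ℝ, ι → ℝ) I ψ z (Pi.single i 1))) hc
  simpa [sum_inner, real_inner_smul_left, inner_grad_left, key, Pi.single_apply] using this

end RiemGeom

end Coordinates

section HarmonicJets

variable {E : Type*} [NormedAddCommGroup E] [NormedSpace ℝ E] [FiniteDimensional ℝ E]
  {H : Type*} [TopologicalSpace H] {I : ModelWithCorners ℝ E H}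
  {M : Type*} [TopologicalSpace M] [ChartedSpace H M] [IsManifold I ∞ M]
  [RiemannianBundle (fun x : M ↦ TangentSpace I x)]
  [IsContMDiffRiemannianBundle I ∞ E (fun x : M ↦ TangentSpace I x)]

namespace RiemGeom

/-- A 2-jet of vanishing Laplacian, expressed in coordinates `X`, is approximated by 2-jets of
harmonic functions. -/
lemma exists_isHarmonicOn_jet_approx [I.Boundaryless] {x : M} {k : ℕ} [Nonempty (Fin k)]
    (hk : k = Module.finrank ℝ E)
    {X : M → Fin k → ℝ} {ψ : (Fin k → ℝ) → M} (hX0 : X x = 0) (hψ0 : ψ 0 = x)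
    (hX : ∀ᶠ q in 𝓝 x, ContMDiffAt I 𝓘(ℝ, Fin k → ℝ) ∞ X q ∧ ψ (X q) = q)
    (hψ : ∀ᶠ z in 𝓝 0, ContMDiffAt 𝓘(ℝ, Fin k → ℝ) I ∞ ψ z ∧ X (ψ z) = z)
    (C : (Fin k → ℝ) →L[ℝ] (Fin k → ℝ) →L[ℝ] ℝ) (hC : ∀ u v, C u v = C v u)
    (ℓ : (Fin k → ℝ) →L[ℝ] ℝ)
    (h0 : ∑ i, ∑ j, C (Pi.single i 1) (Pi.single j 1) *
        inner ℝ (grad I (fun q ↦ X q i) x) (grad I (fun q ↦ X q j) x) +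
      ∑ i, ℓ (Pi.single i 1) * laplacian I (fun q ↦ X q i) x = 0) {δ : ℝ} (hδ : 0 < δ) :
    ∃ F : (Fin k → ℝ) → ℝ, ContDiff ℝ 2 F ∧
      (∀ i j, |fderiv ℝ (fderiv ℝ F) 0 (Pi.single i 1) (Pi.single j 1) -
        C (Pi.single i 1) (Pi.single j 1)| ≤ δ) ∧
      (∀ i, |fderiv ℝ F 0 (Pi.single i 1) - ℓ (Pi.single i 1)| ≤ δ) ∧
      ∃ U : Set M, IsOpen U ∧ x ∈ U ∧ IsHarmonicOn I (fun q ↦ F (X q)) U := by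
  have hXi {q : M} (h : ContMDiffAt I 𝓘(ℝ, Fin k → ℝ) ∞ X q) (i) :
      ContMDiffAt I 𝓘(ℝ, ℝ) ∞ (fun q ↦ X q i) q :=
    (contDiff_apply ℝ ℝ i).contDiffAt.contMDiffAt.comp q h
  have hψx : ContinuousAt ψ 0 := hψ.self_of_nhds.1.continuousAt
  have hXx : ContinuousAt X x := hX.self_of_nhds.1.continuousAt
  have hX' : ∀ᶠ z in 𝓝 0, ContMDiffAt I 𝓘(ℝ, Fin k → ℝ) ∞ X (ψ z) := by
    have : Tendsto ψ (𝓝 0) (𝓝 x) := by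
      rw [← hψ0]
      exact hψx
    exact this.eventually (hX.mono fun q hq ↦ hq.1)
  have hind : ∀ᶠ z in 𝓝 0, LinearIndependent ℝ (fun i ↦ grad I (fun q ↦ X q i) (ψ z)) := by
    filter_upwards [hX', hψ, hψ.eventually_nhds] with z h1 h2 h3
    exact linearIndependent_grad_of_rightInverse (h1.mdifferentiableAt (by simp))
      (h2.1.mdifferentiableAt (by simp)) (h3.mono fun z' hz' ↦ hz'.2)
  have ha (i j) : ∀ᶠ z in 𝓝 0, ContDiffAt ℝ ∞ (fun z ↦
      inner ℝ (grad I (fun q ↦ X q i) (ψ z)) (grad I (fun q ↦ X q j) (ψ z))) z := by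
    filter_upwards [hX', hψ] with z h1 h2
    have h3 := ContMDiffAt.inner_grad (k := ⊤) (hXi h1 i) (hXi h1 j)
    exact (h3.comp z h2.1).contDiffAt
  have hb (i) : ∀ᶠ z in 𝓝 0, ContDiffAt ℝ ∞ (fun z ↦ laplacian I (fun q ↦ X q i) (ψ z)) z := by
    filter_upwards [hX', hψ, hind] with z h1 h2 h3
    have h4 := ContMDiffAt.laplacian (hXi h1 i) (hXi h1) h3 (by simpa using hk)
    exact (h4.comp z h2.1).contDiffAt
  choose a has hae using fun i j ↦ exists_contDiff_eventuallyEq (ha i j)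
  choose b hbs hbe using fun i ↦ exists_contDiff_eventuallyEq (hb i)
  have ha0 (i j) : a i j 0 =
      inner ℝ (grad I (fun q ↦ X q i) x) (grad I (fun q ↦ X q j) x) := by
    rw [(hae i j).eq_of_nhds, hψ0]
  have hb0 (i) : b i 0 = laplacian I (fun q ↦ X q i) x := by
    rw [(hbe i).eq_of_nhds, hψ0]
  obtain ⟨c, hc, hell⟩ : ∃ c : ℝ, 0 < c ∧
      ∀ ξ : Fin k → ℝ, c * ‖ξ‖ ^ 2 ≤ ∑ i, ∑ j, a i j 0 * (ξ i * ξ j) := by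
    have hi := hind.self_of_nhds
    rw [hψ0] at hi
    let L : (Fin k → ℝ) →ₗ[ℝ] TangentSpace I x :=
      Fintype.linearCombination ℝ (fun i ↦ grad I (fun q ↦ X q i) x)
    have hL : LinearMap.ker L = ⊥ := by
      rw [LinearMap.ker_eq_bot']
      intro ξ hξ
      exact funext (Fintype.linearIndependent_iff.1 hi ξ (by simpa [L, Fintype.linearCombination_apply] using hξ))
    obtain ⟨K, hK, hKL⟩ := L.exists_antilipschitzWith hL
    have hK' : (0 : ℝ) < K := hK
    refine ⟨1 / (K : ℝ) ^ 2, by positivity, fun ξ ↦ ?_⟩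
    have h1 : ∑ i, ∑ j, a i j 0 * (ξ i * ξ j) = ‖L ξ‖ ^ 2 := by
      rw [← real_inner_self_eq_norm_sq]
      simp only [L, Fintype.linearCombination_apply, sum_inner, inner_sum, real_inner_smul_left,
        real_inner_smul_right, ha0]
      exact Finset.sum_congr rfl fun i _ ↦ Finset.sum_congr rfl fun j _ ↦ by
        rw [real_inner_comm]
        ring
    have h2 : ‖ξ‖ ≤ K * ‖L ξ‖ := by
      simpa [dist_zero_right] using hKL.le_mul_dist ξ 0
    rw [h1, one_div_mul_eq_div, div_le_iff₀ (by positivity), ← mul_pow, mul_comm]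
    gcongr
  obtain ⟨F, hF, hF2, hF1, hsol⟩ := exists_local_solution_jet_approx has hbs hc hell C hC ℓ (by
    rw [← h0]
    refine congrArg₂ (· + ·) (Finset.sum_congr rfl fun i _ ↦ Finset.sum_congr rfl fun j _ ↦ ?_)
      (Finset.sum_congr rfl fun i _ ↦ ?_)
    exacts [by rw [ha0, mul_comm], by rw [hb0, mul_comm]]) hδ
  refine ⟨F, hF, hF2, hF1, ?_⟩
  have hXt : Tendsto X (𝓝 x) (𝓝 0) := by
    rw [← hX0]
    exact hXx
  have hev : ∀ᶠ q in 𝓝 x, ContMDiffAt I 𝓘(ℝ, ℝ) 2 (fun q ↦ F (X q)) q ∧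
      laplacian I (fun q ↦ F (X q)) q = 0 := by
    filter_upwards [hX, hXt.eventually hsol, hXt.eventually (eventually_all.2 hbe),
      hXt.eventually (eventually_all.2 fun i ↦ eventually_all.2 (hae i))] with q h1 h2 h3 h4
    have h5 : ContMDiffAt I 𝓘(ℝ, Fin k → ℝ) 2 X q := h1.1.of_le two_le_infty
    refine ⟨hF.contMDiff.contMDiffAt.comp q h5, ?_⟩
    rw [laplacian_comp hF.contDiffAt h5, ← h2]
    refine congrArg₂ (· + ·) (Finset.sum_congr rfl fun i _ ↦ Finset.sum_congr rfl fun j _ ↦ ?_)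
      (Finset.sum_congr rfl fun i _ ↦ ?_)
    exacts [by rw [h4, h1.2, mul_comm], by rw [h3, h1.2, mul_comm]]
  obtain ⟨U, hU, hUo, hxU⟩ := eventually_nhds_iff.1 hev
  exact ⟨U, hUo, hxU, fun q hq ↦ (hU q hq).1.contMDiffWithinAt, fun q hq ↦ (hU q hq).2⟩

end RiemGeom

end HarmonicJets

section HarmonicMorphism

variable {E : Type*} [NormedAddCommGroup E] [NormedSpace ℝ E] [FiniteDimensional ℝ E]
  {H : Type*} [TopologicalSpace H] {I : ModelWithCorners ℝ E H}
  {M : Type*} [TopologicalSpace M] [ChartedSpace H M] [IsManifold I ∞ M]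
  [RiemannianBundle (fun x : M ↦ TangentSpace I x)]
  [IsContMDiffRiemannianBundle I ∞ E (fun x : M ↦ TangentSpace I x)]
  {E' : Type*} [NormedAddCommGroup E'] [NormedSpace ℝ E'] [FiniteDimensional ℝ E']
  {H' : Type*} [TopologicalSpace H'] {J : ModelWithCorners ℝ E' H'}
  {N : Type*} [TopologicalSpace N] [ChartedSpace H' N] [IsManifold J ∞ N]
  [RiemannianBundle (fun y : N ↦ TangentSpace J y)]
  [IsContMDiffRiemannianBundle J ∞ E' (fun y : N ↦ TangentSpace J y)]

namespace RiemGeom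

/-- A harmonic morphism commutes with the Laplacian up to a factor. -/
lemma IsHarmonicMorphism.exists_laplacian_comp_eq [J.Boundaryless] {φ : M → N}
    (hφ : IsHarmonicMorphism I J φ) (x : M) :
    ∃ μ : ℝ, ∀ f : N → ℝ, ContMDiffAt J 𝓘(ℝ, ℝ) 2 f (φ x) →
      laplacian I (f ∘ φ) x = μ * laplacian J f (φ x) := by
  obtain ⟨X, ψ, hX0, hψ0, hX, hψ⟩ := exists_centred_coordinates J (φ x)
  let ι := Fin (Module.finrank ℝ E')
  let e (i : ι) : ι → ℝ := Pi.single i 1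
  let Z (q : M) : ι → ℝ := X (φ q)
  have hX2 : ContMDiffAt J 𝓘(ℝ, ι → ℝ) 2 X (φ x) := hX.self_of_nhds.1.of_le two_le_infty
  have hφx : ContMDiffAt I J 2 φ x := hφ.smooth.contMDiffAt.of_le two_le_infty
  have hZ : ContMDiffAt I 𝓘(ℝ, ι → ℝ) 2 Z x := hX2.comp x hφx
  let P (α : ι → ι → ℝ) (β : ι → ℝ) (C : (ι → ℝ) →L[ℝ] (ι → ℝ) →L[ℝ] ℝ) (ℓ : (ι → ℝ) →L[ℝ] ℝ) : ℝ :=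
    ∑ i, ∑ j, C (e i) (e j) * α i j + ∑ i, ℓ (e i) * β i
  let a (i j : ι) : ℝ := inner ℝ (grad J (fun q ↦ X q i) (φ x)) (grad J (fun q ↦ X q j) (φ x))
  let b (i : ι) : ℝ := laplacian J (fun q ↦ X q i) (φ x)
  let a' (i j : ι) : ℝ := inner ℝ (grad I (fun q ↦ Z q i) x) (grad I (fun q ↦ Z q j) x)
  let b' (i : ι) : ℝ := laplacian I (fun q ↦ Z q i) x
  have hN {F : (ι → ℝ) → ℝ} (hF : ContDiffAt ℝ 2 F 0) :
      laplacian J (fun q ↦ F (X q)) (φ x) = P a b (fderiv ℝ (fderiv ℝ F) 0) (fderiv ℝ F 0) := by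
    rw [laplacian_comp (by rwa [hX0]) hX2, hX0]
  have hM {F : (ι → ℝ) → ℝ} (hF : ContDiffAt ℝ 2 F 0) :
      laplacian I (fun q ↦ F (Z q)) x = P a' b' (fderiv ℝ (fderiv ℝ F) 0) (fderiv ℝ F 0) := by
    have hZ0 : Z x = 0 := hX0
    rw [laplacian_comp (by rwa [hZ0]) hZ, hZ0]
  obtain ⟨μ, hμ⟩ : ∃ μ : ℝ, ∀ C ℓ, (∀ u v, C u v = C v u) → P a' b' C ℓ = μ * P a b C ℓ := by
    rcases isEmpty_or_nonempty ι with hι | hι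
    · exact ⟨0, fun C ℓ _ ↦ by simp [P]⟩
    have key (C ℓ) (hC : ∀ u v, C u v = C v u) (h0 : P a b C ℓ = 0) : P a' b' C ℓ = 0 := by
      let K : ℝ := ∑ i, ∑ j, |a' i j| + ∑ i, |b' i|
      have hK : 0 ≤ K := by positivity
      have hle (δ : ℝ) (hδ : 0 < δ) : |P a' b' C ℓ| ≤ δ * K := by
        obtain ⟨F, hF, hF2, hF1, U, hU, hxU, hharm⟩ :=
          exists_isHarmonicOn_jet_approx rfl hX0 hψ0 hX hψ C hC ℓ h0 hδ
        have h1 : P a' b' (fderiv ℝ (fderiv ℝ F) 0) (fderiv ℝ F 0) = 0 := by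
          rw [← hM hF.contDiffAt]
          exact (hφ.comp U _ hU hharm).2 x hxU
        have h2 : P a' b' C ℓ = -∑ i, ∑ j,
            (fderiv ℝ (fderiv ℝ F) 0 (e i) (e j) - C (e i) (e j)) * a' i j -
            ∑ i, (fderiv ℝ F 0 (e i) - ℓ (e i)) * b' i := by
          simp only [sub_mul, Finset.sum_sub_distrib]
          simp only [P] at h1 ⊢
          linarith
        have h3 : |∑ i, ∑ j, (fderiv ℝ (fderiv ℝ F) 0 (e i) (e j) - C (e i) (e j)) * a' i j| ≤
            δ * ∑ i, ∑ j, |a' i j| := by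
          rw [Finset.mul_sum]
          refine (Finset.abs_sum_le_sum_abs _ _).trans (Finset.sum_le_sum fun i _ ↦ ?_)
          rw [Finset.mul_sum]
          refine (Finset.abs_sum_le_sum_abs _ _).trans (Finset.sum_le_sum fun j _ ↦ ?_)
          rw [abs_mul]
          exact mul_le_mul_of_nonneg_right (hF2 i j) (abs_nonneg _)
        have h4 : |∑ i, (fderiv ℝ F 0 (e i) - ℓ (e i)) * b' i| ≤ δ * ∑ i, |b' i| := by
          rw [Finset.mul_sum]
          refine (Finset.abs_sum_le_sum_abs _ _).trans (Finset.sum_le_sum fun j _ ↦ ?_)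
          rw [abs_mul]
          exact mul_le_mul_of_nonneg_right (hF1 j) (abs_nonneg _)
        rw [h2, mul_add]
        refine (abs_sub _ _).trans (add_le_add ?_ h4)
        rwa [abs_neg]
      by_contra hne
      have hpos : 0 < |P a' b' C ℓ| := abs_pos.2 hne
      have := hle (|P a' b' C ℓ| / (K + 1)) (by positivity)
      rw [div_mul_eq_mul_div, le_div_iff₀ (by positivity)] at this
      nlinarith
    obtain ⟨i₀⟩ := hι
    let p : (ι → ℝ) →L[ℝ] ℝ := ContinuousLinearMap.proj (R := ℝ) (φ := fun _ : ι ↦ ℝ) i₀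
    let C₀ : (ι → ℝ) →L[ℝ] (ι → ℝ) →L[ℝ] ℝ := p.smulRight p
    have hC₀ (u v) : C₀ u v = u i₀ * v i₀ := rfl
    have hP₀ (α β C ℓ) (t : ℝ) : P α β (C - t • C₀) ℓ = P α β C ℓ - t * α i₀ i₀ := by
      have hsum : ∑ i, ∑ j, t * (C₀ (e i) (e j)) * α i j = t * α i₀ i₀ := by
        rw [Finset.sum_eq_single i₀ (fun i _ hi ↦ ?_) (by simp),
          Finset.sum_eq_single i₀ (fun j _ hj ↦ ?_) (by simp)]
        · simp [hC₀, e]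
        · simp [hC₀, e, hj.symm]
        · simp [hC₀, e, hi.symm]
      simp only [P, sub_apply, smul_apply, smul_eq_mul, sub_mul, Finset.sum_sub_distrib, hsum]
      ring
    have ha₀ : a i₀ i₀ ≠ 0 := by
      have hψx : MDifferentiableAt J 𝓘(ℝ, ι → ℝ) X (ψ 0) := by
        rw [hψ0]
        exact hX2.mdifferentiableAt two_ne_zero
      have := linearIndependent_grad_of_rightInverse hψx
        (hψ.self_of_nhds.1.mdifferentiableAt (by simp)) (hψ.mono fun z hz ↦ hz.2)
      rw [hψ0] at this
      exact fun h ↦ this.ne_zero i₀ (inner_self_eq_zero.1 h)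
    refine ⟨a' i₀ i₀ / a i₀ i₀, fun C ℓ hC ↦ ?_⟩
    have := key (C - (P a b C ℓ / a i₀ i₀) • C₀) ℓ (fun u v ↦ by
      simp only [sub_apply, smul_apply, hC u v, hC₀, mul_comm]) (by
      rw [hP₀, div_mul_cancel₀ _ ha₀, sub_self])
    rw [hP₀, sub_eq_zero] at this
    rw [this]
    ring
  refine ⟨μ, fun f hf ↦ ?_⟩
  let F (z : ι → ℝ) : ℝ := f (ψ z)
  have hψ2 : ContMDiffAt 𝓘(ℝ, ι → ℝ) J 2 ψ 0 := hψ.self_of_nhds.1.of_le two_le_infty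
  have hF : ContDiffAt ℝ 2 F 0 := by
    have h1 : ContMDiffAt J 𝓘(ℝ, ℝ) 2 f (ψ 0) := by rwa [hψ0]
    exact (h1.comp 0 hψ2).contDiffAt
  have hfF : f =ᶠ[𝓝 (φ x)] fun q ↦ F (X q) := hX.mono fun q hq ↦ by simp only [F, hq.2]
  have hfφ : f ∘ φ =ᶠ[𝓝 x] fun q ↦ F (Z q) := hφx.continuousAt.eventually hfF
  rw [hfF.laplacian_eq hf, hfφ.laplacian_eq (hf.comp x hφx), hN hF, hM hF]
  refine hμ _ _ fun u v ↦ ?_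
  exact (hF.isSymmSndFDerivAt (by simp)).eq u v

lemma mfderiv_mvfderiv_of_leftInverse {V : Type*} [NormedAddCommGroup V] [NormedSpace ℝ V] {x : M}
    {X : M → V} {ψ : V → M} (hX : MDifferentiableAt I 𝓘(ℝ, V) X x)
    (hψ : MDifferentiableAt 𝓘(ℝ, V) I ψ (X x)) (h : ∀ᶠ q in 𝓝 x, ψ (X q) = q)
    (v : TangentSpace I x) :
    (mfderiv 𝓘(ℝ, V) I ψ (X x) : V →L[ℝ] E) (mvfderiv I X x v) = v := by
  have hid : ψ ∘ X =ᶠ[𝓝 x] id := h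
  have h2 := mfderiv_comp x hψ hX
  rw [hid.mfderiv_eq, mfderiv_id] at h2
  exact (congrArg (fun B : E →L[ℝ] E ↦ B v) h2).symm

/-- Every tangent vector is the gradient of a function which is smooth near the point. -/
lemma exists_grad_eq [I.Boundaryless] {x : M} (w : TangentSpace I x) :
    ∃ f : M → ℝ, (∀ᶠ q in 𝓝 x, ContMDiffAt I 𝓘(ℝ, ℝ) ∞ f q) ∧ grad I f x = w := by
  obtain ⟨X, ψ, hX0, rfl, hX, hψ⟩ := exists_centred_coordinates I x
  let A : (Fin (Module.finrank ℝ E) → ℝ) →L[ℝ] TangentSpace I (ψ 0) :=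
    mfderiv 𝓘(ℝ, Fin (Module.finrank ℝ E) → ℝ) I ψ 0
  let ℓ : (Fin (Module.finrank ℝ E) → ℝ) →L[ℝ] ℝ := (innerSL ℝ w).comp A
  have hXx := hX.self_of_nhds.1
  have hψ0 := hψ.self_of_nhds.1
  refine ⟨fun q ↦ ℓ (X q), hX.mono fun q hq ↦ ℓ.contDiff.contMDiff.contMDiffAt.comp q hq.1, ?_⟩
  refine ext_inner_right ℝ fun v ↦ ?_
  rw [inner_grad_left, mvfderiv_comp_vectorSpace (G := ℓ) ℓ.differentiableAt
    (hXx.mdifferentiableAt (by simp)), ℓ.fderiv]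
  have h1 : MDifferentiableAt 𝓘(ℝ, Fin (Module.finrank ℝ E) → ℝ) I ψ (X (ψ 0)) := by
    rw [hX0]
    exact hψ0.mdifferentiableAt (by simp)
  have h3 := mfderiv_mvfderiv_of_leftInverse (hXx.mdifferentiableAt (by simp)) h1
    (hX.mono fun q hq ↦ hq.2) v
  rw [hX0] at h3
  change inner ℝ w (A (mvfderiv I X (ψ 0) v)) = inner ℝ w v
  exact congrArg (inner ℝ w) h3

lemma mvfderiv_comp_map {φ : M → N} {x : M} {f : N → ℝ}
    (hf : MDifferentiableAt J 𝓘(ℝ, ℝ) f (φ x)) (hφ : MDifferentiableAt I J φ x)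
    (v : TangentSpace I x) : d% (f ∘ φ) x v = d% f (φ x) (mfderiv I J φ x v) :=
  congrArg (fun A : E →L[ℝ] ℝ ↦ A v) (mfderiv_comp x hf hφ)

lemma grad_comp {φ : M → N} {x : M} {f : N → ℝ}
    (hf : MDifferentiableAt J 𝓘(ℝ, ℝ) f (φ x)) (hφ : MDifferentiableAt I J φ x) :
    grad I (f ∘ φ) x = LinearMap.adjoint (mfderiv I J φ x).toLinearMap (grad J f (φ x)) := by
  refine ext_inner_right ℝ fun v ↦ ?_
  rw [LinearMap.adjoint_inner_left, inner_grad_left, mvfderiv_comp_map hf hφ]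
  exact (inner_grad_left f (φ x) _).symm

/-- A harmonic morphism is horizontally conformal. -/
lemma IsHarmonicMorphism.inner_grad_comp_eq_mul [J.Boundaryless] {φ : M → N}
    (hφ : IsHarmonicMorphism I J φ) {x : M} {μ : ℝ}
    (hμ : ∀ f : N → ℝ, ContMDiffAt J 𝓘(ℝ, ℝ) 2 f (φ x) →
      laplacian I (f ∘ φ) x = μ * laplacian J f (φ x)) {f g : N → ℝ}
    (hf : ContMDiffAt J 𝓘(ℝ, ℝ) 2 f (φ x)) (hg : ContMDiffAt J 𝓘(ℝ, ℝ) 2 g (φ x)) :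
    inner ℝ (grad I (f ∘ φ) x) (grad I (g ∘ φ) x) =
      μ * inner ℝ (grad J f (φ x)) (grad J g (φ x)) := by
  have hφx : ContMDiffAt I J 2 φ x := hφ.smooth.contMDiffAt.of_le two_le_infty
  have h1 := laplacian_mul (hf.comp x hφx) (hg.comp x hφx)
  have h2 := hμ (fun y ↦ f y * g y) (hf.mul hg)
  rw [laplacian_mul hf hg] at h2
  have h3 : laplacian I ((fun y ↦ f y * g y) ∘ φ) x =
      laplacian I (fun y ↦ (f ∘ φ) y * (g ∘ φ) y) x := rfl
  rw [h3, h1, hμ f hf, hμ g hg] at h2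
  simp only [Function.comp_apply] at h2
  linarith

lemma normSqDifferential_eq_of_inner_grad_comp [J.Boundaryless] {φ : M → N} {x : M} {μ : ℝ}
    (hφ : MDifferentiableAt I J φ x) (h : ∀ f g : N → ℝ, ContMDiffAt J 𝓘(ℝ, ℝ) 2 f (φ x) →
      ContMDiffAt J 𝓘(ℝ, ℝ) 2 g (φ x) → inner ℝ (grad I (f ∘ φ) x) (grad I (g ∘ φ) x) =
      μ * inner ℝ (grad J f (φ x)) (grad J g (φ x))) :
    normSqDifferential I J φ x = Module.finrank ℝ E' * μ := by
  let A : TangentSpace I x →ₗ[ℝ] TangentSpace J (φ x) := (mfderiv I J φ x).toLinearMap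
  have hA : A ∘ₗ LinearMap.adjoint A = μ • LinearMap.id := by
    refine LinearMap.ext fun w ↦ ext_inner_right ℝ fun w' ↦ ?_
    obtain ⟨f, hf, rfl⟩ := exists_grad_eq w
    obtain ⟨g, hg, rfl⟩ := exists_grad_eq w'
    have hf2 := hf.self_of_nhds.of_le two_le_infty
    have hg2 := hg.self_of_nhds.of_le two_le_infty
    have := h f g hf2 hg2
    rw [grad_comp (hf2.mdifferentiableAt two_ne_zero) hφ,
      grad_comp (hg2.mdifferentiableAt two_ne_zero) hφ, LinearMap.adjoint_inner_right] at this
    rw [LinearMap.smul_apply, LinearMap.id_apply, real_inner_smul_left]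
    exact this
  change LinearMap.trace ℝ (TangentSpace I x) (LinearMap.adjoint A ∘ₗ A) = _
  rw [LinearMap.trace_comp_comm', hA, map_smul, LinearMap.trace_id, smul_eq_mul, mul_comm]
  rfl

lemma IsHarmonicMorphism.inner_grad_comp [J.Boundaryless] (hn : Module.finrank ℝ E' ≠ 0)
    {φ : M → N} (hφ : IsHarmonicMorphism I J φ) (x : M) {f g : N → ℝ}
    (hf : ContMDiffAt J 𝓘(ℝ, ℝ) 2 f (φ x)) (hg : ContMDiffAt J 𝓘(ℝ, ℝ) 2 g (φ x)) :
    inner ℝ (grad I (f ∘ φ) x) (grad I (g ∘ φ) x) =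
      normSqDifferential I J φ x / Module.finrank ℝ E' *
        inner ℝ (grad J f (φ x)) (grad J g (φ x)) := by
  obtain ⟨μ, hμ⟩ := hφ.exists_laplacian_comp_eq x
  have h := fun f g ↦ hφ.inner_grad_comp_eq_mul (f := f) (g := g) hμ
  rw [normSqDifferential_eq_of_inner_grad_comp (hφ.smooth.contMDiffAt.mdifferentiableAt (by simp)) h,
    mul_div_cancel_left₀ _ (by exact_mod_cast hn), h _ _ hf hg]

lemma IsHarmonicMorphism.laplacian_comp [J.Boundaryless] (hn : Module.finrank ℝ E' ≠ 0)
    {φ : M → N} (hφ : IsHarmonicMorphism I J φ) (x : M) {f : N → ℝ}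
    (hf : ContMDiffAt J 𝓘(ℝ, ℝ) 2 f (φ x)) :
    laplacian I (f ∘ φ) x =
      normSqDifferential I J φ x / Module.finrank ℝ E' * laplacian J f (φ x) := by
  obtain ⟨μ, hμ⟩ := hφ.exists_laplacian_comp_eq x
  have h := fun f g ↦ hφ.inner_grad_comp_eq_mul (f := f) (g := g) hμ
  rw [normSqDifferential_eq_of_inner_grad_comp (hφ.smooth.contMDiffAt.mdifferentiableAt (by simp)) h,
    mul_div_cancel_left₀ _ (by exact_mod_cast hn), hμ _ hf]

lemma IsHarmonicMorphism.normSqDifferential_pos [J.Boundaryless] (hn : Module.finrank ℝ E' ≠ 0)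
    {φ : M → N} (hφ : IsHarmonicMorphism I J φ) {x : M}
    (hs : Function.Surjective (mfderiv I J φ x)) : 0 < normSqDifferential I J φ x := by
  have : Nontrivial E' := Module.finrank_pos_iff.1 (Nat.pos_of_ne_zero hn)
  obtain ⟨w, hw⟩ : ∃ w : TangentSpace J (φ x), w ≠ 0 := exists_ne (α := E') 0
  obtain ⟨f, hf, rfl⟩ := exists_grad_eq w
  have hf2 := hf.self_of_nhds.of_le two_le_infty
  have h1 := hφ.inner_grad_comp hn x hf2 hf2
  have hn' : (0 : ℝ) < Module.finrank ℝ E' := by exact_mod_cast Nat.pos_of_ne_zero hn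
  have h2 : grad I (f ∘ φ) x ≠ 0 := by
    obtain ⟨v, hv⟩ := hs (grad J f (φ x))
    intro h0
    have h3 := inner_grad_left (I := I) (f ∘ φ) x v
    rw [h0, inner_zero_left, mvfderiv_comp_map (hf2.mdifferentiableAt two_ne_zero)
      (hφ.smooth.contMDiffAt.mdifferentiableAt (by simp)), hv, ← inner_grad_left] at h3
    exact hw (inner_self_eq_zero.1 h3.symm)
  have h4 : 0 < inner ℝ (grad I (f ∘ φ) x) (grad I (f ∘ φ) x) := real_inner_self_pos.2 h2
  have h5 : 0 < inner ℝ (grad J f (φ x)) (grad J f (φ x)) := real_inner_self_pos.2 hw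
  rw [h1] at h4
  have := (pos_iff_pos_of_mul_pos h4).2 h5
  exact (div_pos_iff_of_pos_right hn').1 this

lemma IsHarmonicMorphism.mdifferentiableAt_normSqDifferential [J.Boundaryless]
    (hn : Module.finrank ℝ E' ≠ 0) {φ : M → N} (hφ : IsHarmonicMorphism I J φ) (x : M) :
    MDiffAt (normSqDifferential I J φ) x := by
  have : Nontrivial E' := Module.finrank_pos_iff.1 (Nat.pos_of_ne_zero hn)
  obtain ⟨w, hw⟩ : ∃ w : TangentSpace J (φ x), w ≠ 0 := exists_ne (α := E') 0
  obtain ⟨f, hf, rfl⟩ := exists_grad_eq w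
  have hn' : (Module.finrank ℝ E' : ℝ) ≠ 0 := by exact_mod_cast hn
  have hφx : ContMDiffAt I J ∞ φ x := hφ.smooth.contMDiffAt
  have hfx := hf.self_of_nhds
  let p (q : M) : ℝ := inner ℝ (grad I (f ∘ φ) q) (grad I (f ∘ φ) q)
  let r (y : N) : ℝ := inner ℝ (grad J f y) (grad J f y)
  have hp : ContMDiffAt I 𝓘(ℝ, ℝ) ∞ p x :=
    ContMDiffAt.inner_grad (k := ⊤) (hfx.comp x hφx) (hfx.comp x hφx)
  have hr : ContMDiffAt J 𝓘(ℝ, ℝ) ∞ r (φ x) := ContMDiffAt.inner_grad (k := ⊤) hfx hfx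
  have hr0 : r (φ x) ≠ 0 := fun h ↦ hw (inner_self_eq_zero.1 h)
  have hrφ : ContMDiffAt I 𝓘(ℝ, ℝ) ∞ (r ∘ φ) x := hr.comp x hφx
  have hev : normSqDifferential I J φ =ᶠ[𝓝 x]
      fun q ↦ (Module.finrank ℝ E' : ℝ) * (p q * ((r ∘ φ) q)⁻¹) := by
    filter_upwards [hφx.continuousAt.eventually hf, hrφ.continuousAt.eventually_ne hr0] with q h1 h2
    have h3 : p q = _ * (r ∘ φ) q :=
      hφ.inner_grad_comp hn q (h1.of_le two_le_infty) (h1.of_le two_le_infty)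
    rw [h3]
    field_simp
  have hinv : ContMDiffAt I 𝓘(ℝ, ℝ) ∞ (fun q ↦ ((r ∘ φ) q)⁻¹) x :=
    (contDiffAt_inv ℝ hr0).contMDiffAt.comp x hrφ
  have : ContMDiffAt I 𝓘(ℝ, ℝ) ∞ (normSqDifferential I J φ) x :=
    ((contMDiffAt_const.mul (hp.mul hinv))).congr_of_eventuallyEq hev
  exact this.mdifferentiableAt (by simp)

end RiemGeom

end HarmonicMorphism

section Submanifold

variable {E : Type*} [NormedAddCommGroup E] [NormedSpace ℝ E] [FiniteDimensional ℝ E]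
  {H : Type*} [TopologicalSpace H] {I : ModelWithCorners ℝ E H}
  {M : Type*} [TopologicalSpace M] [ChartedSpace H M] [IsManifold I ∞ M]
  [RiemannianBundle (fun x : M ↦ TangentSpace I x)]
  [IsContMDiffRiemannianBundle I ∞ E (fun x : M ↦ TangentSpace I x)]

namespace RiemGeom

variable (I) in
/-- `F` is a submersion on the open set `U` whose zero set is `B ∩ U`. -/
structure IsDefiningMap {p : ℕ} (B U : Set M) (F : M → EuclideanSpace ℝ (Fin p)) : Prop where
  isOpen : IsOpen U
  contMDiffOn : ContMDiffOn I 𝓘(ℝ, EuclideanSpace ℝ (Fin p)) ∞ F U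
  surjective : ∀ y ∈ U, Function.Surjective (d% F y)
  inter_eq : B ∩ U = {y ∈ U | F y = 0}

variable (I) in
/-- `f` is smooth near `x` and vanishes on `B` near `x`. -/
structure IsVanishingGerm (B : Set M) (x : M) (f : M → ℝ) : Prop where
  smooth : ∀ᶠ y in 𝓝 x, ContMDiffAt I 𝓘(ℝ, ℝ) ∞ f y
  vanishes : ∀ᶠ y in 𝓝[B] x, f y = 0

lemma isSubmanifold_iff {p : ℕ} {B : Set M} : IsSubmanifold I p B ↔
    ∀ x ∈ B, ∃ (U : Set M) (F : M → EuclideanSpace ℝ (Fin p)), x ∈ U ∧ IsDefiningMap I B U F :=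
  forall₂_congr fun _ _ ↦ exists₂_congr fun _ _ ↦
    ⟨fun ⟨h1, h2, h3, h4, h5⟩ ↦ ⟨h2, h1, h3, h4, h5⟩,
      fun ⟨h2, h1, h3, h4, h5⟩ ↦ ⟨h1, h2, h3, h4, h5⟩⟩

namespace IsDefiningMap

variable {p : ℕ} {B U : Set M} {F : M → EuclideanSpace ℝ (Fin p)} {x : M}

lemma contMDiffAt (h : IsDefiningMap I B U F) (hx : x ∈ U) :
    ContMDiffAt I 𝓘(ℝ, EuclideanSpace ℝ (Fin p)) ∞ F x :=
  h.contMDiffOn.contMDiffAt (h.isOpen.mem_nhds hx)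

lemma contMDiffAt_inner (h : IsDefiningMap I B U F) (hx : x ∈ U) (c : EuclideanSpace ℝ (Fin p)) :
    ContMDiffAt I 𝓘(ℝ, ℝ) ∞ (fun y ↦ inner ℝ c (F y)) x :=
  (innerSL ℝ c).contDiff.contMDiff.contMDiffAt.comp x (h.contMDiffAt hx)

lemma eq_zero_iff (h : IsDefiningMap I B U F) (hx : x ∈ U) : F x = 0 ↔ x ∈ B := by
  have := h.inter_eq
  constructor
  · intro h0
    have hx' : x ∈ {y ∈ U | F y = 0} := ⟨hx, h0⟩
    rw [← this] at hx'
    exact hx'.1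
  · intro h0
    have hx' : x ∈ B ∩ U := ⟨h0, hx⟩
    rw [this] at hx'
    exact hx'.2

lemma isVanishingGerm (h : IsDefiningMap I B U F) (hx : x ∈ U) (c : EuclideanSpace ℝ (Fin p)) :
    IsVanishingGerm I B x (fun y ↦ inner ℝ c (F y)) where
  smooth := by
    filter_upwards [h.isOpen.mem_nhds hx] with y hy using h.contMDiffAt_inner hy c
  vanishes := by
    filter_upwards [mem_nhdsWithin_of_mem_nhds (h.isOpen.mem_nhds hx), self_mem_nhdsWithin]
      with y hy hyB
    rw [(h.eq_zero_iff hy).2 hyB, inner_zero_right]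

lemma mvfderiv_inner (h : IsDefiningMap I B U F) (hx : x ∈ U) (c : EuclideanSpace ℝ (Fin p))
    (v : TangentSpace I x) : d% (fun y ↦ inner ℝ c (F y)) x v = inner ℝ c (d% F x v) := by
  have := mvfderiv_comp_vectorSpace (G := innerSL ℝ c) (innerSL ℝ c).differentiableAt
    ((h.contMDiffAt hx).mdifferentiableAt (by simp)) v
  rw [(innerSL ℝ c).fderiv] at this
  exact this

/-- The tangent space of a submanifold is the kernel of the differential of a defining map. -/
lemma mem_tangentSpaceOf_iff [I.Boundaryless] (h : IsDefiningMap I B U F) (hx : x ∈ U) (hxB : x ∈ B)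
    {v : TangentSpace I x} : v ∈ tangentSpaceOf I B x ↔ d% F x v = 0 := by
  constructor
  · intro hv
    refine ext_inner_left ℝ fun c ↦ ?_
    rw [← h.mvfderiv_inner hx, inner_zero_right]
    have hc := h.isVanishingGerm hx c
    exact hv _ hc.smooth hc.vanishes
  · intro hv f hf hfB
    obtain ⟨X, ψ, hX0, hψ0, hX, hψ⟩ := exists_centred_coordinates I x
    let V := Fin (Module.finrank ℝ E) → ℝ
    have hXx : MDifferentiableAt I 𝓘(ℝ, V) X x := hX.self_of_nhds.1.mdifferentiableAt (by simp)
    have hψx := hψ.self_of_nhds.1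
    have hψd : MDifferentiableAt 𝓘(ℝ, V) I ψ 0 := hψx.mdifferentiableAt (by simp)
    have hψc : Tendsto ψ (𝓝 0) (𝓝 x) := by
      have := hψx.continuousAt
      rwa [ContinuousAt, hψ0] at this
    let A : V →L[ℝ] E := mfderiv 𝓘(ℝ, V) I ψ 0
    have hA (w : E) : A (mvfderiv I X x w) = w := by
      have h1 : MDifferentiableAt 𝓘(ℝ, V) I ψ (X x) := by rwa [hX0]
      have := mfderiv_mvfderiv_of_leftInverse hXx h1 (hX.mono fun q hq ↦ hq.2) w
      rw [hX0] at this
      exact this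
    have hfx := hf.self_of_nhds
    have hFx := h.contMDiffAt hx
    have hF1 : ContDiffAt ℝ ∞ (F ∘ ψ) 0 := by
      have h1 : ContMDiffAt I 𝓘(ℝ, EuclideanSpace ℝ (Fin p)) ∞ F (ψ 0) := by rwa [hψ0]
      exact (h1.comp 0 hψx).contDiffAt
    have hf1 : ContDiffAt ℝ ∞ (f ∘ ψ) 0 := by
      have h1 : ContMDiffAt I 𝓘(ℝ, ℝ) ∞ f (ψ 0) := by rwa [hψ0]
      exact (h1.comp 0 hψx).contDiffAt
    have hdF (u : V) : fderiv ℝ (F ∘ ψ) 0 u = (d% F x : E →L[ℝ] _) (A u) := by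
      have h1 : MDifferentiableAt I 𝓘(ℝ, EuclideanSpace ℝ (Fin p)) F (ψ 0) := by
        rw [hψ0]
        exact hFx.mdifferentiableAt (by simp)
      have h2 := mfderiv_comp (0 : V) h1 hψd
      rw [mfderiv_eq_fderiv, hψ0] at h2
      exact congrArg (fun B : V →L[ℝ] EuclideanSpace ℝ (Fin p) ↦ B u) h2
    have hdf (u : V) : fderiv ℝ (f ∘ ψ) 0 u = (d% f x : E →L[ℝ] ℝ) (A u) := by
      have h1 : MDifferentiableAt I 𝓘(ℝ, ℝ) f (ψ 0) := by
        rw [hψ0]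
        exact hfx.mdifferentiableAt (by simp)
      have h2 := mfderiv_comp (0 : V) h1 hψd
      rw [mfderiv_eq_fderiv, hψ0] at h2
      exact congrArg (fun B : V →L[ℝ] ℝ ↦ B u) h2
    have hdF' (w : TangentSpace I x) : fderiv ℝ (F ∘ ψ) 0 (mvfderiv I X x w) = d% F x w :=
      (hdF _).trans (congrArg (d% F x : E →L[ℝ] EuclideanSpace ℝ (Fin p)) (hA w))
    have hdf' (w : TangentSpace I x) : fderiv ℝ (f ∘ ψ) 0 (mvfderiv I X x w) = d% f x w :=
      (hdf _).trans (congrArg (d% f x : E →L[ℝ] ℝ) (hA w))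
    have hextr : IsLocalExtrOn (f ∘ ψ) {z | (F ∘ ψ) z = (F ∘ ψ) 0} 0 := by
      left
      have h0 : (f ∘ ψ) 0 = 0 := by
        rw [Function.comp_apply, hψ0]
        exact hfB.self_of_nhdsWithin hxB
      change ∀ᶠ z in 𝓝[{z | (F ∘ ψ) z = (F ∘ ψ) 0}] 0, (f ∘ ψ) 0 ≤ (f ∘ ψ) z
      rw [eventually_nhdsWithin_iff] at hfB ⊢
      filter_upwards [hψc.eventually hfB, hψc.eventually (h.isOpen.mem_nhds hx)] with z hz hzU hzF
      rw [h0]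
      refine (hz ((h.eq_zero_iff hzU).1 ?_)).ge
      have : F (ψ z) = F (ψ 0) := hzF
      rw [this, hψ0, h.eq_zero_iff hx]
      exact hxB
    obtain ⟨Λ, Λ₀, hne, hΛ⟩ := hextr.exists_linear_map_of_hasStrictFDerivAt
      (hF1.hasStrictFDerivAt (by simp)) (hf1.hasStrictFDerivAt (by simp))
    have hΛ₀ : Λ₀ ≠ 0 := by
      rintro rfl
      refine hne (Prod.ext (LinearMap.ext fun c ↦ ?_) rfl)
      obtain ⟨w, rfl⟩ := h.surjective x hx c
      have := hΛ (mvfderiv I X x w)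
      rw [hdF', zero_smul, add_zero] at this
      exact this
    have := hΛ (mvfderiv I X x v)
    rw [hdF', hdf', hv, map_zero, zero_add, smul_eq_mul] at this
    exact (mul_eq_zero.1 this).resolve_left hΛ₀

lemma tangentSpaceOf_eq_ker [I.Boundaryless] (h : IsDefiningMap I B U F) (hx : x ∈ U) (hxB : x ∈ B) :
    tangentSpaceOf I B x = LinearMap.ker (d% F x).toLinearMap :=
  Submodule.ext fun _ ↦ h.mem_tangentSpaceOf_iff hx hxB

lemma finrank_orthogonal [I.Boundaryless] (h : IsDefiningMap I B U F) (hx : x ∈ U) (hxB : x ∈ B) :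
    Module.finrank ℝ (tangentSpaceOf I B x)ᗮ = p := by
  have h1 := LinearMap.finrank_range_add_finrank_ker (d% F x).toLinearMap
  rw [LinearMap.range_eq_top.2 (h.surjective x hx), finrank_top, ← h.tangentSpaceOf_eq_ker hx hxB]
    at h1
  have h2 := Submodule.finrank_add_finrank_orthogonal (tangentSpaceOf I B x)
  have h3 : Module.finrank ℝ (EuclideanSpace ℝ (Fin p)) = p := finrank_euclideanSpace_fin
  change Module.finrank ℝ (EuclideanSpace ℝ (Fin p)) + _ = _ at h1
  omega

/-- Normal vectors are gradients of combinations of the components of a defining map. -/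
lemma exists_grad_inner_eq [I.Boundaryless] (h : IsDefiningMap I B U F) (hx : x ∈ U) (hxB : x ∈ B)
    {w : TangentSpace I x} (hw : w ∈ (tangentSpaceOf I B x)ᗮ) :
    ∃ c, grad I (fun y ↦ inner ℝ c (F y)) x = w := by
  let A : TangentSpace I x →ₗ[ℝ] EuclideanSpace ℝ (Fin p) := (d% F x).toLinearMap
  have h1 : (LinearMap.range (LinearMap.adjoint A)) = (tangentSpaceOf I B x)ᗮ := by
    rw [h.tangentSpaceOf_eq_ker hx hxB]
    exact (LinearMap.orthogonal_ker A).symm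
  rw [← h1] at hw
  obtain ⟨c, rfl⟩ := hw
  refine ⟨c, ext_inner_right ℝ fun v ↦ ?_⟩
  rw [inner_grad_left, h.mvfderiv_inner hx, LinearMap.adjoint_inner_left]
  rfl

end IsDefiningMap

variable {p : ℕ} {B U : Set M} {F : M → EuclideanSpace ℝ (Fin p)} {x : M}

lemma IsDefiningMap.linearIndependent_grad (h : IsDefiningMap I B U F) (hx : x ∈ U) :
    LinearIndependent ℝ (fun a ↦ grad I (fun y ↦ inner ℝ (EuclideanSpace.single a 1) (F y)) x) := by
  rw [Fintype.linearIndependent_iff]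
  intro c hc i
  obtain ⟨v, hv⟩ := h.surjective x hx (EuclideanSpace.single i 1)
  have := congrArg (fun w ↦ inner ℝ w v) hc
  simp only [sum_inner, real_inner_smul_left, inner_grad_left, h.mvfderiv_inner hx, hv,
    inner_zero_left] at this
  simpa [EuclideanSpace.inner_single_left, Pi.single_apply] using this

/-- Every vector tangent to a submanifold extends to a smooth tangent vector field. -/
lemma IsDefiningMap.exists_isTangentExtension [I.Boundaryless] (h : IsDefiningMap I B U F)
    (hx : x ∈ U) (hxB : x ∈ B) {w : TangentSpace I x} (hw : w ∈ tangentSpaceOf I B x) :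
    ∃ W : Π y : M, TangentSpace I y, IsTangentExtension I B x w W := by
  obtain ⟨f, hf, rfl⟩ := exists_grad_eq w
  let e (a : Fin p) : EuclideanSpace ℝ (Fin p) := EuclideanSpace.single a 1
  let G (a : Fin p) (y : M) : ℝ := inner ℝ (e a) (F y)
  let A (y : M) : Matrix (Fin p) (Fin p) ℝ := Matrix.gram ℝ (fun a ↦ grad I (G a) y)
  let κ (a : Fin p) (y : M) : ℝ := ∑ b, (A y)⁻¹ a b * inner ℝ (grad I (G b) y) (grad I f y)
  let W (y : M) : TangentSpace I y := grad I f y - ∑ a, κ a y • grad I (G a) y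
  have hdet {y : M} (hy : y ∈ U) : (A y).det ≠ 0 :=
    (Matrix.posDef_gram_of_linearIndependent (h.linearIndependent_grad hy)).det_pos.ne'
  have hG {y : M} (hy : y ∈ U) (a) : ContMDiffAt I 𝓘(ℝ, ℝ) ∞ (G a) y := h.contMDiffAt_inner hy (e a)
  refine ⟨W, ⟨?_, ?_, ?_⟩⟩
  · filter_upwards [h.isOpen.mem_nhds hx, hf] with y hy hfy
    have h1 (a) : ContMDiffAt I I.tangent ∞ (T% (grad I (G a))) y :=
      ContMDiffAt.grad (k := ⊤) (hG hy a)
    have h2 : ContMDiffAt I I.tangent ∞ (T% (grad I f)) y := ContMDiffAt.grad (k := ⊤) hfy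
    have h3 (a) : ContMDiffAt I 𝓘(ℝ, ℝ) ∞ (κ a) y := by
      refine contMDiffAt_finsetSum fun b _ ↦ ContMDiffAt.mul ?_ ?_
      · exact ContMDiffAt.matrix_inv
          (fun i j ↦ ContMDiffAt.inner_grad (k := ⊤) (hG hy i) (hG hy j)) (hdet hy) a b
      · exact ContMDiffAt.inner_grad (k := ⊤) (hG hy b) hfy
    exact h2.sub_section (ContMDiffAt.sum_section fun a _ ↦ (h3 a).smul_section (h1 a))
  · have h0 (a) : κ a x = 0 := by
      refine Finset.sum_eq_zero fun b _ ↦ ?_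
      rw [inner_grad_left, h.mvfderiv_inner hx, (h.mem_tangentSpaceOf_iff hx hxB).1 hw,
        inner_zero_right, mul_zero]
    simp only [W, h0, zero_smul, Finset.sum_const_zero, sub_zero]
  · filter_upwards [mem_nhdsWithin_of_mem_nhds (h.isOpen.mem_nhds hx), self_mem_nhdsWithin]
      with y hy hyB
    rw [h.mem_tangentSpaceOf_iff hy hyB]
    have hin (c) : inner ℝ (e c) (d% F y (W y)) = 0 := by
      have hA : A y * (A y)⁻¹ = 1 := Matrix.mul_nonsing_inv _ (hdet hy).isUnit
      have hAe (a) : inner ℝ (grad I (G c) y) (grad I (G a) y) = A y c a := rfl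
      have hsum : ∑ a, κ a y * A y c a = inner ℝ (grad I (G c) y) (grad I f y) := by
        simp only [κ, Finset.sum_mul]
        rw [Finset.sum_comm]
        have hb (b : Fin p) : ∑ a, (A y)⁻¹ a b * inner ℝ (grad I (G b) y) (grad I f y) * A y c a =
            (if c = b then 1 else 0) * inner ℝ (grad I (G b) y) (grad I f y) := by
          rw [← Matrix.one_apply, ← hA, Matrix.mul_apply, Finset.sum_mul]
          exact Finset.sum_congr rfl fun a _ ↦ by ring
        simp only [hb]
        simp
      rw [← h.mvfderiv_inner hy]
      change d% (G c) y (W y) = 0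
      rw [← inner_grad_left, inner_sub_right, inner_sum]
      simp only [real_inner_smul_right, hAe, hsum, sub_self]
    ext c
    have := hin c
    simpa [e, EuclideanSpace.inner_single_left] using this

lemma IsVanishingGerm.inner_leviCivita_eq {f : M → ℝ} (hf : IsVanishingGerm I B x f)
    {v w : TangentSpace I x} (hv : v ∈ tangentSpaceOf I B x) {W : Π y : M, TangentSpace I y}
    (hW : IsTangentExtension I B x w W) :
    inner ℝ (leviCivita I M W x v) (grad I f x) = -hess I f x v w := by
  have hW1 : MDiffAt (T% W) x := hW.smooth.self_of_nhds.mdifferentiableAt (by simp)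
  have h1 := hess_eq_sub (hf.smooth.self_of_nhds.of_le two_le_infty) hW1 v
  have h2 : d% (fun y ↦ d% f y (W y)) x v = 0 := by
    refine hv _ ?_ ?_
    · filter_upwards [hf.smooth, hW.smooth] with y hy hWy
      exact ContMDiffAt.mvfderiv_apply (by simpa using hy) hWy
    · have hs : ∀ᶠ y in 𝓝[B] x, ∀ᶠ z in 𝓝 y, ContMDiffAt I 𝓘(ℝ, ℝ) ∞ f z :=
        mem_nhdsWithin_of_mem_nhds hf.smooth.eventually_nhds
      have hv' : ∀ᶠ y in 𝓝[B] x, ∀ᶠ z in 𝓝[B] y, f z = 0 :=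
        eventually_eventually_nhdsWithin.2 hf.vanishes
      filter_upwards [hs, hv', hW.tangent] with y h3 h4 h5
      exact h5 f h3 h4
  rw [h2, hW.apply_eq, zero_sub] at h1
  rw [inner_grad_right, h1, neg_neg]

lemma IsVanishingGerm.grad_mem_orthogonal {f : M → ℝ} (hf : IsVanishingGerm I B x f) :
    grad I f x ∈ (tangentSpaceOf I B x)ᗮ := by
  rw [Submodule.mem_orthogonal']
  intro v hv
  rw [inner_grad_left]
  exact hv f hf.smooth hf.vanishes

/-- The mean curvature of a submanifold paired with the gradient of a function which
vanishes on it. -/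
lemma IsDefiningMap.inner_meanCurvature_grad [I.Boundaryless] (h : IsDefiningMap I B U F)
    (hx : x ∈ U) (hxB : x ∈ B) {f : M → ℝ} (hf : IsVanishingGerm I B x f) :
    inner ℝ (meanCurvature I B x) (grad I f x) =
      -∑ i, hess I f x (stdOrthonormalBasis ℝ (tangentSpaceOf I B x) i)
        (stdOrthonormalBasis ℝ (tangentSpaceOf I B x) i) := by
  rw [meanCurvature, sum_inner, ← Finset.sum_neg_distrib]
  refine Finset.sum_congr rfl fun i _ ↦ ?_
  have hmem := (stdOrthonormalBasis ℝ (tangentSpaceOf I B x) i).2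
  have hex := h.exists_isTangentExtension hx hxB hmem
  rw [secondFundamentalForm, dif_pos hex, Submodule.inner_starProjection_left_eq_right,
    Submodule.starProjection_eq_self_iff.2 hf.grad_mem_orthogonal,
    hf.inner_leviCivita_eq hmem hex.choose_spec]

lemma meanCurvature_mem_orthogonal (B : Set M) (x : M) :
    meanCurvature I B x ∈ (tangentSpaceOf I B x)ᗮ := by
  refine Submodule.sum_mem _ fun i _ ↦ ?_
  rw [secondFundamentalForm]
  split_ifs
  · exact Submodule.starProjection_apply_mem _ _
  · exact Submodule.zero_mem _

lemma IsDefiningMap.meanCurvature_eq_zero_iff [I.Boundaryless] (h : IsDefiningMap I B U F)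
    (hx : x ∈ U) (hxB : x ∈ B) : meanCurvature I B x = 0 ↔ ∀ c,
      ∑ i, hess I (fun y ↦ inner ℝ c (F y)) x (stdOrthonormalBasis ℝ (tangentSpaceOf I B x) i)
        (stdOrthonormalBasis ℝ (tangentSpaceOf I B x) i) = 0 := by
  constructor
  · intro h0 c
    have := h.inner_meanCurvature_grad hx hxB (h.isVanishingGerm hx c)
    rwa [h0, inner_zero_left, zero_eq_neg] at this
  · intro h0
    obtain ⟨c, hc⟩ := h.exists_grad_inner_eq hx hxB (meanCurvature_mem_orthogonal B x)
    have := h.inner_meanCurvature_grad hx hxB (h.isVanishingGerm hx c)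
    rw [h0 c, hc, neg_zero] at this
    exact inner_self_eq_zero.1 this

end RiemGeom

end Submanifold

/-- The trace over a subspace, in terms of the trace and an orthogonal basis of the complement. -/
lemma LinearMap.sum_inner_stdOrthonormalBasis_eq {V : Type*} [NormedAddCommGroup V]
    [InnerProductSpace ℝ V] [FiniteDimensional ℝ V] (A : V →ₗ[ℝ] V) (K : Submodule ℝ V)
    {κ : Type*} [Fintype κ] [DecidableEq κ] {h : κ → V} (hK : ∀ a, h a ∈ Kᗮ) {μ : ℝ} (hμ : 0 < μ)
    (horth : ∀ a b, inner ℝ (h a) (h b) = if a = b then μ else 0)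
    (hcard : Fintype.card κ = Module.finrank ℝ Kᗮ) :
    ∑ i, inner ℝ (A (stdOrthonormalBasis ℝ K i)) (stdOrthonormalBasis ℝ K i : V) =
      LinearMap.trace ℝ V A - μ⁻¹ * ∑ a, inner ℝ (A (h a)) (h a) := by
  let s : ℝ := (√μ)⁻¹
  have hs : s * s = μ⁻¹ := by rw [← mul_inv, Real.mul_self_sqrt hμ.le]
  let h' (a : κ) : Kᗮ := ⟨s • h a, Submodule.smul_mem _ _ (hK a)⟩
  have hon : Orthonormal ℝ h' := by
    rw [orthonormal_iff_ite]
    intro a b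
    rw [Submodule.coe_inner, real_inner_smul_left, real_inner_smul_right, horth, ← mul_assoc, hs]
    split_ifs
    exacts [inv_mul_cancel₀ hμ.ne', mul_zero _]
  let b : OrthonormalBasis κ ℝ Kᗮ := OrthonormalBasis.mk hon
    (hon.linearIndependent.span_eq_top_of_card_eq_finrank' hcard).ge
  have hb (a) : (b a : V) = s • h a := by simp [b, h']
  let e := ((stdOrthonormalBasis ℝ K).prod b).map K.orthogonalDecomposition.symm
  rw [LinearMap.trace_eq_sum_inner A e, Fintype.sum_sum_type]
  have h1 (i) : e (Sum.inl i) = stdOrthonormalBasis ℝ K i := by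
    simp [e]
  have h2 (a) : e (Sum.inr a) = s • h a := by
    simp [e, hb]
  simp only [h1, h2, map_smul, real_inner_smul_left, real_inner_smul_right, ← mul_assoc, hs]
  simp only [← Finset.mul_sum, real_inner_comm (A _)]
  ring

section HarmonicMorphism

variable {E : Type*} [NormedAddCommGroup E] [NormedSpace ℝ E] [FiniteDimensional ℝ E]
  {H : Type*} [TopologicalSpace H] {I : ModelWithCorners ℝ E H}
  {M : Type*} [TopologicalSpace M] [ChartedSpace H M] [IsManifold I ∞ M]
  [RiemannianBundle (fun x : M ↦ TangentSpace I x)]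
  [IsContMDiffRiemannianBundle I ∞ E (fun x : M ↦ TangentSpace I x)]
  {E' : Type*} [NormedAddCommGroup E'] [NormedSpace ℝ E'] [FiniteDimensional ℝ E']
  {H' : Type*} [TopologicalSpace H'] {J : ModelWithCorners ℝ E' H'}
  {N : Type*} [TopologicalSpace N] [ChartedSpace H' N] [IsManifold J ∞ N]
  [RiemannianBundle (fun y : N ↦ TangentSpace J y)]
  [IsContMDiffRiemannianBundle J ∞ E' (fun y : N ↦ TangentSpace J y)]

namespace RiemGeom

lemma IsDefiningMap.comp {p : ℕ} {B U : Set N} {F : N → EuclideanSpace ℝ (Fin p)}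
    (h : IsDefiningMap J B U F) {φ : M → N} (hφ : ContMDiff I J ∞ φ) (hs : IsSubmersive I J φ) :
    IsDefiningMap I (φ ⁻¹' B) (φ ⁻¹' U) (F ∘ φ) where
  isOpen := h.isOpen.preimage hφ.continuous
  contMDiffOn := h.contMDiffOn.comp hφ.contMDiffOn fun _ hx ↦ hx
  surjective x hx c := by
    obtain ⟨w, hw⟩ := h.surjective (φ x) hx c
    obtain ⟨v, hv⟩ := hs x w
    refine ⟨v, ?_⟩
    have h1 : MDifferentiableAt J 𝓘(ℝ, EuclideanSpace ℝ (Fin p)) F (φ x) :=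
      (h.contMDiffAt hx).mdifferentiableAt (by simp)
    have h2 : d% (F ∘ φ) x v = d% F (φ x) (mfderiv I J φ x v) :=
      congrArg (fun A : E →L[ℝ] EuclideanSpace ℝ (Fin p) ↦ A v)
        (mfderiv_comp x h1 (hφ.contMDiffAt.mdifferentiableAt (by simp)))
    rw [h2, hv, hw]
  inter_eq := by
    ext x
    exact Set.ext_iff.1 h.inter_eq (φ x)

variable (I J) in
/-- The square of the dilation of a horizontally conformal map. -/
noncomputable def dilationSq (φ : M → N) (x : M) : ℝ :=
  normSqDifferential I J φ x / Module.finrank ℝ E'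

lemma IsHarmonicMorphism.mdifferentiableAt_dilationSq [J.Boundaryless]
    (hn : Module.finrank ℝ E' ≠ 0) {φ : M → N} (hφ : IsHarmonicMorphism I J φ) (x : M) :
    MDiffAt (dilationSq I J φ) x := by
  have h : dilationSq I J φ =
      fun y ↦ (Module.finrank ℝ E' : ℝ)⁻¹ * normSqDifferential I J φ y :=
    funext fun y ↦ div_eq_inv_mul _ _
  rw [h]
  exact mdifferentiableAt_const.mul (hφ.mdifferentiableAt_normSqDifferential hn x)

lemma IsHarmonicMorphism.mfderiv_grad_comp [J.Boundaryless]
    (hn : Module.finrank ℝ E' ≠ 0) {φ : M → N} (hφ : IsHarmonicMorphism I J φ) (x : M) {f : N → ℝ}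
    (hf : ContMDiffAt J 𝓘(ℝ, ℝ) 2 f (φ x)) :
    mfderiv I J φ x (grad I (f ∘ φ) x) = dilationSq I J φ x • grad J f (φ x) := by
  refine ext_inner_left ℝ fun w ↦ ?_
  obtain ⟨g, hg, rfl⟩ := exists_grad_eq w
  have hg2 := hg.self_of_nhds.of_le two_le_infty
  rw [inner_grad_left, ← mvfderiv_comp_map (hg2.mdifferentiableAt two_ne_zero)
    (hφ.smooth.contMDiffAt.mdifferentiableAt (by simp)), ← inner_grad_left,
    hφ.inner_grad_comp hn x hg2 hf, real_inner_smul_right]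
  rfl

/-- The Hessian of the composition with a harmonic morphism, along a horizontal gradient. -/
lemma IsHarmonicMorphism.hess_comp_grad_grad [I.Boundaryless] [J.Boundaryless]
    (hn : Module.finrank ℝ E' ≠ 0) {φ : M → N} (hφ : IsHarmonicMorphism I J φ) (x : M) {f g : N → ℝ}
    (hf : ContMDiffAt J 𝓘(ℝ, ℝ) 2 f (φ x)) (hg : ContMDiffAt J 𝓘(ℝ, ℝ) 2 g (φ x)) :
    hess I (f ∘ φ) x (grad I (g ∘ φ) x) (grad I (g ∘ φ) x) =
      dilationSq I J φ x ^ 2 * hess J f (φ x) (grad J g (φ x)) (grad J g (φ x)) +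
      inner ℝ (grad J f (φ x)) (grad J g (φ x)) *
        d% (dilationSq I J φ) x (grad I (g ∘ φ) x) -
      1 / 2 * inner ℝ (grad J g (φ x)) (grad J g (φ x)) *
        d% (dilationSq I J φ) x (grad I (f ∘ φ) x) := by
  have hφx : ContMDiffAt I J 2 φ x := hφ.smooth.contMDiffAt.of_le two_le_infty
  have hφd : MDifferentiableAt I J φ x := hφx.mdifferentiableAt two_ne_zero
  have hev {f : N → ℝ} (hf : ContMDiffAt J 𝓘(ℝ, ℝ) 2 f (φ x)) :
      ∀ᶠ q in 𝓝 x, ContMDiffAt J 𝓘(ℝ, ℝ) 2 f (φ q) :=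
    hφx.continuousAt.eventually ((contMDiffAt_iff_contMDiffAt_nhds (by simp)).1 hf)
  have key {f g : N → ℝ} (hf : ContMDiffAt J 𝓘(ℝ, ℝ) 2 f (φ x))
      (hg : ContMDiffAt J 𝓘(ℝ, ℝ) 2 g (φ x)) (v : TangentSpace I x) :
      d% (fun q ↦ inner ℝ (grad I (f ∘ φ) q) (grad I (g ∘ φ) q)) x v =
        inner ℝ (grad J f (φ x)) (grad J g (φ x)) * d% (dilationSq I J φ) x v +
        dilationSq I J φ x *
          d% (fun y ↦ inner ℝ (grad J f y) (grad J g y)) (φ x) (mfderiv I J φ x v) := by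
    let r (y : N) : ℝ := inner ℝ (grad J f y) (grad J g y)
    have hr : MDifferentiableAt J 𝓘(ℝ, ℝ) r (φ x) :=
      (ContMDiffAt.inner_grad (k := 1) (hf.of_le (by norm_num)) (hg.of_le (by norm_num))
        ).mdifferentiableAt one_ne_zero
    have h1 : (fun q ↦ inner ℝ (grad I (f ∘ φ) q) (grad I (g ∘ φ) q)) =ᶠ[𝓝 x]
        fun q ↦ dilationSq I J φ q * (r ∘ φ) q := by
      filter_upwards [hev hf, hev hg] with q h1 h2
      exact hφ.inner_grad_comp hn q h1 h2
    rw [h1.mvfderiv_eq, mvfderiv_fun_mul (hφ.mdifferentiableAt_dilationSq hn x) (hr.comp x hφd)]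
    simp only [add_apply, smul_apply, smul_eq_mul]
    rw [mvfderiv_comp_map hr hφd]
    simp only [r, Function.comp_apply]
    ring
  rw [hess_grad_grad (hf.comp x hφx) (hg.comp x hφx) (hg.comp x hφx), hess_grad_grad hf hg hg,
    key hf hg, key hg hg, hφ.mfderiv_grad_comp hn x hf, hφ.mfderiv_grad_comp hn x hg]
  simp only [map_smul, smul_eq_mul]
  ring

/-- The trace of the Hessian over the tangent space of the preimage of a submanifold
under a harmonic morphism. -/
lemma IsHarmonicMorphism.sum_hess_comp [I.Boundaryless] [J.Boundaryless]
    (hn : Module.finrank ℝ E' ≠ 0) {φ : M → N} (hφ : IsHarmonicMorphism I J φ)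
    (hs : IsSubmersive I J φ) {p : ℕ} {B U : Set N} {F : N → EuclideanSpace ℝ (Fin p)}
    (h : IsDefiningMap J B U F) {x : M} (hxU : φ x ∈ U) (hxB : φ x ∈ B)
    (c : EuclideanSpace ℝ (Fin p)) :
    ∑ i, hess I (fun y ↦ inner ℝ c ((F ∘ φ) y)) x
        (stdOrthonormalBasis ℝ (tangentSpaceOf I (φ ⁻¹' B) x) i)
        (stdOrthonormalBasis ℝ (tangentSpaceOf I (φ ⁻¹' B) x) i) =
      dilationSq I J φ x * ∑ i, hess J (fun y ↦ inner ℝ c (F y)) (φ x)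
        (stdOrthonormalBasis ℝ (tangentSpaceOf J B (φ x)) i)
        (stdOrthonormalBasis ℝ (tangentSpaceOf J B (φ x)) i) -
      (dilationSq I J φ x)⁻¹ * (1 - p / 2) *
        inner ℝ c (d% F (φ x) (mfderiv I J φ x (grad I (dilationSq I J φ) x))) := by
  have hφd : MDifferentiableAt I J φ x := hφ.smooth.contMDiffAt.mdifferentiableAt (by simp)
  have hμ : 0 < dilationSq I J φ x := div_pos (hφ.normSqDifferential_pos hn (hs x))
    (by exact_mod_cast Nat.pos_of_ne_zero hn)
  set μ := dilationSq I J φ x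
  have h' := h.comp hφ.smooth hs
  let f (c : EuclideanSpace ℝ (Fin p)) (y : N) : ℝ := inner ℝ c (F y)
  have hf2 (c) : ContMDiffAt J 𝓘(ℝ, ℝ) 2 (f c) (φ x) :=
    (h.contMDiffAt_inner hxU c).of_le two_le_infty
  let b := (stdOrthonormalBasis ℝ (tangentSpaceOf J B (φ x))ᗮ).reindex
    (finCongr (h.finrank_orthogonal hxU hxB))
  choose d hd using fun a ↦ h.exists_grad_inner_eq hxU hxB (b a).2
  have hd' (a) : grad J (f (d a)) (φ x) = b a := hd a
  have hbo (a a') : inner ℝ (b a : TangentSpace J (φ x)) (b a') = if a = a' then 1 else 0 :=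
    orthonormal_iff_ite.1 b.orthonormal a a'
  have e1 := LinearMap.sum_inner_stdOrthonormalBasis_eq
    (leviCivita J N (grad J (f c)) (φ x)).toLinearMap (tangentSpaceOf J B (φ x))
    (fun a ↦ (b a).2) zero_lt_one hbo (by rw [Fintype.card_fin, h.finrank_orthogonal hxU hxB])
  have e2 := LinearMap.sum_inner_stdOrthonormalBasis_eq
    (leviCivita I M (grad I (f c ∘ φ)) x).toLinearMap (tangentSpaceOf I (φ ⁻¹' B) x)
    (h := fun a ↦ grad I (f (d a) ∘ φ) x)
    (fun a ↦ (h'.isVanishingGerm (x := x) hxU (d a)).grad_mem_orthogonal) hμ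
    (fun a a' ↦ by
      rw [hφ.inner_grad_comp hn x (hf2 _) (hf2 _), hd', hd', hbo, mul_ite, mul_one, mul_zero]
      rfl)
    (by rw [Fintype.card_fin, h'.finrank_orthogonal (x := x) hxU hxB])
  change ∑ i, hess I (f c ∘ φ) x _ _ = laplacian I (f c ∘ φ) x -
    _ * ∑ a, hess I (f c ∘ φ) x _ _ at e2
  change ∑ i, hess J (f c) (φ x) _ _ = laplacian J (f c) (φ x) -
    _ * ∑ a, hess J (f c) (φ x) _ _ at e1
  have hlap : laplacian I (f c ∘ φ) x = μ * laplacian J (f c) (φ x) :=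
    hφ.laplacian_comp hn x (hf2 c)
  let z := mfderiv I J φ x (grad I (dilationSq I J φ) x)
  have hdz (c) : d% (dilationSq I J φ) x (grad I (f c ∘ φ) x) =
      inner ℝ (grad J (f c) (φ x)) z := by
    rw [← inner_grad_left, real_inner_comm, inner_grad_left, inner_grad_left,
      mvfderiv_comp_map ((hf2 c).mdifferentiableAt two_ne_zero) hφd]
  have hexp : ∑ a, inner ℝ (grad J (f c) (φ x)) (b a : TangentSpace J (φ x)) *
      inner ℝ (b a : TangentSpace J (φ x)) z = inner ℝ (grad J (f c) (φ x)) z := by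
    have hmem := (h.isVanishingGerm hxU c).grad_mem_orthogonal
    have h1 := congrArg (Subtype.val) (b.sum_repr' ⟨_, hmem⟩)
    have h2 := congrArg (fun w ↦ inner ℝ w z) h1
    simp only [Submodule.coe_sum, Submodule.coe_smul, sum_inner, real_inner_smul_left,
      Submodule.coe_inner] at h2
    rw [← h2]
    exact Finset.sum_congr rfl fun a _ ↦ by rw [real_inner_comm]
  have hfz : inner ℝ (grad J (f c) (φ x)) z = inner ℝ c (d% F (φ x) z) := by
    rw [inner_grad_left, h.mvfderiv_inner hxU]
  have hterm (a) : hess I (f c ∘ φ) x (grad I (f (d a) ∘ φ) x) (grad I (f (d a) ∘ φ) x) =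
      μ ^ 2 * hess J (f c) (φ x) (b a) (b a) +
      inner ℝ (grad J (f c) (φ x)) (b a : TangentSpace J (φ x)) *
        inner ℝ (b a : TangentSpace J (φ x)) z - 1 / 2 * inner ℝ (grad J (f c) (φ x)) z := by
    rw [hφ.hess_comp_grad_grad hn x (hf2 c) (hf2 (d a)), hdz, hdz, hd', hbo, if_pos rfl, mul_one]
  change ∑ i, hess I (f c ∘ φ) x _ _ = μ * ∑ i, hess J (f c) (φ x) _ _ -
    μ⁻¹ * (1 - p / 2) * inner ℝ c (d% F (φ x) z)
  rw [e1, e2, hlap, ← hfz]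
  simp only [hterm, Finset.sum_sub_distrib, Finset.sum_add_distrib, hexp, ← Finset.mul_sum,
    Finset.sum_const, Finset.card_univ, Fintype.card_fin, nsmul_eq_mul]
  field_simp
  ring

lemma IsHarmonicMorphism.grad_normSqDifferential [J.Boundaryless]
    (hn : Module.finrank ℝ E' ≠ 0) {φ : M → N} (hφ : IsHarmonicMorphism I J φ) (x : M) :
    grad I (normSqDifferential I J φ) x =
      (Module.finrank ℝ E' : ℝ) • grad I (dilationSq I J φ) x := by
  have hn' : (Module.finrank ℝ E' : ℝ) ≠ 0 := by exact_mod_cast hn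
  have h : normSqDifferential I J φ =
      fun y ↦ (Module.finrank ℝ E' : ℝ) * dilationSq I J φ y :=
    funext fun y ↦ (mul_div_cancel₀ _ hn').symm
  refine ext_inner_right ℝ fun v ↦ ?_
  rw [inner_grad_left, real_inner_smul_left, inner_grad_left, h,
    mvfderiv_fun_mul mdifferentiableAt_const (hφ.mdifferentiableAt_dilationSq hn x)]
  simp [mvfderiv_const]

/-- At each point, the mean curvature of the preimage of a minimal submanifold vanishes if and only
if the gradient of `‖dφ‖²` is mapped to a tangent vector. -/
lemma IsHarmonicMorphism.meanCurvature_preimage_eq_zero_iff [I.Boundaryless] [J.Boundaryless]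
    {φ : M → N} (hφ : IsHarmonicMorphism I J φ)
    (hs : IsSubmersive I J φ) {p : ℕ} (hp : p ≠ 2) {B U : Set N} {F : N → EuclideanSpace ℝ (Fin p)}
    (h : IsDefiningMap J B U F) {x : M} (hxU : φ x ∈ U) (hxB : φ x ∈ B)
    (hmin : meanCurvature J B (φ x) = 0) :
    mfderiv I J φ x (grad I (normSqDifferential I J φ) x) ∈ tangentSpaceOf J B (φ x) ↔
      meanCurvature I (φ ⁻¹' B) x = 0 := by
  have h' := h.comp hφ.smooth hs
  rcases eq_or_ne p 0 with rfl | hp0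
  · have h1 : (tangentSpaceOf I (φ ⁻¹' B) x)ᗮ = ⊥ :=
      Submodule.finrank_eq_zero.1 (h'.finrank_orthogonal (x := x) hxU hxB)
    have h2 : meanCurvature I (φ ⁻¹' B) x = 0 := by
      have := meanCurvature_mem_orthogonal (I := I) (φ ⁻¹' B) x
      rwa [h1, Submodule.mem_bot] at this
    refine iff_of_true ?_ h2
    rw [h.mem_tangentSpaceOf_iff hxU hxB]
    exact Subsingleton.elim _ _
  have hn : Module.finrank ℝ E' ≠ 0 := by
    have h1 := LinearMap.finrank_le_finrank_of_surjective
      (f := (d% F (φ x)).toLinearMap) (h.surjective (φ x) hxU)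
    have h2 : Module.finrank ℝ (EuclideanSpace ℝ (Fin p)) ≤ Module.finrank ℝ E' := h1
    rw [finrank_euclideanSpace_fin] at h2
    omega
  have hn' : (Module.finrank ℝ E' : ℝ) ≠ 0 := by exact_mod_cast hn
  have hμ : dilationSq I J φ x ≠ 0 := div_ne_zero (hφ.normSqDifferential_pos hn (hs x)).ne' hn'
  have hp' : (1 - p / 2 : ℝ) ≠ 0 := by
    intro h0
    refine hp ?_
    have : (p : ℝ) = 2 := by linarith
    exact_mod_cast this
  have hmin' := (h.meanCurvature_eq_zero_iff hxU hxB).1 hmin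
  rw [h'.meanCurvature_eq_zero_iff (x := x) hxU hxB, h.mem_tangentSpaceOf_iff hxU hxB,
    hφ.grad_normSqDifferential hn, map_smul, map_smul, smul_eq_zero_iff_right hn']
  simp only [hφ.sum_hess_comp hn hs h hxU hxB, hmin', mul_zero, zero_sub, neg_eq_zero, mul_eq_zero,
    inv_eq_zero, hμ, hp', false_or]
  exact ⟨fun h0 c ↦ by rw [h0, inner_zero_right], fun h0 ↦ ext_inner_left ℝ fun c ↦ by
    rw [h0 c, inner_zero_right]⟩

end RiemGeom

end HarmonicMorphism

end Geometry

theorem mainTheorem3 {m n : ℕ}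
    {M : Type*} [TopologicalSpace M] [T2Space M] [ChartedSpace (EuclideanSpace ℝ (Fin m)) M]
    [IsManifold (𝓡 m) ∞ M] [RiemannianBundle (fun x : M ↦ TangentSpace (𝓡 m) x)]
    [IsContMDiffRiemannianBundle (𝓡 m) ∞ (EuclideanSpace ℝ (Fin m))
      (fun x : M ↦ TangentSpace (𝓡 m) x)]
    {N : Type*} [TopologicalSpace N] [T2Space N] [ChartedSpace (EuclideanSpace ℝ (Fin n)) N]
    [IsManifold (𝓡 n) ∞ N] [RiemannianBundle (fun y : N ↦ TangentSpace (𝓡 n) y)]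
    [IsContMDiffRiemannianBundle (𝓡 n) ∞ (EuclideanSpace ℝ (Fin n))
      (fun y : N ↦ TangentSpace (𝓡 n) y)]
    (φ : M → N) (hφ : IsHarmonicMorphism (𝓡 m) (𝓡 n) φ) (hsub : IsSubmersive (𝓡 m) (𝓡 n) φ)
    (p : ℕ) (hp : p ≠ 2) (B : Set N) (hB : IsMinimalSubmanifold (𝓡 n) p B) :
    (∀ x ∈ φ ⁻¹' B,
      mfderiv (𝓡 m) (𝓡 n) φ x (grad (𝓡 m) (normSqDifferential (𝓡 m) (𝓡 n) φ) x) ∈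
        tangentSpaceOf (𝓡 n) B (φ x)) ↔
    IsMinimalSubmanifold (𝓡 m) p (φ ⁻¹' B) := by
  have hdef := isSubmanifold_iff.1 hB.isSubmanifold
  have key (x : M) (hx : x ∈ φ ⁻¹' B) :
      mfderiv (𝓡 m) (𝓡 n) φ x (grad (𝓡 m) (normSqDifferential (𝓡 m) (𝓡 n) φ) x) ∈
        tangentSpaceOf (𝓡 n) B (φ x) ↔ meanCurvature (𝓡 m) (φ ⁻¹' B) x = 0 := by
    obtain ⟨U, F, hxU, hF⟩ := hdef (φ x) hx
    exact hφ.meanCurvature_preimage_eq_zero_iff hsub hp hF hxU hx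
      (hB.meanCurvature_eq_zero _ hx)
  refine (forall₂_congr key).trans ⟨fun h ↦ ⟨isSubmanifold_iff.2 fun x hx ↦ ?_, h⟩,
    fun h ↦ h.meanCurvature_eq_zero⟩
  obtain ⟨U, F, hxU, hF⟩ := hdef (φ x) hx
  exact ⟨φ ⁻¹' U, F ∘ φ, hxU, hF.comp hφ.smooth hsub⟩
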